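/- Let $n,s,l$ be non-negative integers and work over the field $\mathbb{C}(q)$. For $m\ge 0$ put $I_{m|m}=\{-m,\dots,-1,1,\dots,m\}$, with parity $|i|=\bar 0$ if $i>0$ and $|i|=\bar 1$ if $i<0$; the matrix unit $E_{ij}$ has parity $|i|+|j|$, and all tensor products of superalgebras are multiplied by the sign rule $(a\otimes b)(c\otimes d)=(-1)^{|b||c|}ac\otimes bd$. Let $\xi=q-q^{-1}$, $\varphi(i,j)=(-1)^{|j|}(\delta_{i,j}+\delta_{i,-j})$ and, for indices in $I_{m|m}$, $$S=\sum_{i,j}q^{\varphi(i,j)}E_{ii}\otimes E_{jj}+\xi\sum_{i<j}(-1)^{|i|}(E_{ji}+E_{-j,-i})\otimes E_{ij},$$ $$S^{-1}=\sum_{i,j}q^{-\varphi(i,j)}E_{ii}\otimes E_{jj}-\xi\sum_{i<j}(-1)^{|i|}(E_{ji}+E_{-j,-i})\otimes E_{ij}.$$ In what follows plain superscripts denote the tensor positions of matrix legs and bracketed superscripts those of algebra legs. The quantum queer superalgebra $\mathrm{U}_q(\mathfrak{q}_n)$ is the unital associative superalgebra generated by $L_{ij}$ of parity $|i|+|j|$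 ($i,j\in I_{n|n}$, $i\le j$; $L_{ij}=0$ for $i>j$) with relations $L_{ii}L_{-i,-i}=1=L_{-i,-i}L_{ii}$ and $L^{[1]2}L^{[1]3}S^{23}=S^{23}L^{[1]3}L^{[1]2}$, where $L=\sum_{i\le j} L_{ij}\otimes E_{ij}$. Its comultiplication and counit are given by $\Delta(L)=L\otimes L$, i.e. $\Delta(L_{ij})=\sum_k(-1)^{(|i|+|k|)(|k|+|j|)}L_{ik}\otimes L_{kj}$, and $\varepsilon(L_{ij})=\delta_{ij}$. A $\mathrm{U}_q(\mathfrak{q}_n)$-supermodule superalgebra is a unital associative superalgebra $B$ that is a $\mathrm{U}_q(\mathfrak{q}_n)$-supermodule with $u.(ab)=\sum_{(u)}(-1)^{|u_{(2)}||a|}(u_{(1)}.a)(u_{(2)}.b)$ and $u.1=\varepsilon(u)1$. On a tensor product of supermodules, $u.(x\otimes y)=\sum_{(u)}(-1)^{|u_{(2)}||x|}u_{(1)}.x\otimes u_{(2)}.y$. Homomorphisms of supermodules preserve parity. For $m\ge0$ let $\bar{\mathsf A}_{m,n}$ be the unital associative superalgebra generated by $\bar t_{\alpha b}$ of parity $|\alpha|+|b|$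 ($\alpha\in I_{m|m}$, $b\in I_{n|n}$) with relations $$\bar t_{\alpha b}=(-1)^{|\alpha|+|b|}\bar t_{-\alpha,-b},\qquad \bar T^{1[3]}\bar T^{2[3]}S^{12}=S^{12}\bar T^{2[3]}\bar T^{1[3]},\qquad \bar T=\sum_{\alpha,b}(-1)^{|b|(|\alpha|+|b|)}E_{b\alpha}\otimes\bar t_{\alpha b}.$$ For $s+p\le m$ let $\bar\iota_p:\bar{\mathsf A}_{s,n}\to\bar{\mathsf A}_{m,n}$ be the superalgebra homomorphism with $\bar t_{\alpha a}\mapsto\bar t_{\alpha-p,a}$ for $\alpha=-1,\dots,-s$ and $a\in I_{n|n}$. Then the following hold. 1. For every $m\ge 0$ there is a unique action $\bar\Phi$ of $\mathrm{U}_q(\mathfrak{q}_n)$ making $\bar{\mathsf A}_{m,n}$ a $\mathrm{U}_q(\mathfrak{q}_n)$-supermodule superalgebra with $L^{[2]3}\cdot\bar T^{1[2]}=(S^{-1})^{13}\bar T^{1[2]}$, where, writing $\bar T=\sum E_{b\alpha}\otimes \bar T_{b\alpha}$, the left-hand side means $\sum(-1)^{(|c|+|d|)(|b|+|\alpha|)}E_{b\alpha}\otimes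 \bar\Phi_{L_{cd}}(\bar T_{b\alpha})\otimes E_{cd}$. 2. For these actions there is a unique homomorphism of $\mathrm{U}_q(\mathfrak{q}_n)$-supermodules $\bar\Theta:\bar{\mathsf A}_{l,n}\otimes\bar{\mathsf A}_{s,n}\to\bar{\mathsf A}_{s,n}\otimes\bar{\mathsf A}_{l,n}$ such that $$\bar\Theta\circ(1\otimes\mathrm{mul})=(\mathrm{mul}\otimes1)\circ(1\otimes\bar\Theta)\circ(\bar\Theta\otimes1),\qquad \bar\Theta\circ(\mathrm{mul}\otimes1)=(1\otimes\mathrm{mul})\circ(\bar\Theta\otimes1)\circ(1\otimes\bar\Theta),$$ $\bar\Theta(1\otimes x)=x\otimes1$, $\bar\Theta(y\otimes1)=1\otimes y$ for all $x\in\bar{\mathsf A}_{s,n}$, $y\in\bar{\mathsf A}_{l,n}$, and $\bar\Theta(\bar T_l^{1[3]}\bar T_s^{2[4]})=S^{12}\bar T_s^{2[3]}\bar T_l^{1[4]}$, where $\bar T_l=\sum_{\beta=-l}^{-1}\sum_{b\in I_{n|n}}E_{b\beta}\otimes\bar t_{\beta b}$ and $\bar T_s=\sum_{\alpha=-s}^{-1}\sum_{a\in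 I_{n|n}}E_{a\alpha}\otimes\bar t_{\alpha a}$. 3. With the multiplication $(\mathrm{mul}\otimes\mathrm{mul})\circ(1\otimes\bar\Theta\otimes1)$ and unit $1\otimes1$, the tensor product $\bar{\mathsf A}_{s,n}\otimes\bar{\mathsf A}_{l,n}$ is a $\mathrm{U}_q(\mathfrak{q}_n)$-supermodule superalgebra, and the $\mathbb{C}(q)$-linear map $$\bar\sigma:\bar{\mathsf A}_{s,n}\otimes\bar{\mathsf A}_{l,n}\to\bar{\mathsf A}_{s+l,n},\qquad x\otimes y\mapsto\bar\iota_l(x)\,\bar\iota_0(y),$$ is an isomorphism of $\mathrm{U}_q(\mathfrak{q}_n)$-supermodule superalgebras. -/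

import Mathlib

open scoped TensorProduct DirectSum

noncomputable section

namespace QuantumQueer

/-- The base field `ℂ(q)`. -/
abbrev K : Type := RatFunc ℂ

/-- The indeterminate `q`. -/
def q : K := RatFunc.X

/-- `ξ = q - q⁻¹`. -/
def xi : K := q - q⁻¹

/-- The index set `I_{m|m} = {-m, …, -1, 1, …, m}`. -/
abbrev Idx (m : ℕ) : Type := {i : ℤ // i ∈ (Finset.Icc (-(m : ℤ)) m).erase 0}

instance (m : ℕ) : Neg (Idx m) :=
  ⟨fun i => ⟨-i.1, by
    have h := i.2
    simp only [Finset.mem_erase, Finset.mem_Icc] at h ⊢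
    omega⟩⟩

/-- The parity `|i|` of an index: even if `i > 0`, odd if `i < 0`. -/
def par {m : ℕ} (i : Idx m) : ZMod 2 := if 0 < i.1 then 0 else 1

/-- The sign `(-1)^x` in the base field. -/
def sgn (x : ZMod 2) : K := if x = 0 then 1 else -1

/-- `φ(i,j) = (-1)^{|j|} (δ_{i,j} + δ_{i,-j})`. -/
def phi {m : ℕ} (i j : Idx m) : ℤ :=
  (if par j = 0 then 1 else -1) * ((if i = j then 1 else 0) + (if i = -j then 1 else 0))

/-- The tensor matrix
`S = ∑_{i,j} q^{φ(i,j)} E_{ii} ⊗ E_{jj} + ξ ∑_{i<j} (-1)^{|i|} (E_{ji} + E_{-j,-i}) ⊗ E_{ij}`.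
Here and below the entry in row `(i,k)` and column `(j,l)` is the coefficient of
`E_{ij} ⊗ E_{kl}`. -/
def S (m : ℕ) : Matrix (Idx m × Idx m) (Idx m × Idx m) K := fun x y =>
  (if x.1 = y.1 ∧ x.2 = y.2 then q ^ phi x.1 x.2 else 0) +
  (if x.2 < y.2 then
    xi * sgn (par x.2) *
      ((if x.1 = y.2 ∧ y.1 = x.2 then 1 else 0) + (if x.1 = -y.2 ∧ y.1 = -x.2 then 1 else 0))
   else 0)

/-- The inverse tensor matrix
`S⁻¹ = ∑_{i,j} q^{-φ(i,j)} E_{ii} ⊗ E_{jj} - ξ ∑_{i<j} (-1)^{|i|} (E_{ji} + E_{-j,-i}) ⊗ E_{ij}`. -/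
def Sinv (m : ℕ) : Matrix (Idx m × Idx m) (Idx m × Idx m) K := fun x y =>
  (if x.1 = y.1 ∧ x.2 = y.2 then q ^ (-phi x.1 x.2) else 0) -
  (if x.2 < y.2 then
    xi * sgn (par x.2) *
      ((if x.1 = y.2 ∧ y.1 = x.2 then 1 else 0) + (if x.1 = -y.2 ∧ y.1 = -x.2 then 1 else 0))
   else 0)

/-! ### Super tensor matrices

An even element of `Hom ⊗ Hom ⊗ A` is written `∑ E_{ij} ⊗ E_{kl} ⊗ M_{(i,k),(j,l)}`, one of
`A ⊗ Hom ⊗ Hom` is written `∑ M_{(i,k),(j,l)} ⊗ E_{ij} ⊗ E_{kl}`; in both cases the coefficient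
`M_{(i,k),(j,l)}` has parity `|i|+|j|+|k|+|l|`, and the sign in a product is given by the
sign rule `(a ⊗ b)(c ⊗ d) = (-1)^{|b||c|} ac ⊗ bd`. -/

section Tensor

variable {A : Type*} [Ring A] [Algebra K A] {a b c d e f : ℕ}

/-- Product of even elements of `Hom ⊗ Hom ⊗ A`:
`(E_{ij} ⊗ E_{kl} ⊗ u)(E_{jj'} ⊗ E_{ll'} ⊗ v)
  = (-1)^{(|j|+|j'|)(|u|+|k|+|l|) + (|l|+|l'|)|u|} E_{ij'} ⊗ E_{kl'} ⊗ uv`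
with `|u| = |i|+|j|+|k|+|l|`. -/
def mulR (M : Matrix (Idx a × Idx b) (Idx c × Idx d) A)
    (N : Matrix (Idx c × Idx d) (Idx e × Idx f) A) :
    Matrix (Idx a × Idx b) (Idx e × Idx f) A := fun x z =>
  ∑ y, sgn ((par y.1 + par z.1) * (par x.1 + par y.1) +
      (par y.2 + par z.2) * (par x.1 + par y.1 + par x.2 + par y.2)) • (M x y * N y z)

/-- Product of even elements of `A ⊗ Hom ⊗ Hom`:
`(u ⊗ E_{ij} ⊗ E_{kl})(v ⊗ E_{jj'} ⊗ E_{ll'})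
  = (-1)^{|v|(|i|+|j|+|k|+|l|) + (|j|+|j'|)(|k|+|l|)} uv ⊗ E_{ij'} ⊗ E_{kl'}`
with `|v| = |j|+|j'|+|l|+|l'|`. -/
def mulL (M : Matrix (Idx a × Idx b) (Idx c × Idx d) A)
    (N : Matrix (Idx c × Idx d) (Idx e × Idx f) A) :
    Matrix (Idx a × Idx b) (Idx e × Idx f) A := fun x z =>
  ∑ y, sgn ((par y.1 + par z.1 + par y.2 + par z.2) *
        (par x.1 + par y.1 + par x.2 + par y.2) +
      (par y.1 + par z.1) * (par x.2 + par y.2)) • (M x y * N y z)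

/-- A matrix placed in the first matrix leg, with the identity of size `b` in the second. -/
def leg1 (b : ℕ) (T : Matrix (Idx a) (Idx c) A) : Matrix (Idx a × Idx b) (Idx c × Idx b) A :=
  fun x y => if x.2 = y.2 then T x.1 y.1 else 0

/-- A matrix placed in the second matrix leg, with the identity of size `b` in the first. -/
def leg2 (b : ℕ) (T : Matrix (Idx a) (Idx c) A) : Matrix (Idx b × Idx a) (Idx b × Idx c) A :=
  fun x y => if x.1 = y.1 then T x.2 y.2 else 0

variable (A) in
/-- A scalar tensor matrix with entries regarded in `A`. -/
def scal (M : Matrix (Idx a × Idx b) (Idx c × Idx d) K) :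
    Matrix (Idx a × Idx b) (Idx c × Idx d) A := M.map (algebraMap K A)

end Tensor

/-! ### Superalgebras given by generators and homogeneous relations -/

section Presentation

variable {X : Type} (p : X → ZMod 2)

/-- The parity `i` part of the free superalgebra on generators `x` of parity `p x`: the span of
the words of total parity `i`. -/
def freeGrading (i : ZMod 2) : Submodule K (FreeAlgebra K X) :=
  Submodule.span K {w | ∃ xs : List X, (xs.map p).sum = i ∧ (xs.map (FreeAlgebra.ι K)).prod = w}

variable (r : FreeAlgebra K X → FreeAlgebra K X → Prop)

/-- The induced parity `i` part of the superalgebra presented by the relations `r`. -/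
def quotGrading (i : ZMod 2) : Submodule K (RingQuot r) :=
  (freeGrading p i).map (RingQuot.mkAlgHom K r).toLinearMap

theorem freeGrading_ι (x : X) : FreeAlgebra.ι K x ∈ freeGrading p (p x) :=
  Submodule.subset_span ⟨[x], by simp, by simp⟩

theorem freeGrading_one : (1 : FreeAlgebra K X) ∈ freeGrading p 0 :=
  Submodule.subset_span ⟨[], by simp, by simp⟩

theorem freeGrading_mul {i j : ZMod 2} {u v : FreeAlgebra K X} (hu : u ∈ freeGrading p i)
    (hv : v ∈ freeGrading p j) : u * v ∈ freeGrading p (i + j) := by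
  have h : freeGrading p i * freeGrading p j ≤ freeGrading p (i + j) := by
    unfold freeGrading
    rw [Submodule.span_mul_span]
    apply Submodule.span_mono
    rintro _ ⟨_, ⟨xs, hx, rfl⟩, _, ⟨ys, hy, rfl⟩, rfl⟩
    exact ⟨xs ++ ys, by simp [hx, hy], by simp⟩
  exact h (Submodule.mul_mem_mul hu hv)

instance : SetLike.GradedMonoid (quotGrading p r) where
  one_mem := ⟨1, freeGrading_one p, by simp⟩
  mul_mem := by
    rintro i j _ _ ⟨u, hu, rfl⟩ ⟨v, hv, rfl⟩
    exact ⟨u * v, freeGrading_mul p hu hv, by simp⟩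

/-- The free version of the decomposition into homogeneous components. -/
def preDecompose : FreeAlgebra K X →ₐ[K] ⨁ i, quotGrading p r i :=
  FreeAlgebra.lift K fun x => DirectSum.of (fun i => quotGrading p r i) (p x)
    ⟨RingQuot.mkAlgHom K r (FreeAlgebra.ι K x), FreeAlgebra.ι K x, freeGrading_ι p x, rfl⟩

theorem preDecompose_word (xs : List X) :
    ∃ h, preDecompose p r (xs.map (FreeAlgebra.ι K)).prod =
      DirectSum.of (fun i => quotGrading p r i) (xs.map p).sum
        ⟨RingQuot.mkAlgHom K r (xs.map (FreeAlgebra.ι K)).prod, h⟩ := by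
  induction xs with
  | nil => exact ⟨⟨1, freeGrading_one p, by simp⟩, by simp; rfl⟩
  | cons x xs ih =>
    obtain ⟨h, ih⟩ := ih
    refine ⟨⟨_, Submodule.subset_span ⟨x :: xs, rfl, rfl⟩, rfl⟩, ?_⟩
    have e : preDecompose p r ((x :: xs).map (FreeAlgebra.ι K)).prod =
        preDecompose p r (FreeAlgebra.ι K x) * preDecompose p r (xs.map (FreeAlgebra.ι K)).prod := by
      rw [← map_mul, List.map_cons, List.prod_cons]
    rw [e, ih, preDecompose, FreeAlgebra.lift_ι_apply, DirectSum.of_mul_of]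
    refine DirectSum.of_eq_of_gradedMonoid_eq (Sigma.subtype_ext ?_ ?_)
    · simp [GradedMonoid.mk]
    · simp [GradedMonoid.mk]

theorem preDecompose_of_mem {i : ZMod 2} {u : FreeAlgebra K X} (hu : u ∈ freeGrading p i) :
    preDecompose p r u = DirectSum.lof K (ZMod 2) (fun i => quotGrading p r i) i
      ⟨RingQuot.mkAlgHom K r u, u, hu, rfl⟩ := by
  induction hu using Submodule.span_induction with
  | mem u hu =>
    obtain ⟨xs, rfl, rfl⟩ := hu
    obtain ⟨h, e⟩ := preDecompose_word p r xs
    exact e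
  | zero =>
    rw [map_zero]
    symm
    convert map_zero (DirectSum.lof K (ZMod 2) (fun i => quotGrading p r i) i)
    simp
  | add u v hu hv eu ev =>
    rw [map_add, eu, ev, ← map_add]
    congr 1
    ext
    simp
  | smul c u hu eu =>
    rw [map_smul, eu, ← map_smul]
    congr 1
    ext
    simp

/-- A superalgebra presented by homogeneous relations is a `ℤ/2`-graded algebra. -/
abbrev gradedAlgebraOfHomogeneous
    (hr : ∀ u v, r u v → ∃ i, u ∈ freeGrading p i ∧ v ∈ freeGrading p i) :
    GradedAlgebra (quotGrading p r) :=
  GradedAlgebra.ofAlgHom _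
    (RingQuot.liftAlgHom K ⟨preDecompose p r, by
      intro u v h
      obtain ⟨i, hu, hv⟩ := hr u v h
      rw [preDecompose_of_mem p r hu, preDecompose_of_mem p r hv]
      congr 2
      exact RingQuot.mkAlgHom_rel K h⟩)
    (by
      apply RingQuot.ringQuot_ext'
      ext x
      simp [preDecompose])
    (by
      rintro i ⟨_, u, hu, rfl⟩
      simp only [AlgHom.toLinearMap_apply, RingQuot.liftAlgHom_mkAlgHom_apply]
      exact preDecompose_of_mem p r hu)

end Presentation

/-! ### Elementary facts used to see that the objects below are well defined -/

theorem sgn_add (x y : ZMod 2) : sgn (x + y) = sgn x * sgn y := by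
  revert x y
  have h : ∀ x : ZMod 2, x = 0 ∨ x = 1 := by decide
  intro x y
  have h2 : (1 : ZMod 2) + 1 = 0 := by decide
  rcases h x with rfl | rfl <;> rcases h y with rfl | rfl <;> simp [sgn, h2]

theorem add_self_two (x : ZMod 2) : x + x = 0 := by revert x; decide

theorem par_neg {m : ℕ} (i : Idx m) : par (-i) = par i + 1 := by
  have h := i.2
  simp only [Finset.mem_erase, Finset.mem_Icc] at h
  have e : (-i).1 = -i.1 := rfl
  unfold par
  rw [e]
  by_cases h0 : 0 < i.1
  · rw [if_pos h0, if_neg (by omega)]; decide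
  · rw [if_neg h0, if_pos (by omega)]; decide

theorem S_parity {m : ℕ} {x y : Idx m × Idx m} (h : S m x y ≠ 0) :
    par x.1 + par y.1 + par x.2 + par y.2 = 0 := by
  obtain ⟨i, k⟩ := x
  obtain ⟨j, l⟩ := y
  simp only
  by_cases h1 : i = j ∧ k = l
  · obtain ⟨rfl, rfl⟩ := h1
    generalize par i = a, par k = b
    revert a b; decide
  by_cases h2 : i = l ∧ j = k
  · obtain ⟨rfl, rfl⟩ := h2
    generalize par i = a, par j = b
    revert a b; decide
  by_cases h3 : i = -l ∧ j = -k
  · obtain ⟨rfl, rfl⟩ := h3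
    rw [par_neg, par_neg]
    generalize par l = a, par k = b
    revert a b; decide
  · exact absurd (by simp [S, h1, h2, h3]) h

section Tensor

variable {A : Type*} [Ring A] [Algebra K A] {a b c d e f g h : ℕ}

theorem mulL_assoc (M : Matrix (Idx a × Idx b) (Idx c × Idx d) A)
    (N : Matrix (Idx c × Idx d) (Idx e × Idx f) A)
    (P : Matrix (Idx e × Idx f) (Idx g × Idx h) A) :
    mulL (mulL M N) P = mulL M (mulL N P) := by
  ext x w
  simp only [mulL, Finset.smul_sum, Finset.sum_mul, Finset.mul_sum, smul_mul_assoc,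
    mul_smul_comm, smul_smul, ← sgn_add, mul_assoc]
  rw [Finset.sum_comm]
  refine Finset.sum_congr rfl fun y _ => Finset.sum_congr rfl fun z _ => ?_
  congr 2
  generalize par x.1 = x1, par x.2 = x2, par y.1 = y1, par y.2 = y2, par z.1 = z1,
    par z.2 = z2, par w.1 = w1, par w.2 = w2
  revert x1 x2 y1 y2 z1 z2 w1 w2
  decide +kernel

/-- Product of even elements of `A ⊗ Hom`. -/
def mulL1 (M : Matrix (Idx a) (Idx b) A) (N : Matrix (Idx b) (Idx c) A) :
    Matrix (Idx a) (Idx c) A := fun i j =>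
  ∑ k, sgn ((par i + par k) * (par k + par j)) • (M i k * N k j)

theorem leg1_mulL1 (M : Matrix (Idx a) (Idx b) A) (N : Matrix (Idx b) (Idx c) A) :
    leg1 d (mulL1 M N) = mulL (leg1 d M) (leg1 d N) := by
  ext x z
  simp only [leg1, mulL, mulL1, Fintype.sum_prod_type]
  split_ifs with h
  · refine Finset.sum_congr rfl fun k _ => ?_
    rw [Finset.sum_eq_single x.2 (by intro y _ hy; simp [Ne.symm hy]) (by simp)]
    simp only [h, if_true]
    congr 2
    generalize par x.1 = x1, par k = k1, par z.1 = z1, par z.2 = z2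
    revert x1 k1 z1 z2; decide
  · symm
    refine Finset.sum_eq_zero fun k _ => Finset.sum_eq_zero fun y _ => ?_
    by_cases h1 : x.2 = y
    · simp [← h1, h]
    · simp [h1]

theorem leg2_mulL1 (M : Matrix (Idx a) (Idx b) A) (N : Matrix (Idx b) (Idx c) A) :
    leg2 d (mulL1 M N) = mulL (leg2 d M) (leg2 d N) := by
  ext x z
  simp only [leg2, mulL, mulL1, Fintype.sum_prod_type]
  rw [Finset.sum_comm]
  split_ifs with h
  · refine Finset.sum_congr rfl fun k _ => ?_
    rw [Finset.sum_eq_single x.1 (by intro y _ hy; simp [Ne.symm hy]) (by simp)]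
    simp only [h, if_true]
    congr 2
    generalize par x.2 = x1, par k = k1, par z.1 = z1, par z.2 = z2
    revert x1 k1 z1 z2; decide
  · symm
    refine Finset.sum_eq_zero fun k _ => Finset.sum_eq_zero fun y _ => ?_
    by_cases h1 : x.1 = y
    · simp [← h1, h]
    · simp [h1]

theorem leg_comm (M : Matrix (Idx a) (Idx b) A) (N : Matrix (Idx c) (Idx d) A)
    (h : ∀ i j k l, N i j * M k l =
      sgn ((par i + par j) * (par k + par l)) • (M k l * N i j)) :
    mulL (leg1 a N) (leg2 d M) = mulL (leg2 c M) (leg1 b N) := by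
  ext x z
  simp only [mulL, leg1, leg2]
  rw [Finset.sum_eq_single (z.1, x.2), Finset.sum_eq_single (x.1, z.2)]
  · simp only [if_true, h, smul_smul, ← sgn_add]
    congr 2
    generalize par x.1 = x1, par x.2 = x2, par z.1 = z1, par z.2 = z2
    revert x1 x2 z1 z2; decide
  · rintro ⟨y1, y2⟩ - hy
    by_cases h1 : x.1 = y1
    · have h2 : ¬ y2 = z.2 := fun h2 => hy (by rw [h1, h2])
      simp [h2]
    · simp [h1]
  · simp
  · rintro ⟨y1, y2⟩ - hy
    by_cases h1 : x.2 = y2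
    · have h2 : ¬ y1 = z.1 := fun h2 => hy (by rw [h1, h2])
      simp [h2]
    · simp [h1]
  · simp

variable {B : Type*} [Ring B] [Algebra K B] (F : A →ₐ[K] B)

theorem map_mulL (M : Matrix (Idx a × Idx b) (Idx c × Idx d) A)
    (N : Matrix (Idx c × Idx d) (Idx e × Idx f) A) :
    (mulL M N).map F = mulL (M.map F) (N.map F) := by
  ext x z
  simp [mulL]

theorem map_leg1 (T : Matrix (Idx a) (Idx c) A) : (leg1 b T).map F = leg1 b (T.map F) := by
  ext x z
  simp only [leg1, Matrix.map_apply]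
  split_ifs <;> simp

theorem map_leg2 (T : Matrix (Idx a) (Idx c) A) : (leg2 b T).map F = leg2 b (T.map F) := by
  ext x z
  simp only [leg2, Matrix.map_apply]
  split_ifs <;> simp

theorem map_scal (M : Matrix (Idx a × Idx b) (Idx c × Idx d) K) :
    (scal A M).map F = scal B M := by
  ext x z
  simp [scal]

theorem mulR_leg1 (M : Matrix (Idx a × Idx b) (Idx c × Idx d) A) (T : Matrix (Idx c) (Idx e) A)
    (x : Idx a × Idx b) (z : Idx e × Idx d) :
    mulR M (leg1 d T) x z = ∑ k, sgn ((par k + par z.1) * (par x.1 + par k)) •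
      (M x (k, z.2) * T k z.1) := by
  simp only [mulR, leg1, Fintype.sum_prod_type]
  refine Finset.sum_congr rfl fun k _ => ?_
  rw [Finset.sum_eq_single z.2 (by intro y _ hy; simp [hy]) (by simp)]
  simp [add_self_two]

theorem mulR_leg2 (M : Matrix (Idx a × Idx b) (Idx c × Idx d) A) (T : Matrix (Idx d) (Idx e) A)
    (x : Idx a × Idx b) (z : Idx c × Idx e) :
    mulR M (leg2 c T) x z = ∑ k, sgn ((par k + par z.2) *
      (par x.1 + par z.1 + par x.2 + par k)) • (M x (z.1, k) * T k z.2) := by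
  simp only [mulR, leg2, Fintype.sum_prod_type]
  rw [Finset.sum_comm]
  refine Finset.sum_congr rfl fun k _ => ?_
  rw [Finset.sum_eq_single z.1 (by intro y _ hy; simp [hy]) (by simp)]
  simp [add_self_two]

end Tensor

section Homogeneous

variable {X : Type} (p : X → ZMod 2) {a b c d e f : ℕ}

/-- All entries of the tensor matrix are homogeneous of the parity given by the indices. -/
def EvenTensor (M : Matrix (Idx a × Idx b) (Idx c × Idx d) (FreeAlgebra K X)) : Prop :=
  ∀ x y, M x y ∈ freeGrading p (par x.1 + par y.1 + par x.2 + par y.2)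

variable {p}

theorem EvenTensor.mul_mem {M : Matrix (Idx a × Idx b) (Idx c × Idx d) (FreeAlgebra K X)}
    {N : Matrix (Idx c × Idx d) (Idx e × Idx f) (FreeAlgebra K X)} (hM : EvenTensor p M)
    (hN : EvenTensor p N) (x y z) :
    M x y * N y z ∈ freeGrading p (par x.1 + par z.1 + par x.2 + par z.2) := by
  convert freeGrading_mul p (hM x y) (hN y z) using 2
  generalize par x.1 = x1, par x.2 = x2, par y.1 = y1, par y.2 = y2, par z.1 = z1,
    par z.2 = z2
  revert x1 x2 y1 y2 z1 z2; decide

theorem EvenTensor.mulL {M : Matrix (Idx a × Idx b) (Idx c × Idx d) (FreeAlgebra K X)}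
    {N : Matrix (Idx c × Idx d) (Idx e × Idx f) (FreeAlgebra K X)} (hM : EvenTensor p M)
    (hN : EvenTensor p N) : EvenTensor p (mulL M N) := fun x z =>
  Submodule.sum_mem _ fun y _ => Submodule.smul_mem _ _ (hM.mul_mem hN x y z)

theorem EvenTensor.mulR {M : Matrix (Idx a × Idx b) (Idx c × Idx d) (FreeAlgebra K X)}
    {N : Matrix (Idx c × Idx d) (Idx e × Idx f) (FreeAlgebra K X)} (hM : EvenTensor p M)
    (hN : EvenTensor p N) : EvenTensor p (mulR M N) := fun x z =>
  Submodule.sum_mem _ fun y _ => Submodule.smul_mem _ _ (hM.mul_mem hN x y z)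

theorem EvenTensor.leg1 {T : Matrix (Idx a) (Idx c) (FreeAlgebra K X)}
    (hT : ∀ i j, T i j ∈ freeGrading p (par i + par j)) : EvenTensor p (leg1 b T) := by
  intro x y
  unfold QuantumQueer.leg1
  split_ifs with h
  · rw [h, add_assoc, add_self_two, add_zero]
    exact hT _ _
  · exact Submodule.zero_mem _

theorem EvenTensor.leg2 {T : Matrix (Idx a) (Idx c) (FreeAlgebra K X)}
    (hT : ∀ i j, T i j ∈ freeGrading p (par i + par j)) : EvenTensor p (leg2 b T) := by
  intro x y
  unfold QuantumQueer.leg2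
  split_ifs with h
  · rw [h, add_self_two, zero_add]
    exact hT _ _
  · exact Submodule.zero_mem _

theorem EvenTensor.S (m : ℕ) : EvenTensor p (scal (FreeAlgebra K X) (S m)) := by
  intro x y
  by_cases h : QuantumQueer.S m x y = 0
  · simp [scal, h]
  · rw [S_parity h, scal, Matrix.map_apply, Algebra.algebraMap_eq_smul_one]
    exact Submodule.smul_mem _ _ (freeGrading_one p)

end Homogeneous

/-! ### The quantum queer superalgebra -/

/-- Index set of the generators `L_{ij}`, `i ≤ j`. -/
abbrev LIdx (n : ℕ) : Type := {x : Idx n × Idx n // x.1 ≤ x.2}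

/-- The generator `L_{ij}` has parity `|i| + |j|`. -/
def LPar {n : ℕ} (x : LIdx n) : ZMod 2 := par x.1.1 + par x.1.2

/-- The generator matrix in the free algebra; `L_{ij} = 0` for `i > j`. -/
def Lfree (n : ℕ) : Matrix (Idx n) (Idx n) (FreeAlgebra K (LIdx n)) := fun i j =>
  if h : i ≤ j then FreeAlgebra.ι K (⟨(i, j), h⟩ : LIdx n) else 0

/-- Defining relations: `L_{ii} L_{-i,-i} = 1` for all `i ∈ I_{n|n}`, and
`L^{[1]2} L^{[1]3} S^{23} = S^{23} L^{[1]3} L^{[1]2}`. -/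
inductive URel (n : ℕ) : FreeAlgebra K (LIdx n) → FreeAlgebra K (LIdx n) → Prop
  | inv (i : Idx n) : URel n (Lfree n i i * Lfree n (-i) (-i)) 1
  | rtt (x z : Idx n × Idx n) : URel n
      (mulL (mulL (leg1 n (Lfree n)) (leg2 n (Lfree n))) (scal _ (S n)) x z)
      (mulL (mulL (scal _ (S n)) (leg2 n (Lfree n))) (leg1 n (Lfree n)) x z)

/-- The quantum queer superalgebra `U_q(𝔮_n)`. -/
abbrev Uq (n : ℕ) : Type := RingQuot (URel n)

/-- The generator matrix `L` of `U_q(𝔮_n)`. -/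
def L (n : ℕ) : Matrix (Idx n) (Idx n) (Uq n) := (Lfree n).map (RingQuot.mkAlgHom K (URel n))

/-- The `ℤ/2`-grading of `U_q(𝔮_n)`. -/
abbrev UqGrading (n : ℕ) : ZMod 2 → Submodule K (Uq n) := quotGrading LPar (URel n)

theorem Lfree_mem (n : ℕ) (i j : Idx n) : Lfree n i j ∈ freeGrading LPar (par i + par j) := by
  unfold Lfree
  split_ifs with h
  · exact freeGrading_ι LPar (⟨(i, j), h⟩ : LIdx n)
  · exact Submodule.zero_mem _

theorem URel_homogeneous (n : ℕ) (u v : FreeAlgebra K (LIdx n)) (h : URel n u v) :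
    ∃ i, u ∈ freeGrading LPar i ∧ v ∈ freeGrading LPar i := by
  cases h with
  | inv i =>
    refine ⟨0, ?_, freeGrading_one _⟩
    convert freeGrading_mul LPar (Lfree_mem n i i) (Lfree_mem n (-i) (-i)) using 2
    simp [add_self_two]
  | rtt x z =>
    have h1 := EvenTensor.leg1 (b := n) (Lfree_mem n)
    have h2 := EvenTensor.leg2 (b := n) (Lfree_mem n)
    exact ⟨_, ((h1.mulL h2).mulL (EvenTensor.S n)) x z, (((EvenTensor.S n).mulL h2).mulL h1) x z⟩

instance (n : ℕ) : GradedAlgebra (UqGrading n) :=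
  gradedAlgebraOfHomogeneous LPar (URel n) (URel_homogeneous n)

theorem L_mem (n : ℕ) (i j : Idx n) : L n i j ∈ UqGrading n (par i + par j) :=
  ⟨_, Lfree_mem n i j, rfl⟩

theorem L_eq_zero {n : ℕ} {i j : Idx n} (h : ¬ i ≤ j) : L n i j = 0 := by
  simp [L, Lfree, h]

theorem L_inv (n : ℕ) (i : Idx n) : L n i i * L n (-i) (-i) = 1 := by
  have h := RingQuot.mkAlgHom_rel K (URel.inv i)
  simpa [L] using h

theorem L_rtt (n : ℕ) : mulL (mulL (leg1 n (L n)) (leg2 n (L n))) (scal _ (S n)) =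
    mulL (mulL (scal _ (S n)) (leg2 n (L n))) (leg1 n (L n)) := by
  have h : ((mulL (mulL (leg1 n (Lfree n)) (leg2 n (Lfree n))) (scal _ (S n)))).map
      (RingQuot.mkAlgHom K (URel n)) =
      (mulL (mulL (scal _ (S n)) (leg2 n (Lfree n))) (leg1 n (Lfree n))).map
      (RingQuot.mkAlgHom K (URel n)) := by
    ext x z
    exact RingQuot.mkAlgHom_rel K (URel.rtt x z)
  simp only [map_mulL, map_leg1, map_leg2, map_scal] at h
  exact h

/-- An algebra homomorphism out of `U_q(𝔮_n)` from a matrix satisfying the defining relations. -/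
def UqLift {n : ℕ} {A : Type*} [Ring A] [Algebra K A] (M : Matrix (Idx n) (Idx n) A)
    (hz : ∀ i j, ¬ i ≤ j → M i j = 0) (hi : ∀ i, M i i * M (-i) (-i) = 1)
    (hr : mulL (mulL (leg1 n M) (leg2 n M)) (scal _ (S n)) =
      mulL (mulL (scal _ (S n)) (leg2 n M)) (leg1 n M)) : Uq n →ₐ[K] A :=
  RingQuot.liftAlgHom K ⟨FreeAlgebra.lift K fun x : LIdx n => M x.1.1 x.1.2, by
    have e : (Lfree n).map (FreeAlgebra.lift K fun x : LIdx n => M x.1.1 x.1.2) = M := by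
      ext i j
      by_cases h : i ≤ j
      · simp [Lfree, h]
      · simp [Lfree, h, hz]
    have e' : ∀ i j, FreeAlgebra.lift K (fun x : LIdx n => M x.1.1 x.1.2) (Lfree n i j) = M i j :=
      fun i j => congrFun (congrFun e i) j
    intro u v h
    cases h with
    | inv i => rw [map_mul, e', e', hi, map_one]
    | rtt x z =>
      have h := congrFun (congrFun hr x) z
      rw [← e, ← map_leg1, ← map_leg2, ← map_scal (FreeAlgebra.lift K fun x : LIdx n => M x.1.1 x.1.2),
        ← map_mulL, ← map_mulL, ← map_mulL, ← map_mulL] at h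
      exact h⟩

theorem UqLift_L {n : ℕ} {A : Type*} [Ring A] [Algebra K A] (M : Matrix (Idx n) (Idx n) A)
    (hz hi hr) (i j : Idx n) : UqLift M hz hi hr (L n i j) = M i j := by
  by_cases h : i ≤ j
  · simp [UqLift, L, Lfree, h]
  · simp [L_eq_zero h, hz i j h]

/-- The counit `ε(L) = 1`. -/
def counit (n : ℕ) : Uq n →ₐ[K] K :=
  UqLift (1 : Matrix (Idx n) (Idx n) K)
    (fun i j h => Matrix.one_apply_ne fun e => h e.le)
    (fun i => by simp)
    (by
      have h1 : leg1 n (1 : Matrix (Idx n) (Idx n) K) = 1 := by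
        ext x y
        by_cases h : x.2 = y.2 <;> by_cases h' : x.1 = y.1 <;>
          simp [leg1, Matrix.one_apply, Prod.ext_iff, h, h']
      have h2 : leg2 n (1 : Matrix (Idx n) (Idx n) K) = 1 := by
        ext x y
        by_cases h : x.2 = y.2 <;> by_cases h' : x.1 = y.1 <;>
          simp [leg2, Matrix.one_apply, Prod.ext_iff, h, h']
      have l : ∀ M : Matrix (Idx n × Idx n) (Idx n × Idx n) K, mulL 1 M = M := by
        intro M
        ext x z
        rw [mulL, Finset.sum_eq_single x (by intro y _ hy; simp [Ne.symm hy])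
          (by simp)]
        simp [add_self_two, add_assoc, sgn]
      have r : ∀ M : Matrix (Idx n × Idx n) (Idx n × Idx n) K, mulL M 1 = M := by
        intro M
        ext x z
        rw [mulL, Finset.sum_eq_single z (by intro y _ hy; simp [hy])
          (by simp)]
        simp [add_self_two, add_assoc, sgn]
      rw [h1, h2, l, l, r, r])

section Comul

open GradedTensorProduct

/-- The matrix `L ⊗ L`, with entries
`∑_k (-1)^{(|i|+|k|)(|k|+|j|)} L_{ik} ⊗ L_{kj}` in the tensor product of superalgebras. -/
def LL (n : ℕ) : Matrix (Idx n) (Idx n) (UqGrading n ᵍ⊗[K] UqGrading n) := fun i j =>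
  ∑ k, sgn ((par i + par k) * (par k + par j)) • (L n i k ᵍ⊗ₜ[K] L n k j)

theorem uzpow_smul_eq {M : Type*} [AddCommGroup M] [Module K M] (x : ZMod 2) (v : M) :
    ((-1 : ℤˣ) ^ x) • v = sgn x • v := by
  have h : ∀ x : ZMod 2, x = 0 ∨ x = 1 := by decide
  rcases h x with rfl | rfl
  · simp [sgn]
  · simp [sgn]

theorem LL_eq_mulL1 (n : ℕ) : LL n = mulL1 ((L n).map (includeLeft (UqGrading n) (UqGrading n)))
    ((L n).map (includeRight (UqGrading n) (UqGrading n))) := by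
  ext i j
  refine Finset.sum_congr rfl fun k _ => ?_
  simp only [Matrix.map_apply, includeLeft_apply, includeRight_apply]
  rw [tmul_one_mul_one_tmul]

theorem LL_zero (n : ℕ) (i j : Idx n) (h : ¬ i ≤ j) : LL n i j = 0 := by
  refine Finset.sum_eq_zero fun k _ => ?_
  by_cases h1 : i ≤ k
  · rw [L_eq_zero (i := k) fun h2 => h (h1.trans h2)]
    simp [tmul]
  · simp [L_eq_zero h1, tmul]

theorem LL_diag (n : ℕ) (i : Idx n) : LL n i i = L n i i ᵍ⊗ₜ[K] L n i i := by
  unfold LL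
  rw [Finset.sum_eq_single i]
  · simp [add_self_two, sgn]
  · intro k _ hk
    by_cases h1 : i ≤ k
    · rw [L_eq_zero (i := k) fun h2 => hk (le_antisymm h2 h1)]
      simp [tmul]
    · simp [L_eq_zero h1, tmul]
  · simp

theorem LL_inv (n : ℕ) (i : Idx n) : LL n i i * LL n (-i) (-i) = 1 := by
  have h1 : L n i i ∈ UqGrading n 0 := by
    simpa [add_self_two] using L_mem n i i
  rw [LL_diag, LL_diag]
  have h := tmul_coe_mul_coe_tmul (UqGrading n) (UqGrading n) (L n i i) ⟨_, h1⟩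
    ⟨_, L_mem n (-i) (-i)⟩ (L n (-i) (-i))
  simp only [zero_mul, uzpow_zero, one_smul, L_inv] at h
  rw [h]
  rfl

theorem LL_rtt (n : ℕ) : mulL (mulL (leg1 n (LL n)) (leg2 n (LL n))) (scal _ (S n)) =
    mulL (mulL (scal _ (S n)) (leg2 n (LL n))) (leg1 n (LL n)) := by
  have hl := congrArg (fun M => M.map (includeLeft (UqGrading n) (UqGrading n))) (L_rtt n)
  have hr := congrArg (fun M => M.map (includeRight (UqGrading n) (UqGrading n))) (L_rtt n)
  simp only [map_mulL, map_leg1, map_leg2, map_scal] at hl hr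
  rw [LL_eq_mulL1]
  have hc : ∀ i j k l : Idx n,
      (L n).map (includeRight (UqGrading n) (UqGrading n)) i j *
        (L n).map (includeLeft (UqGrading n) (UqGrading n)) k l =
      sgn ((par i + par j) * (par k + par l)) •
        ((L n).map (includeLeft (UqGrading n) (UqGrading n)) k l *
          (L n).map (includeRight (UqGrading n) (UqGrading n)) i j) := by
    intro i j k l
    simp only [Matrix.map_apply, includeLeft_apply, includeRight_apply]
    rw [tmul_one_mul_one_tmul]
    have h := tmul_coe_mul_coe_tmul (UqGrading n) (UqGrading n) 1 ⟨_, L_mem n i j⟩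
      ⟨_, L_mem n k l⟩ 1
    simp only [one_mul, mul_one] at h
    rw [← uzpow_smul_eq]
    exact h
  generalize (L n).map (includeLeft (UqGrading n) (UqGrading n)) = P at *
  generalize (L n).map (includeRight (UqGrading n) (UqGrading n)) = Q at *
  have c1 := leg_comm P Q hc
  have c2 : mulL (leg2 n Q) (leg1 n P) = mulL (leg1 n P) (leg2 n Q) := by
    refine (leg_comm Q P fun i j k l => ?_).symm
    rw [hc, smul_smul, mul_comm (par k + par l), ← sgn_add, add_self_two]
    simp [sgn]
  rw [leg1_mulL1, leg2_mulL1]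
  calc mulL (mulL (mulL (leg1 n P) (leg1 n Q)) (mulL (leg2 n P) (leg2 n Q))) (scal _ (S n))
      = mulL (leg1 n P) (mulL (mulL (leg1 n Q) (leg2 n P)) (mulL (leg2 n Q) (scal _ (S n)))) := by
        simp only [mulL_assoc]
    _ = mulL (mulL (leg1 n P) (leg2 n P)) (mulL (mulL (leg1 n Q) (leg2 n Q)) (scal _ (S n))) := by
        rw [c1]; simp only [mulL_assoc]
    _ = mulL (mulL (mulL (leg1 n P) (leg2 n P)) (scal _ (S n))) (mulL (leg2 n Q) (leg1 n Q)) := by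
        rw [hr]; simp only [mulL_assoc]
    _ = mulL (mulL (scal _ (S n)) (leg2 n P)) (mulL (mulL (leg1 n P) (leg2 n Q)) (leg1 n Q)) := by
        rw [hl]; simp only [mulL_assoc]
    _ = mulL (mulL (scal _ (S n)) (mulL (leg2 n P) (leg2 n Q)))
          (mulL (leg1 n P) (leg1 n Q)) := by
        rw [← c2]; simp only [mulL_assoc]

/-- The comultiplication `Δ(L) = L ⊗ L`, a homomorphism of superalgebras. -/
def comul (n : ℕ) : Uq n →ₐ[K] (UqGrading n ᵍ⊗[K] UqGrading n) :=
  UqLift (LL n) (LL_zero n) (LL_inv n) (LL_rtt n)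

end Comul

/-- The comultiplication as a linear map to the tensor product. -/
def Delta (n : ℕ) : Uq n →ₗ[K] Uq n ⊗[K] Uq n :=
  (GradedTensorProduct.of K (UqGrading n) (UqGrading n)).symm.toLinearMap ∘ₗ
    (comul n).toLinearMap

/-! ### The dual quantum coordinate superalgebra -/

/-- The generator `t̄_{αb}` has parity `|α| + |b|`. -/
def tPar {s n : ℕ} (x : Idx s × Idx n) : ZMod 2 := par x.1 + par x.2

/-- The free generator `t̄_{αb}`. -/
def tfree {s n : ℕ} (α : Idx s) (b : Idx n) : FreeAlgebra K (Idx s × Idx n) :=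
  FreeAlgebra.ι K (α, b)

/-- The generator matrix `T̄ = ∑ (-1)^{|b|(|α|+|b|)} E_{bα} ⊗ t̄_{αb}` in the free algebra. -/
def Tfree (s n : ℕ) : Matrix (Idx n) (Idx s) (FreeAlgebra K (Idx s × Idx n)) := fun b α =>
  sgn (par b * (par α + par b)) • tfree α b

/-- Defining relations: `t̄_{αb} = (-1)^{|α|+|b|} t̄_{-α,-b}` and
`T̄^{1[3]} T̄^{2[3]} S^{12} = S^{12} T̄^{2[3]} T̄^{1[3]}`. -/
inductive BarRel (s n : ℕ) :
    FreeAlgebra K (Idx s × Idx n) → FreeAlgebra K (Idx s × Idx n) → Prop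
  | sym (α : Idx s) (b : Idx n) :
      BarRel s n (tfree α b) (sgn (par α + par b) • tfree (-α) (-b))
  | rtt (x : Idx n × Idx n) (z : Idx s × Idx s) : BarRel s n
      (mulR (mulR (leg1 n (Tfree s n)) (leg2 s (Tfree s n))) (scal _ (S s)) x z)
      (mulR (mulR (scal _ (S n)) (leg2 n (Tfree s n))) (leg1 s (Tfree s n)) x z)

/-- The dual quantum coordinate superalgebra `Ā_{s,n}`. -/
abbrev Abar (s n : ℕ) : Type := RingQuot (BarRel s n)

/-- The generator `t̄_{αb}` of `Ā_{s,n}`. -/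
def tbar {s n : ℕ} (α : Idx s) (b : Idx n) : Abar s n :=
  RingQuot.mkAlgHom K (BarRel s n) (tfree α b)

/-- The `ℤ/2`-grading of `Ā_{s,n}`. -/
abbrev AbarGrading (s n : ℕ) : ZMod 2 → Submodule K (Abar s n) := quotGrading tPar (BarRel s n)

theorem BarRel_homogeneous (s n : ℕ) (u v : FreeAlgebra K (Idx s × Idx n)) (h : BarRel s n u v) :
    ∃ i, u ∈ freeGrading tPar i ∧ v ∈ freeGrading tPar i := by
  have ht : ∀ (α : Idx s) (b : Idx n), tfree α b ∈ freeGrading tPar (par α + par b) :=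
    fun α b => freeGrading_ι tPar (α, b)
  have hT : ∀ b α, Tfree s n b α ∈ freeGrading tPar (par b + par α) := fun b α => by
    rw [add_comm]
    exact Submodule.smul_mem _ _ (ht α b)
  cases h with
  | sym α b =>
    refine ⟨_, ht α b, Submodule.smul_mem _ _ ?_⟩
    convert ht (-α) (-b) using 2
    rw [par_neg, par_neg]
    generalize par α = x, par b = y
    revert x y; decide
  | rtt x z =>
    exact ⟨_, (((EvenTensor.leg1 hT).mulR (EvenTensor.leg2 hT)).mulR (EvenTensor.S s)) x z,
      (((EvenTensor.S n).mulR (EvenTensor.leg2 hT)).mulR (EvenTensor.leg1 hT)) x z⟩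

instance (s n : ℕ) : GradedAlgebra (AbarGrading s n) :=
  gradedAlgebraOfHomogeneous tPar (BarRel s n) (BarRel_homogeneous s n)

/-- The shift `α ↦ α - p` for `α < 0`, extended oddly by `α ↦ α + p` for `α > 0`. -/
def shift {s m : ℕ} (p : ℕ) (h : s + p ≤ m) (α : Idx s) : Idx m :=
  ⟨if 0 < α.1 then α.1 + p else α.1 - p, by
    have := α.2
    simp only [Finset.mem_erase, Finset.mem_Icc] at this ⊢
    split_ifs <;> omega⟩

section Iota

variable {s m : ℕ} (p : ℕ) (h : s + p ≤ m)

theorem idx_ne {s : ℕ} (α : Idx s) : α.1 ≠ 0 := (Finset.mem_erase.mp α.2).1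

theorem shift_val (α : Idx s) : (shift p h α).1 = if 0 < α.1 then α.1 + p else α.1 - p := rfl

theorem neg_val {s : ℕ} (α : Idx s) : (-α).1 = -α.1 := rfl

theorem shift_neg (α : Idx s) : shift p h (-α) = -shift p h α := by
  apply Subtype.ext
  have := idx_ne α
  rw [neg_val, shift_val, shift_val, neg_val]
  split_ifs <;> omega

theorem par_shift (α : Idx s) : par (shift p h α) = par α := by
  have := idx_ne α
  unfold par
  rw [shift_val]
  congr 1
  apply propext
  split_ifs <;> omega

theorem shift_lt (α β : Idx s) : shift p h α < shift p h β ↔ α < β := by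
  have := idx_ne α
  have := idx_ne β
  rw [← Subtype.coe_lt_coe, ← Subtype.coe_lt_coe, shift_val, shift_val]
  split_ifs <;> omega

theorem shift_inj : Function.Injective (shift (s := s) p h) := by
  intro α β e
  have e := congrArg Subtype.val e
  have := idx_ne α
  have := idx_ne β
  rw [shift_val, shift_val] at e
  apply Subtype.ext
  split_ifs at e <;> omega

theorem S_shift (x y : Idx s × Idx s) :
    S m (Prod.map (shift p h) (shift p h) x) (Prod.map (shift p h) (shift p h) y) = S s x y := by
  simp only [S, phi, Prod.map_fst, Prod.map_snd, ← shift_neg, (shift_inj p h).eq_iff, par_shift,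
    shift_lt]

theorem S_shift_zero (x : Idx m × Idx m) (y : Idx s × Idx s)
    (hx : x ∉ Set.range (Prod.map (shift p h) (shift p h))) :
    S m x (Prod.map (shift p h) (shift p h) y) = 0 := by
  obtain ⟨i, k⟩ := x
  obtain ⟨j, l⟩ := y
  have h1 : ¬ (i = shift p h j ∧ k = shift p h l) := by
    rintro ⟨rfl, rfl⟩
    exact hx ⟨(j, l), rfl⟩
  have h2 : ¬ (i = shift p h l ∧ shift p h j = k) := by
    rintro ⟨rfl, rfl⟩
    exact hx ⟨(l, j), rfl⟩
  have h3 : ¬ (i = -shift p h l ∧ shift p h j = -k) := by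
    rintro ⟨rfl, e⟩
    have e' : k = -shift p h j := by
      apply Subtype.ext
      rw [neg_val, e, neg_val, neg_neg]
    exact hx ⟨(-l, -j), by simp [shift_neg, e']⟩
  simp only [S, Prod.map_fst, Prod.map_snd, h1, h2, h3, if_false, add_zero, mul_zero, ite_self]

theorem tbar_sym {s n : ℕ} (α : Idx s) (b : Idx n) :
    tbar α b = sgn (par α + par b) • tbar (-α) (-b) := by
  have e := RingQuot.mkAlgHom_rel K (BarRel.sym α b)
  rw [map_smul] at e
  exact e

/-- The homomorphism of superalgebras `ῑ_p : Ā_{s,n} → Ā_{m,n}`, `t̄_{αa} ↦ t̄_{α-p,a}` for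
`α = -1, …, -s`; by the relation `t̄_{αb} = (-1)^{|α|+|b|} t̄_{-α,-b}` this means
`t̄_{αa} ↦ t̄_{α+p,a}` for `α = 1, …, s`. -/
def iotaBar (n : ℕ) : Abar s n →ₐ[K] Abar m n :=
  RingQuot.liftAlgHom K
    ⟨FreeAlgebra.lift K fun x : Idx s × Idx n => (tbar (shift p h x.1) x.2 : Abar m n), by
      intro u v hr
      cases hr with
      | sym α b =>
        rw [map_smul, tfree, tfree, FreeAlgebra.lift_ι_apply, FreeAlgebra.lift_ι_apply,
          tbar_sym, par_shift, shift_neg]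
      | rtt x z =>
        have eT : ∀ b α, FreeAlgebra.lift K
            (fun x : Idx s × Idx n => (tbar (shift p h x.1) x.2 : Abar m n)) (Tfree s n b α) =
            RingQuot.mkAlgHom K (BarRel m n) (Tfree m n b (shift p h α)) := by
          intro b α
          rw [Tfree, Tfree, map_smul, map_smul, tfree, FreeAlgebra.lift_ι_apply, par_shift]
          rfl
        have eR := RingQuot.mkAlgHom_rel K
          (BarRel.rtt (n := n) x (Prod.map (shift p h) (shift p h) z))
        convert eR using 1
        · rw [mulR, mulR, map_sum, map_sum]
          refine Fintype.sum_of_injective (Prod.map (shift p h) (shift p h))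
            ((shift_inj p h).prodMap (shift_inj p h)) _ _ ?_ ?_
          · intro y hy
            simp [scal, S_shift_zero p h y z hy]
          · intro y
            simp only [Prod.map_fst, Prod.map_snd, par_shift, map_smul, map_mul, scal,
              Matrix.map_apply, S_shift, AlgHom.commutes]
            congr 2
            rw [mulR_leg2, mulR_leg2, map_sum, map_sum]
            refine Finset.sum_congr rfl fun k _ => ?_
            simp only [map_smul, map_mul, par_shift, eT, leg1, Prod.map_fst, Prod.map_snd]
            split_ifs <;> simp [eT]
        · rw [mulR_leg1, mulR_leg1, map_sum, map_sum]
          refine Finset.sum_congr rfl fun k _ => ?_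
          simp only [map_smul, map_mul, par_shift, eT, Prod.map_fst, Prod.map_snd]
          congr 2
          rw [mulR_leg2, mulR_leg2, map_sum, map_sum]
          refine Finset.sum_congr rfl fun k _ => ?_
          simp only [map_smul, map_mul, par_shift, eT, scal, Matrix.map_apply, AlgHom.commutes]⟩

end Iota

/-- The generator matrix `T̄ = ∑ (-1)^{|b|(|α|+|b|)} E_{bα} ⊗ t̄_{αb}` of `Ā_{s,n}`. -/
def Tbar (s n : ℕ) : Matrix (Idx n) (Idx s) (Abar s n) := fun b α =>
  sgn (par b * (par α + par b)) • tbar α b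

/-! ### Supermodules and supermodule superalgebras over `U_q(𝔮_n)` -/

/-- The linear map `u ↦ (-1)^{|u| j} u` (for homogeneous `u`) of `U_q(𝔮_n)`. -/
def twist (n : ℕ) (j : ZMod 2) : Uq n →ₗ[K] Uq n :=
  ∑ i : ZMod 2, sgn (i * j) • GradedAlgebra.proj (UqGrading n) i

/-- The linear map `u ↦ ∑ (-1)^{|u_{(2)}| j} u_{(1)} ⊗ u_{(2)}`. -/
def DeltaTwist (n : ℕ) (j : ZMod 2) : Uq n →ₗ[K] Uq n ⊗[K] Uq n :=
  (twist n j).lTensor (Uq n) ∘ₗ Delta n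

section Module

variable (n : ℕ) {V W : Type} [AddCommGroup V] [Module K V] [AddCommGroup W] [Module K W]

/-- `V = 𝒱 0 ⊕ 𝒱 1` with the action `ρ` is a `U_q(𝔮_n)`-supermodule. -/
structure IsSupermodule (𝒱 : ZMod 2 → Submodule K V) (ρ : Uq n →ₗ[K] Module.End K V) : Prop where
  internal : DirectSum.IsInternal 𝒱
  one_act : ρ 1 = 1
  mul_act : ∀ u v, ρ (u * v) = ρ u * ρ v
  act_mem : ∀ i j, ∀ u ∈ UqGrading n i, ∀ x ∈ 𝒱 j, ρ u x ∈ 𝒱 (i + j)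

/-- `V` with unit `e`, multiplication `μ`, grading `𝒱` and action `ρ` is a unital associative
superalgebra and a `U_q(𝔮_n)`-supermodule such that
`u.(ab) = ∑ (-1)^{|u_{(2)}||a|} (u_{(1)}.a)(u_{(2)}.b)` and `u.1 = ε(u) 1`. -/
structure IsSupermoduleSuperalgebra (𝒱 : ZMod 2 → Submodule K V) (e : V)
    (μ : V →ₗ[K] V →ₗ[K] V) (ρ : Uq n →ₗ[K] Module.End K V) : Prop
    extends IsSupermodule n 𝒱 ρ where
  one_mul : ∀ x, μ e x = x
  mul_one : ∀ x, μ x e = x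
  mul_assoc : ∀ x y z, μ (μ x y) z = μ x (μ y z)
  one_mem : e ∈ 𝒱 0
  mul_mem : ∀ i j, ∀ x ∈ 𝒱 i, ∀ y ∈ 𝒱 j, μ x y ∈ 𝒱 (i + j)
  act_mul : ∀ (u : Uq n) (j : ZMod 2), ∀ a ∈ 𝒱 j, ∀ b : V,
    ρ u (μ a b) = TensorProduct.lift (μ.compl₁₂ (ρ.flip a) (ρ.flip b)) (DeltaTwist n j u)
  act_one : ∀ u : Uq n, ρ u e = counit n u • e

/-- Homomorphisms of `U_q(𝔮_n)`-supermodules (parity preserving). -/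
structure IsSupermoduleHom (𝒱 : ZMod 2 → Submodule K V) (ρ : Uq n →ₗ[K] Module.End K V)
    (𝒲 : ZMod 2 → Submodule K W) (ρ' : Uq n →ₗ[K] Module.End K W) (f : V →ₗ[K] W) : Prop where
  map_mem : ∀ i, ∀ x ∈ 𝒱 i, f x ∈ 𝒲 i
  map_act : ∀ u x, f (ρ u x) = ρ' u (f x)

/-- Isomorphisms of `U_q(𝔮_n)`-supermodule superalgebras. -/
structure IsSupermoduleSuperalgebraIso
    (𝒱 : ZMod 2 → Submodule K V) (e : V) (μ : V →ₗ[K] V →ₗ[K] V) (ρ : Uq n →ₗ[K] Module.End K V)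
    (𝒲 : ZMod 2 → Submodule K W) (e' : W) (μ' : W →ₗ[K] W →ₗ[K] W)
    (ρ' : Uq n →ₗ[K] Module.End K W) (f : V →ₗ[K] W) : Prop
    extends IsSupermoduleHom n 𝒱 ρ 𝒲 ρ' f where
  map_one : f e = e'
  map_mul : ∀ x y, f (μ x y) = μ' (f x) (f y)
  bijective : Function.Bijective f

/-- The `ℤ/2`-grading of a tensor product. -/
def tensorGrading (𝒱 : ZMod 2 → Submodule K V) (𝒲 : ZMod 2 → Submodule K W) (k : ZMod 2) :
    Submodule K (V ⊗[K] W) :=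
  Submodule.span K {z | ∃ i j, i + j = k ∧ ∃ x ∈ 𝒱 i, ∃ y ∈ 𝒲 j, x ⊗ₜ[K] y = z}

end Module

/-- The action of `U_q(𝔮_n)` on a tensor product through the comultiplication,
`u.(x ⊗ y) = ∑ (-1)^{|u_{(2)}||x|} u_{(1)}.x ⊗ u_{(2)}.y`. -/
def tensorAct (n : ℕ) {A B : Type} [Ring A] [Algebra K A] [AddCommGroup B] [Module K B]
    (𝒜 : ZMod 2 → Submodule K A) [GradedAlgebra 𝒜]
    (ρ : Uq n →ₗ[K] Module.End K A) (ρ' : Uq n →ₗ[K] Module.End K B) :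
    Uq n →ₗ[K] Module.End K (A ⊗[K] B) :=
  ∑ j : ZMod 2,
    TensorProduct.lift ((TensorProduct.mapBilinear (RingHom.id K) A B A B).compl₁₂
      (LinearMap.lcomp K A (GradedAlgebra.proj 𝒜 j) ∘ₗ ρ) ρ') ∘ₗ DeltaTwist n j

/-! ### The action on `Ā_{s,n}`, the braiding and the map `σ̄` -/

/-- `ρ` is the action `Φ̄` of `U_q(𝔮_n)` on `Ā_{s,n}`: it makes `Ā_{s,n}` a supermodule
superalgebra, and `L^{[2]3} · T̄^{1[2]} = (S⁻¹)^{13} T̄^{1[2]}`, where the left side is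
`∑ (-1)^{(|c|+|d|)(|b|+|α|)} E_{bα} ⊗ L_{cd}.T̄_{bα} ⊗ E_{cd}`. -/
structure IsBarAction (s n : ℕ) (ρ : Uq n →ₗ[K] Module.End K (Abar s n)) : Prop
    extends IsSupermoduleSuperalgebra n (AbarGrading s n) 1 (LinearMap.mul K (Abar s n)) ρ where
  gen : ∀ (b c d : Idx n) (α : Idx s),
    sgn ((par c + par d) * (par b + par α)) • ρ (L n c d) (Tbar s n b α) =
      ∑ b' : Idx n, Sinv n (b, c) (b', d) • Tbar s n b' α

open TensorProduct in
/-- `Θ` is the braiding operator `Θ̄ : Ā_{l,n} ⊗ Ā_{s,n} → Ā_{s,n} ⊗ Ā_{l,n}`. The last condition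
is `Θ̄(T̄_l^{1[3]} T̄_s^{2[4]}) = S^{12} T̄_s^{2[3]} T̄_l^{1[4]}` for the generator matrices
`T̄_l = ∑_{β<0} E_{bβ} ⊗ t̄_{βb}` and `T̄_s = ∑_{α<0} E_{aα} ⊗ t̄_{αa}`: the coefficients of
`E_{bβ} ⊗ E_{aα}` are compared. -/
structure IsBraiding (n s l : ℕ) (ρs : Uq n →ₗ[K] Module.End K (Abar s n))
    (ρl : Uq n →ₗ[K] Module.End K (Abar l n))
    (Θ : Abar l n ⊗[K] Abar s n →ₗ[K] Abar s n ⊗[K] Abar l n) : Prop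
    extends IsSupermoduleHom n
      (tensorGrading (AbarGrading l n) (AbarGrading s n)) (tensorAct n (AbarGrading l n) ρl ρs)
      (tensorGrading (AbarGrading s n) (AbarGrading l n)) (tensorAct n (AbarGrading s n) ρs ρl)
      Θ where
  braid_mul : Θ ∘ₗ (LinearMap.mul' K (Abar s n)).lTensor (Abar l n) =
    (LinearMap.mul' K (Abar s n)).rTensor (Abar l n) ∘ₗ
      (TensorProduct.assoc K (Abar s n) (Abar s n) (Abar l n)).symm.toLinearMap ∘ₗ
      Θ.lTensor (Abar s n) ∘ₗ
      (TensorProduct.assoc K (Abar s n) (Abar l n) (Abar s n)).toLinearMap ∘ₗ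
      Θ.rTensor (Abar s n) ∘ₗ
      (TensorProduct.assoc K (Abar l n) (Abar s n) (Abar s n)).symm.toLinearMap
  mul_braid : Θ ∘ₗ (LinearMap.mul' K (Abar l n)).rTensor (Abar s n) =
    (LinearMap.mul' K (Abar l n)).lTensor (Abar s n) ∘ₗ
      (TensorProduct.assoc K (Abar s n) (Abar l n) (Abar l n)).toLinearMap ∘ₗ
      Θ.rTensor (Abar l n) ∘ₗ
      (TensorProduct.assoc K (Abar l n) (Abar s n) (Abar l n)).symm.toLinearMap ∘ₗ
      Θ.lTensor (Abar l n) ∘ₗ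
      (TensorProduct.assoc K (Abar l n) (Abar l n) (Abar s n)).toLinearMap
  one_tmul : ∀ x : Abar s n, Θ (1 ⊗ₜ[K] x) = x ⊗ₜ[K] 1
  tmul_one : ∀ y : Abar l n, Θ (y ⊗ₜ[K] 1) = 1 ⊗ₜ[K] y
  gen : ∀ (β : Idx l) (α : Idx s), β.1 < 0 → α.1 < 0 → ∀ b a : Idx n,
    sgn ((par b + par β) * (par a + par α)) • Θ (tbar β b ⊗ₜ[K] tbar α a) =
      ∑ b' : Idx n, ∑ a' : Idx n,
        (S n (b, a) (b', a') * sgn ((par a + par a') * (par b' + par β))) •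
          (tbar α a' ⊗ₜ[K] tbar β b')

/-- The braided multiplication `(mul ⊗ mul) ∘ (1 ⊗ Θ ⊗ 1)` on `Ā_{s,n} ⊗ Ā_{l,n}`. -/
def braidedMul {n s l : ℕ} (Θ : Abar l n ⊗[K] Abar s n →ₗ[K] Abar s n ⊗[K] Abar l n) :
    Abar s n ⊗[K] Abar l n →ₗ[K] Abar s n ⊗[K] Abar l n →ₗ[K] Abar s n ⊗[K] Abar l n :=
  TensorProduct.curry
    (TensorProduct.map (LinearMap.mul' K (Abar s n)) (LinearMap.mul' K (Abar l n)) ∘ₗ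
      (TensorProduct.assoc K (Abar s n) (Abar s n) (Abar l n ⊗[K] Abar l n)).symm.toLinearMap ∘ₗ
      ((TensorProduct.assoc K (Abar s n) (Abar l n) (Abar l n)).toLinearMap ∘ₗ
        Θ.rTensor (Abar l n) ∘ₗ
        (TensorProduct.assoc K (Abar l n) (Abar s n) (Abar l n)).symm.toLinearMap).lTensor
          (Abar s n) ∘ₗ
      (TensorProduct.assoc K (Abar s n) (Abar l n) (Abar s n ⊗[K] Abar l n)).toLinearMap)

/-- The linear map `σ̄ : Ā_{s,n} ⊗ Ā_{l,n} → Ā_{s+l,n}`, `x ⊗ y ↦ ῑ_l(x) ῑ_0(y)`. -/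
def sigmaBar (n s l : ℕ) : Abar s n ⊗[K] Abar l n →ₗ[K] Abar (s + l) n :=
  TensorProduct.lift ((LinearMap.mul K (Abar (s + l) n)).compl₁₂
    (iotaBar l le_rfl n : Abar s n →ₐ[K] Abar (s + l) n).toLinearMap
    (iotaBar 0 (Nat.le_add_left l s) n : Abar l n →ₐ[K] Abar (s + l) n).toLinearMap)

end QuantumQueer

end

open scoped TensorProduct DirectSum

noncomputable section

namespace QuantumQueer

/-! Combining `S` with the flip and suitable signs gives an operator w on functions of two column
indices (`braidAux` at parameter q, the same as `wop 0`). It satisfies the Hecke relation w² = 1 -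
ξw (`braidAux_braidAux`, `wop_wop`) and the braid relation (`braidAux_braid`). The symmetry relation
of the coordinate superalgebra reduces its defining relations to quadratic ones between generators
with negative row index, and these are stated through w alone (`HalfRel`, `relL_eq_relR`).
Homomorphisms out of the superalgebra are therefore easy to build (`abarHom`).

Let η be 0 or ξ, so that w + η is w or w⁻¹. Moving a vector past a generator by w + η gives a matrix
over the coordinate superalgebra. A mixed braid relation shows that these matrices again satisfy the
quadratic relations (`transferGen_half`), so there are operators D_{bc} that are multiplicative as a
matrix and satisfy an RTT type relation (`wop_transfer_transfer`). For η = ξ they are upper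
triangular with entries from S⁻¹, and a change of signs turns them into the action of `Uq n`
(`uqAct`, `barAct_isBarAction`).

For η = 0 they describe how a generator of the second factor moves past the first factor. This lets
the superalgebra of size s + l act on the tensor product (`actGen_half`), and evaluating that action
at 1 ⊗ 1 inverts σ̄ (`mulTensor_bijective`); no basis theorem is needed. The braiding is then
defined as σ̄⁻¹ applied to the product in the opposite order (`exchange`). Its compatibilities, its
equivariance and the supermodule superalgebra structure are all pulled back along the injective map
σ̄ from the associative algebra of size s + l, because the maps ῑ are equivariant (`hom_uqAct`).
Uniqueness of the action and of the braiding holds because both are determined on generators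
(`act_unique`, `IsTwisting.unique`). -/

theorem q_ne_zero : q ≠ 0 := RatFunc.X_ne_zero

theorem idx_neg_neg {n : ℕ} (a : Idx n) : - -a = a := Subtype.ext (neg_neg a.1)

theorem idx_eq_iff {n : ℕ} (a b : Idx n) : a = b ↔ a.1 = b.1 := Subtype.ext_iff

/-! ### The Hecke operator on two indices and its behaviour under negation of indices -/

section GenericBraid

variable {k : Type*} [Field k] (r : k) {n : ℕ} {M : Type*} [AddCommGroup M] [Module k M]

/-- The coefficient of the flip in the braid operator with parameter `r`. -/
def flipCoeffAux (b a : Idx n) : k :=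
  (if 0 < a.1 then (if 0 < b.1 then -1 else 1) else 1) *
    (if b.1 = a.1 then (if 0 < a.1 then r else r⁻¹) else
      (if b.1 = -a.1 then (if 0 < a.1 then r else r⁻¹) else 1))

/-- The braid operator with parameter `r` on module valued functions of two indices. -/
def braidAux (f : Idx n → Idx n → M) (b a : Idx n) : M :=
  flipCoeffAux r b a • f a b - (if a.1 < b.1 then r - r⁻¹ else 0) • f b a
    - (if a.1 < -b.1 then (r - r⁻¹) * (if 0 < b.1 then 1 else -1) else 0) • f (-b) (-a)

/-- This Hecke relation makes w + (r - r⁻¹) the inverse of w. Both sides involve only the values of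
f at (b, a), (a, b) and their negatives, so a case analysis on the signs and the relative order of
a, b and -b suffices; a = b and a = -b are separate because the flip coefficient changes there. -/
theorem braidAux_braidAux (hr : r ≠ 0) (f : Idx n → Idx n → M) (b a : Idx n) :
    braidAux r (braidAux r f) b a = f b a - (r - r⁻¹) • braidAux r f b a := by
  have ha := idx_ne a
  have hb := idx_ne b
  rcases eq_or_ne a b with rfl | h
  · rcases lt_or_gt_of_ne ha with ha | ha <;>
    (simp (disch := omega) only [braidAux, flipCoeffAux, neg_val, idx_neg_neg, neg_neg,
       if_pos, if_neg, if_true, if_false, lt_self_iff_false]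
     match_scalars <;> field_simp <;> ring)
  rcases eq_or_ne a (-b) with rfl | h'
  · rcases lt_or_gt_of_ne hb with hb | hb <;>
    (simp (disch := omega) only [braidAux, flipCoeffAux, neg_val, idx_neg_neg, neg_neg,
       if_pos, if_neg, if_true, if_false, lt_self_iff_false]
     match_scalars <;> field_simp <;> ring)
  rw [ne_eq, idx_eq_iff] at h h'
  rw [neg_val] at h'
  rcases lt_or_gt_of_ne ha with ha | ha <;> rcases lt_or_gt_of_ne hb with hb | hb <;>
  rcases lt_or_gt_of_ne h with h | h <;> rcases lt_or_gt_of_ne h' with h' | h' <;>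
  first
  | omega
  | (simp (disch := omega) only [braidAux, flipCoeffAux, neg_val, idx_neg_neg, neg_neg,
       if_pos, if_neg]
     match_scalars <;> field_simp <;> ring)

/-- The sign `(-1)^{|b|}` in the field `k`. -/
def idxSgn (b : Idx n) : k := if 0 < b.1 then 1 else -1

/-- With `braidAux_neg_right` this is the Hecke-Clifford type exchange between the operator and
negation of an index. It is used to reduce the braid relation to positive indices. -/
theorem braidAux_neg_left (f : Idx n → Idx n → M) (b a : Idx n) :
    braidAux r f (-b) a = -braidAux r (fun x y => (idxSgn x : k) • f x (-y)) b a := by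
  have ha := idx_ne a
  have hb := idx_ne b
  rcases lt_or_gt_of_ne ha with ha | ha <;> rcases lt_or_gt_of_ne hb with hb | hb <;>
  (simp (disch := omega) only [braidAux, flipCoeffAux, idxSgn, neg_val, idx_neg_neg, neg_neg,
       if_pos, if_neg]
   split_ifs <;> first | (exfalso; omega) | module)

theorem braidAux_neg_right (f : Idx n → Idx n → M) (b a : Idx n) :
    braidAux r f b (-a) = -(idxSgn b : k) • (braidAux r (fun x y => f (-x) y) b a +
      (r - r⁻¹) • f (-b) a) - (r - r⁻¹) • f b (-a) := by
  have ha := idx_ne a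
  have hb := idx_ne b
  rcases lt_or_gt_of_ne ha with ha | ha <;> rcases lt_or_gt_of_ne hb with hb | hb <;>
  (simp (disch := omega) only [braidAux, flipCoeffAux, idxSgn, neg_val, idx_neg_neg, neg_neg,
       if_pos, if_neg]
   rcases eq_or_ne a b with rfl | h
   · try simp (disch := omega) only [if_pos, if_true, lt_self_iff_false, if_false]
     first | (exfalso; omega) | module
   rcases eq_or_ne a (-b) with rfl | h'
   · try simp (disch := omega) only [if_pos, if_neg, neg_val, neg_neg, idx_neg_neg, if_true, lt_self_iff_false, if_false]
     module
   rw [ne_eq, idx_eq_iff] at h h'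
   rw [neg_val] at h'
   split_ifs <;> first | (exfalso; omega) | module)

/-- The braid operator on the first two of three indices. -/
def braidAux₁ : Module.End k (Idx n → Idx n → Idx n → M) where
  toFun f a b c := braidAux r (fun x y => f x y c) a b
  map_add' f g := by ext a b c; simp only [braidAux, Pi.add_apply]; module
  map_smul' t f := by ext a b c; simp only [braidAux, Pi.smul_apply, RingHom.id_apply]; module

/-- The braid operator on the last two of three indices. -/
def braidAux₂ : Module.End k (Idx n → Idx n → Idx n → M) where
  toFun f a b c := braidAux r (f a) b c
  map_add' f g := by ext a b c; simp only [braidAux, Pi.add_apply]; module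
  map_smul' t f := by ext a b c; simp only [braidAux, Pi.smul_apply, RingHom.id_apply]; module

variable (k n M)

/-- Negation of the first index. -/
def neg₁ : Module.End k (Idx n → Idx n → Idx n → M) where
  toFun f a b c := f (-a) b c
  map_add' _ _ := rfl
  map_smul' _ _ := rfl

/-- Negation of the second index. -/
def neg₂ : Module.End k (Idx n → Idx n → Idx n → M) where
  toFun f a b c := f a (-b) c
  map_add' _ _ := rfl
  map_smul' _ _ := rfl

/-- Negation of the third index. -/
def neg₃ : Module.End k (Idx n → Idx n → Idx n → M) where
  toFun f a b c := f a b (-c)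
  map_add' _ _ := rfl
  map_smul' _ _ := rfl

/-- The parity sign of the first index. -/
def sgn₁ : Module.End k (Idx n → Idx n → Idx n → M) where
  toFun f a b c := (idxSgn a : k) • f a b c
  map_add' f g := by ext; simp
  map_smul' t f := by ext; simp [smul_smul, mul_comm]

/-- The parity sign of the second index. -/
def sgn₂ : Module.End k (Idx n → Idx n → Idx n → M) where
  toFun f a b c := (idxSgn b : k) • f a b c
  map_add' f g := by ext; simp
  map_smul' t f := by ext; simp [smul_smul, mul_comm]

variable {k n M}

/-- The operator only keeps, swaps or negates both indices, and none of these changes the product of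
the two signs. -/
theorem braidAux_idxSgn (f : Idx n → Idx n → M) (b a : Idx n) :
    braidAux r (fun x y => (idxSgn x * idxSgn y : k) • f x y) b a =
      (idxSgn b * idxSgn a : k) • braidAux r f b a := by
  have ha := idx_ne a
  have hb := idx_ne b
  rcases lt_or_gt_of_ne ha with ha | ha <;> rcases lt_or_gt_of_ne hb with hb | hb <;>
  (simp (disch := omega) only [braidAux, idxSgn, neg_val, if_pos, if_neg]
   module)

theorem neg₁_braidAux₁ : neg₁ k n M * braidAux₁ r = -(braidAux₁ r * (sgn₁ k n M * neg₂ k n M)) := by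
  refine LinearMap.ext fun f => ?_
  ext a b c
  exact braidAux_neg_left r (fun x y => f x y c) a b

theorem neg₂_braidAux₂ : neg₂ k n M * braidAux₂ r = -(braidAux₂ r * (sgn₂ k n M * neg₃ k n M)) := by
  refine LinearMap.ext fun f => ?_
  ext a b c
  exact braidAux_neg_left r (f a) b c

theorem neg₂_braidAux₁ : neg₂ k n M * braidAux₁ r =
    -(sgn₁ k n M * braidAux₁ r * neg₁ k n M) - (r - r⁻¹) • (sgn₁ k n M * neg₁ k n M)
      - (r - r⁻¹) • neg₂ k n M := by
  refine LinearMap.ext fun f => ?_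
  ext a b c
  refine (braidAux_neg_right r (fun x y => f x y c) a b).trans ?_
  change _ = -((idxSgn a : k) • braidAux r (fun x y => f (-x) y c) a b)
    - (r - r⁻¹) • ((idxSgn a : k) • f (-a) b c) - (r - r⁻¹) • f a (-b) c
  module

theorem neg₃_braidAux₂ : neg₃ k n M * braidAux₂ r =
    -(sgn₂ k n M * braidAux₂ r * neg₂ k n M) - (r - r⁻¹) • (sgn₂ k n M * neg₂ k n M)
      - (r - r⁻¹) • neg₃ k n M := by
  refine LinearMap.ext fun f => ?_
  ext a b c
  refine (braidAux_neg_right r (f a) b c).trans ?_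
  change _ = -((idxSgn b : k) • braidAux r (fun x y => f a (-x) y) b c)
    - (r - r⁻¹) • ((idxSgn b : k) • f a (-b) c) - (r - r⁻¹) • f a b (-c)
  module

theorem sgn₁_sgn₂_braidAux₁ : sgn₁ k n M * sgn₂ k n M * braidAux₁ r =
    braidAux₁ r * (sgn₁ k n M * sgn₂ k n M) := by
  refine LinearMap.ext fun f => ?_
  ext a b c
  refine Eq.trans ?_ ((braidAux_idxSgn r (fun x y => f x y c) a b).symm.trans ?_)
  · exact smul_smul _ _ _
  · change _ = braidAux r (fun x y => (idxSgn x : k) • (idxSgn y : k) • f x y c) a b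
    simp only [smul_smul]

theorem sgn₁_braidAux₂ : sgn₁ k n M * braidAux₂ r = braidAux₂ r * sgn₁ k n M := by
  refine LinearMap.ext fun f => ?_
  ext a b c
  change (idxSgn a : k) • braidAux r (f a) b c = braidAux r (fun x y => (idxSgn a : k) • f a x y) b c
  simp only [braidAux]
  module

theorem neg₁_braidAux₂ : neg₁ k n M * braidAux₂ r = braidAux₂ r * neg₁ k n M := rfl

theorem neg₃_braidAux₁ : neg₃ k n M * braidAux₁ r = braidAux₁ r * neg₃ k n M := rfl

end GenericBraid

/-! ### The braid relation -/

section GenericBraid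

variable {k : Type*} [Field k] (r : k) {n : ℕ} {M : Type*} [AddCommGroup M] [Module k M]

theorem idxSgn_mul_self (a : Idx n) : (idxSgn a * idxSgn a : k) = 1 := by
  unfold idxSgn; split_ifs <;> simp

theorem sgn₂_braidAux₁_sgn₂ : sgn₂ k n M * braidAux₁ r * sgn₂ k n M =
    sgn₁ k n M * braidAux₁ r * sgn₁ k n M := by
  have h1 : sgn₁ k n M * sgn₁ k n M = 1 := by
    refine LinearMap.ext fun f => ?_
    ext a b c
    exact (smul_smul _ _ _).trans (by rw [idxSgn_mul_self, one_smul]; rfl)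
  have h2 : sgn₂ k n M * sgn₂ k n M = 1 := by
    refine LinearMap.ext fun f => ?_
    ext a b c
    exact (smul_smul _ _ _).trans (by rw [idxSgn_mul_self, one_smul]; rfl)
  calc _ = sgn₁ k n M * (sgn₁ k n M * sgn₂ k n M * braidAux₁ r) * sgn₂ k n M := by
        simp only [← mul_assoc, h1, one_mul]
    _ = _ := by
        rw [sgn₁_sgn₂_braidAux₁, mul_assoc, mul_assoc, mul_assoc, h2, mul_one, mul_assoc]

/-- The defect of the braid relation intertwines negation of the first index with an operation on
the function. Each summand below pushes a negation or a sign through one factor of one of the two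
words of length three. -/
theorem braid_defect_neg₁ {R : Type*} [Ring R] {w1 w2 N1 N2 N3 P1 P2 : R}
    (e1 : N1 * w1 = -(w1 * (P1 * N2))) (e2 : N2 * w2 = -(w2 * (P2 * N3))) (e3 : P1 * w2 = w2 * P1)
    (e4 : N3 * w1 = w1 * N3) (e5 : P1 * P2 * w1 = w1 * (P1 * P2)) (c1 : N1 * w2 = w2 * N1) :
    N1 * (w1 * w2 * w1 - w2 * w1 * w2) = (w1 * w2 * w1 - w2 * w1 * w2) * (P1 * P2 * N3) := by
  linear_combination (norm := noncomm_ring) e1 * (w2 * w1) - (w1 * P1) * e2 * w1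
    + w1 * e3 * (P2 * N3 * w1) + (w1 * w2 * P1 * P2) * e4 + (w1 * w2) * e5 * N3
    - c1 * (w1 * w2) - w2 * e1 * w2 + (w2 * w1 * P1) * e2 - (w2 * w1) * e3 * (P2 * N3)

/-- The analogue for the second index. The extra terms with x come from the inhomogeneous exchange
rules `f1` and `f2`; they cancel because x, a scalar in the application, commutes with the word in
`h`. -/
theorem braid_defect_neg₂ {R : Type*} [Ring R] {w1 w2 N1 N2 N3 P1 P2 x : R}
    (e1 : N1 * w1 = -(w1 * (P1 * N2))) (e2 : N2 * w2 = -(w2 * (P2 * N3))) (e3 : P1 * w2 = w2 * P1)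
    (e4 : N3 * w1 = w1 * N3) (e6 : P2 * w1 * P2 = P1 * w1 * P1) (c1 : N1 * w2 = w2 * N1)
    (h : w2 * P2 * w1 * x = x * (w2 * P2 * w1))
    (f1 : N2 * w1 = -(P1 * w1 * N1) - x * (P1 * N1) - x * N2)
    (f2 : N3 * w2 = -(P2 * w2 * N2) - x * (P2 * N2) - x * N3) :
    N2 * (w1 * w2 * w1 - w2 * w1 * w2) = P1 * (w1 * w2 * w1 - w2 * w1 * w2) * (P1 * N2) := by
  linear_combination (norm := noncomm_ring) f1 * (w2 * w1) - (P1 * w1) * c1 * w1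
    - (P1 * w1 * w2) * e1 - (x * P1) * c1 * w1 - (x * P1 * w2) * e1 - x * e2 * w1 + (x * w2 * P2) * e4
    - e2 * (w1 * w2) + (w2 * P2) * e4 * w2 + (w2 * P2 * w1) * f2 - w2 * e6 * (w2 * N2)
    - h * (P2 * N2 + N3) - x * w2 * e6 * N2
    + e3 * (w1 * P1 * w2 * N2) - P1 * w2 * w1 * e3 * N2 + x * e3 * (w1 * P1 * N2)

theorem neg₁_braid :
    neg₁ k n M * (braidAux₁ r * braidAux₂ r * braidAux₁ r - braidAux₂ r * braidAux₁ r * braidAux₂ r) =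
    (braidAux₁ r * braidAux₂ r * braidAux₁ r - braidAux₂ r * braidAux₁ r * braidAux₂ r) *
      (sgn₁ k n M * sgn₂ k n M * neg₃ k n M) :=
  braid_defect_neg₁ (neg₁_braidAux₁ r) (neg₂_braidAux₂ r) (sgn₁_braidAux₂ r)
    (neg₃_braidAux₁ r) (sgn₁_sgn₂_braidAux₁ r) (neg₁_braidAux₂ r)

theorem neg₂_braid :
    neg₂ k n M * (braidAux₁ r * braidAux₂ r * braidAux₁ r - braidAux₂ r * braidAux₁ r * braidAux₂ r) =
    sgn₁ k n M * (braidAux₁ r * braidAux₂ r * braidAux₁ r - braidAux₂ r * braidAux₁ r * braidAux₂ r) *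
      (sgn₁ k n M * neg₂ k n M) := by
  have f1 := neg₂_braidAux₁ (n := n) (M := M) r
  have f2 := neg₃_braidAux₂ (n := n) (M := M) r
  simp only [Algebra.smul_def] at f1 f2
  exact braid_defect_neg₂ (neg₁_braidAux₁ r) (neg₂_braidAux₂ r) (sgn₁_braidAux₂ r)
    (neg₃_braidAux₁ r) (sgn₂_braidAux₁_sgn₂ r) (neg₁_braidAux₂ r)
    (Algebra.commutes _ _).symm f1 f2

theorem braidAux₁_apply (f : Idx n → Idx n → Idx n → M) (a b c : Idx n) :
    braidAux₁ r f a b c = flipCoeffAux r a b • f b a c - (if b.1 < a.1 then r - r⁻¹ else 0) • f a b c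
      - (if b.1 < -a.1 then (r - r⁻¹) * (if 0 < a.1 then 1 else -1) else 0) • f (-a) (-b) c := rfl

theorem braidAux₂_apply (f : Idx n → Idx n → Idx n → M) (a b c : Idx n) :
    braidAux₂ r f a b c = flipCoeffAux r b c • f a c b - (if c.1 < b.1 then r - r⁻¹ else 0) • f a b c
      - (if c.1 < -b.1 then (r - r⁻¹) * (if 0 < b.1 then 1 else -1) else 0) • f a (-b) (-c) := rfl

-- Once a and b are positive, every coefficient depends only on the order of a and b, the sign of c,
-- and the position of |c| relative to a and b, with coincidences treated as separate cases. Each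
-- case is an identity of rational functions in r.
set_option maxHeartbeats 4000000 in
theorem braidAux_braid_of_pos (hr : r ≠ 0) (f : Idx n → Idx n → Idx n → M) (a b c : Idx n)
    (ha : 0 < a.1) (hb : 0 < b.1) :
    braidAux₁ r (braidAux₂ r (braidAux₁ r f)) a b c =
      braidAux₂ r (braidAux₁ r (braidAux₂ r f)) a b c := by
  have hc := idx_ne c
  rcases lt_trichotomy a.1 b.1 with h1 | h1 | h1 <;>
  rcases lt_or_gt_of_ne hc with hc | hc <;>
  rcases lt_trichotomy a.1 |c.1| with h3 | h3 | h3 <;>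
  rcases lt_trichotomy b.1 |c.1| with h5 | h5 | h5 <;>
  (first | rw [abs_of_pos hc] at h3 h5 | rw [abs_of_neg hc] at h3 h5) <;>
  (try (exfalso; omega)) <;>
  (try (have e : a = b := Subtype.ext h1; subst e)) <;>
  (try (have e : a = c := Subtype.ext h3; subst e)) <;>
  (try (have e : b = c := Subtype.ext h5; subst e)) <;>
  (try (have e : c = -a := Subtype.ext (by rw [neg_val]; omega); subst e)) <;>
  (try (have e : c = -b := Subtype.ext (by rw [neg_val]; omega); subst e)) <;>
  simp (disch := omega) only [braidAux₁_apply, braidAux₂_apply, flipCoeffAux, neg_val,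
      idx_neg_neg, neg_neg, if_pos, if_neg, if_true, if_false, lt_self_iff_false,
      zero_smul, sub_zero, one_smul, one_mul, mul_one] <;>
  match_scalars <;> field_simp <;> ring

/-- The negation symmetries of the defect carry an arbitrary triple to one whose first two indices
are positive, where the defect vanishes by direct computation. The third index needs no reduction.
-/
theorem braidAux_braid (hr : r ≠ 0) :
    braidAux₁ (n := n) (M := M) r * braidAux₂ r * braidAux₁ r =
      braidAux₂ r * braidAux₁ r * braidAux₂ r := by
  rw [← sub_eq_zero]
  -- From here on the defect is an unknown operator, known only through its two symmetries and its
  -- vanishing for positive first and second index.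
  obtain ⟨Z, hZ⟩ : ∃ Z : Module.End k (Idx n → Idx n → Idx n → M),
    braidAux₁ r * braidAux₂ r * braidAux₁ r - braidAux₂ r * braidAux₁ r * braidAux₂ r = Z :=
    ⟨_, rfl⟩
  have hZ1 := neg₁_braid (n := n) (M := M) r
  have hZ2 := neg₂_braid (n := n) (M := M) r
  rw [hZ] at hZ1 hZ2 ⊢
  have hpos (f : Idx n → Idx n → Idx n → M) (a b c : Idx n) (ha : 0 < a.1) (hb : 0 < b.1) :
      Z f a b c = 0 := by
    rw [← hZ]
    exact sub_eq_zero.mpr (braidAux_braid_of_pos r hr f a b c ha hb)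
  have hpos' (f : Idx n → Idx n → Idx n → M) (a b c : Idx n) (ha : 0 < a.1) :
      Z f a b c = 0 := by
    rcases lt_or_gt_of_ne (idx_ne b) with hb | hb
    · have h := congrFun (congrFun (congrFun (LinearMap.congr_fun hZ2 f) a) (-b)) c
      have h' : Z f a (- -b) c = (idxSgn a : k) • Z ((sgn₁ k n M * neg₂ k n M) f) a (-b) c := h
      rw [idx_neg_neg] at h'
      rw [h', hpos _ _ (-b) _ ha (by rw [neg_val]; omega), smul_zero]
    · exact hpos f a b c ha hb
  refine LinearMap.ext fun f => ?_
  ext a b c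
  rcases lt_or_gt_of_ne (idx_ne a) with ha | ha
  · have h := congrFun (congrFun (congrFun (LinearMap.congr_fun hZ1 f) (-a)) b) c
    have h' : Z f (- -a) b c = Z ((sgn₁ k n M * sgn₂ k n M * neg₃ k n M) f) (-a) b c := h
    rw [idx_neg_neg] at h'
    rw [h', hpos' _ (-a) _ _ (by rw [neg_val]; omega)]
    rfl
  · exact hpos' f a b c ha

end GenericBraid

/-! ### Rows, columns and negation symmetries of the matrix S -/

section Sums

variable {m : ℕ} {M : Type*} [AddCommGroup M] [Module K M]

theorem idx_neg_eq_iff (a b : Idx m) : -a = b ↔ a = -b :=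
  ⟨fun h => by rw [← h, idx_neg_neg], fun h => by rw [h, idx_neg_neg]⟩

theorem S_apply (i j k l : Idx m) : S m (i, j) (k, l) =
    (if i = k ∧ j = l then q ^ phi i j else 0) +
      ((if i = l ∧ k = j then (if j.1 < l.1 then xi * sgn (par j) else 0) else 0) +
      (if i = -l ∧ k = -j then (if j.1 < l.1 then xi * sgn (par j) else 0) else 0)) := by
  simp only [S, ← Subtype.coe_lt_coe]
  congr 1
  split_ifs <;> ring

/-- At most three entries contribute to a column: the diagonal one, the swapped one and the swapped
one with both indices negated. -/
theorem sum_S_column (z : Idx m × Idx m) (G : Idx m × Idx m → M) :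
    ∑ y, S m y z • G y = q ^ phi z.1 z.2 • G z +
      ((if z.1.1 < z.2.1 then xi * sgn (par z.1) else 0) • G (z.2, z.1) +
      (if -z.1.1 < z.2.1 then xi * sgn (par (-z.1)) else 0) • G (-z.2, -z.1)) := by
  obtain ⟨α, β⟩ := z
  have h3 (i j : Idx m) : (i = -β ∧ α = -j) ↔ (-β, -α) = (i, j) := by
    rw [Prod.mk.injEq, idx_neg_eq_iff, idx_neg_eq_iff α j, ← idx_neg_eq_iff i, eq_comm (a := -i)]
  have h2 (i j : Idx m) : (i = β ∧ α = j) ↔ (β, α) = (i, j) := by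
    rw [Prod.mk.injEq, eq_comm (a := i)]
  have h1 (i j : Idx m) : (i = α ∧ j = β) ↔ (α, β) = (i, j) := by
    rw [Prod.mk.injEq, eq_comm (a := i), eq_comm (a := j)]
  have e (y : Idx m × Idx m) : S m y (α, β) = (if (α, β) = y then q ^ phi y.1 y.2 else 0) +
      ((if (β, α) = y then (if y.2.1 < β.1 then xi * sgn (par y.2) else 0) else 0) +
      (if (-β, -α) = y then (if y.2.1 < β.1 then xi * sgn (par y.2) else 0) else 0)) := by
    obtain ⟨i, j⟩ := y
    rw [S_apply]
    simp only [h1, h2, h3]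
  simp only [e, add_smul, Finset.sum_add_distrib]
  congr 1
  · rw [Finset.sum_eq_single (α, β) (by intro y _ hy; simp [Ne.symm hy]) (by simp), if_pos rfl]
  congr 1
  · rw [Finset.sum_eq_single (β, α) (by intro y _ hy; simp [Ne.symm hy]) (by simp), if_pos rfl]
  · rw [Finset.sum_eq_single (-β, -α) (by intro y _ hy; simp [Ne.symm hy]) (by simp), if_pos rfl]
    rfl

theorem sum_S_row (x : Idx m × Idx m) (G : Idx m × Idx m → M) :
    ∑ y, S m x y • G y = q ^ phi x.1 x.2 • G x +
      ((if x.2.1 < x.1.1 then xi * sgn (par x.2) else 0) • G (x.2, x.1) +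
      (if x.2.1 < -x.1.1 then xi * sgn (par x.2) else 0) • G (-x.2, -x.1)) := by
  obtain ⟨i, j⟩ := x
  have h3 (k l : Idx m) : (i = -l ∧ k = -j) ↔ (-j, -i) = (k, l) := by
    rw [Prod.mk.injEq, ← idx_neg_eq_iff, eq_comm (a := k), and_comm]
  have h2 (k l : Idx m) : (i = l ∧ k = j) ↔ (j, i) = (k, l) := by
    rw [Prod.mk.injEq, eq_comm (a := k), and_comm]
  have h1 (k l : Idx m) : (i = k ∧ j = l) ↔ (i, j) = (k, l) := by
    rw [Prod.mk.injEq]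
  have e (y : Idx m × Idx m) : S m (i, j) y = (if (i, j) = y then q ^ phi i j else 0) +
      ((if (j, i) = y then (if j.1 < y.2.1 then xi * sgn (par j) else 0) else 0) +
      (if (-j, -i) = y then (if j.1 < y.2.1 then xi * sgn (par j) else 0) else 0)) := by
    obtain ⟨k, l⟩ := y
    rw [S_apply]
    simp only [h1, h2, h3]
  simp only [e, add_smul, Finset.sum_add_distrib]
  congr 1
  · rw [Finset.sum_eq_single (i, j) (by intro y _ hy; simp [Ne.symm hy]) (by simp), if_pos rfl]
  congr 1
  · rw [Finset.sum_eq_single (j, i) (by intro y _ hy; simp [Ne.symm hy]) (by simp), if_pos rfl]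
  · rw [Finset.sum_eq_single (-j, -i) (by intro y _ hy; simp [Ne.symm hy]) (by simp), if_pos rfl]
    rfl

theorem phi_neg_left (i j : Idx m) : phi (-i) j = phi i j := by
  unfold phi
  simp only [idx_neg_eq_iff, idx_neg_neg]
  ring

/-- Negating the first leg exchanges the two off-diagonal summands of S and leaves φ unchanged. In
the second leg negation reverses the order of indices, which is why a correction appears in
`S_neg_right`. -/
theorem S_neg_left (i j k l : Idx m) : S m (-i, j) (-k, l) = S m (i, j) (k, l) := by
  rw [S_apply, S_apply]
  simp only [phi_neg_left, idx_neg_eq_iff, idx_neg_neg]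
  rw [add_comm (ite (i = -l ∧ k = -j) _ _)]

theorem phi_neg_right (i j : Idx m) : phi i (-j) = -phi i j := by
  unfold phi
  rw [par_neg, idx_neg_neg]
  have h : ∀ x : ZMod 2, (if x + 1 = 0 then (1 : ℤ) else -1) = -(if x = 0 then 1 else -1) := by
    decide
  rw [h]; ring

theorem sgn_one : sgn 1 = -1 := by simp [sgn]

theorem sgn_zero : sgn 0 = 1 := by simp [sgn]

/-- The difference between `S` and its conjugate by negation in the second leg. -/
theorem S_neg_right (i j k l : Idx m) : S m (i, j) (k, l) = S m (i, -j) (k, -l) +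
    xi * sgn (par j) * ((if i = l ∧ k = j then 1 else 0) + (if i = -l ∧ k = -j then 1 else 0)) := by
  rw [S_apply, S_apply]
  simp only [phi_neg_right, idx_neg_eq_iff, idx_neg_neg, neg_val, par_neg, sgn_add, sgn_one]
  have hl := idx_ne l
  -- On the diagonal with i = ±j the exponent changes sign, so the entry jumps by exactly the
  -- correction term.
  have hs : (q ^ (if par j = 0 then (1 : ℤ) else -1)) - (q ^ (-(if par j = 0 then (1 : ℤ) else -1)))
      = xi * sgn (par j) := by
    unfold sgn xi
    split_ifs <;> simp
  by_cases h : j = l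
  · subst h
    by_cases h1 : i = j
    · subst h1
      have h2 : ¬ i = -i := by rw [idx_eq_iff, neg_val]; omega
      by_cases h3 : i = k
      · subst h3
        simp [h2, phi, ← hs]
      · simp [h2, h3, Ne.symm h3]
    · by_cases h1 : i = -j
      · subst h1
        have h2 : ¬ -j = j := by rw [idx_eq_iff, neg_val]; omega
        by_cases h3 : k = -j
        · subst h3
          simp [h2, phi, ← hs]
        · simp [h2, h3, Ne.symm h3]
      · have hp : phi i j = 0 := by simp [phi, *]
        simp [*]
  · have h' : j.1 ≠ l.1 := fun e => h (Subtype.ext e)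
    rcases lt_or_gt_of_ne h' with h' | h'
    · simp only [h, h', and_false, if_false, if_true, if_neg (show ¬ -j.1 < -l.1 by omega)]
      split_ifs <;> ring
    · simp only [h, and_false, if_false, if_neg (show ¬ j.1 < l.1 by omega),
        if_pos (show -j.1 < -l.1 by omega)]
      split_ifs <;> ring

end Sums

/-! ### The shifted operator w + η and its mixed braid relations -/

section Wop

variable {n : ℕ} {M N : Type*} [AddCommGroup M] [Module K M] [AddCommGroup N] [Module K N] (η : K)

/-- The braid operator shifted by the scalar `η`, on module valued functions of two indices. -/
def wop : Module.End K (Idx n → Idx n → M) where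
  toFun f b a := braidAux q f b a + η • f b a
  map_add' f g := by
    ext b a
    simp only [braidAux, Pi.add_apply, smul_add]
    abel
  map_smul' t f := by
    ext b a
    simp only [braidAux, Pi.smul_apply, RingHom.id_apply, smul_add, smul_sub]
    simp only [smul_comm _ t]

theorem flipCoeffAux_q (b a : Idx n) :
    flipCoeffAux q b a = sgn ((par b + 1) * (par a + 1)) * q ^ phi b a := by
  have ha := idx_ne a
  have hb := idx_ne b
  unfold flipCoeffAux phi
  simp only [idx_eq_iff, neg_val]
  congr 1
  · unfold par
    split_ifs <;> simp [sgn, add_self_two]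
  · by_cases h : 0 < a.1
    · simp only [par, h, if_true]
      split_ifs <;> first | omega | simp
    · simp only [par, h, if_false]
      split_ifs <;> first | omega | simp_all

theorem sgn_par_eq (b : Idx n) : sgn (par b) = if 0 < b.1 then 1 else -1 := by
  unfold par
  split_ifs <;> simp [sgn]

theorem wop_apply (f : Idx n → Idx n → M) (b a : Idx n) : wop η f b a =
    (sgn ((par b + 1) * (par a + 1)) * q ^ phi b a) • f a b - (if a.1 < b.1 then xi else 0) • f b a
      - (if a.1 < -b.1 then xi * sgn (par b) else 0) • f (-b) (-a) + η • f b a := by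
  rw [sgn_par_eq, ← flipCoeffAux_q]
  rfl

/-- The coefficients are scalars, so linear maps act on the values only. This lets one operator
serve for algebras, endomorphism rings and tensor products at once. -/
theorem wop_map (φ : M →ₗ[K] N) (f : Idx n → Idx n → M) (b a : Idx n) :
    wop η (fun x y => φ (f x y)) b a = φ (wop η f b a) := by
  simp only [wop_apply, map_add, map_sub, map_smul]

/-- The matrix coefficients of the shifted braid operator. -/
def wcoeff (b a k c : Idx n) : K := wop η (fun x y => if x = k ∧ y = c then (1 : K) else 0) b a

theorem wop_eq_sum (f : Idx n → Idx n → M) (b a : Idx n) :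
    wop η f b a = ∑ k, ∑ c, wcoeff η b a k c • f k c := by
  have e : f = ∑ k, ∑ c, fun x y => (if x = k ∧ y = c then (1 : K) else 0) • f k c := by
    ext x y
    simp only [Finset.sum_apply, ite_smul, one_smul, zero_smul]
    rw [Finset.sum_eq_single x (by intro k _ hk; simp [Ne.symm hk]) (by simp),
      Finset.sum_eq_single y (by intro k _ hk; simp [Ne.symm hk]) (by simp)]
    simp
  conv_lhs => rw [e]
  simp only [map_sum, Finset.sum_apply]
  refine Finset.sum_congr rfl fun k _ => Finset.sum_congr rfl fun c _ => ?_
  exact wop_map η (LinearMap.toSpanSingleton K M (f k c)) _ b a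

/-- The dictionary between w and the matrix S: a flip of the two column indices together with parity
signs. -/
theorem wop_zero_eq_sum_S (f : Idx n → Idx n → M) (b a : Idx n) :
    wop 0 f b a = sgn ((par b + 1) * (par a + 1)) •
      ∑ y, S n (b, a) y • sgn (par b * (par y.1 + 1)) • f y.2 y.1 := by
  rw [sum_S_row, wop_apply, zero_smul, add_zero, smul_add, smul_add, sub_sub, sub_eq_add_neg,
    neg_add, ← neg_smul, ← neg_smul]
  have h2 : ∀ x : ZMod 2, x = 0 ∨ x = 1 := by decide
  congr 1
  · simp only [smul_smul]
    congr 2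
    rcases h2 (par b) with h | h <;> simp [h, sgn, add_self_two]
  congr 1
  · simp only [smul_smul]
    congr 1
    rcases h2 (par b) with h | h <;> rcases h2 (par a) with h' | h' <;> rw [h, h'] <;>
      split_ifs <;> simp [sgn, add_self_two]
  · simp only [smul_smul, par_neg]
    congr 1
    rcases h2 (par b) with h | h <;> rcases h2 (par a) with h' | h' <;> rw [h, h'] <;>
      split_ifs <;> simp [sgn, add_self_two]

theorem wop_wop (f : Idx n → Idx n → M) : wop 0 (wop 0 f) = f - xi • wop 0 f := by
  ext b a
  have h := braidAux_braidAux q q_ne_zero f b a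
  have e : ∀ (g : Idx n → Idx n → M), wop 0 g = braidAux q g := fun g => by
    ext b a
    exact (congrArg (braidAux q g b a + ·) (zero_smul K _)).trans (add_zero _)
  rw [e, e, h]
  rfl

/-- The shifted braid operator on the first two of three indices. -/
def wop₁ : Module.End K (Idx n → Idx n → Idx n → M) := braidAux₁ q + algebraMap K _ η

/-- The shifted braid operator on the last two of three indices. -/
def wop₂ : Module.End K (Idx n → Idx n → Idx n → M) := braidAux₂ q + algebraMap K _ η

theorem wop₁_apply (f : Idx n → Idx n → Idx n → M) (a b c : Idx n) :
    wop₁ η f a b c = wop η (fun x y => f x y c) a b := rfl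

theorem wop₂_apply (f : Idx n → Idx n → Idx n → M) (a b c : Idx n) :
    wop₂ η f a b c = wop η (f a) b c := rfl

/-- The condition y² = yx covers y = 0, the braid relation itself, and y = x, where w + x = w⁻¹ by
the Hecke relation and the claim is the braid relation with two factors inverted. The general form
treats both cases together. -/
theorem mixed_braid {R : Type*} [Ring R] {w1 w2 x y : R} (hb : w1 * w2 * w1 = w2 * w1 * w2)
    (h1 : w1 * w1 = 1 - x * w1) (h2 : w2 * w2 = 1 - x * w2) (c1 : w1 * y = y * w1)
    (c2 : w2 * y = y * w2) (hy : y * y = y * x) :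
    w2 * (w1 + y) * (w2 + y) = (w1 + y) * (w2 + y) * w1 := by
  linear_combination (norm := noncomm_ring) -hb + y * h2 - y * h1 + c2 * w2 + c2 * w1
    + hy * w2 - hy * w1 + c2 * y + y * c2 + w2 * c1 - c1 * w1

theorem braidAux₁_sq : braidAux₁ (n := n) (M := M) q * braidAux₁ q =
    1 - algebraMap K _ xi * braidAux₁ q := by
  refine LinearMap.ext fun f => ?_
  ext a b c
  exact braidAux_braidAux q q_ne_zero (fun x y => f x y c) a b

theorem braidAux₂_sq : braidAux₂ (n := n) (M := M) q * braidAux₂ q =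
    1 - algebraMap K _ xi * braidAux₂ q := by
  refine LinearMap.ext fun f => ?_
  ext a b c
  exact braidAux_braidAux q q_ne_zero (f a) b c

variable {η}

/-- The hypothesis on η says that η is 0 or ξ, so that w + η is w or w⁻¹. -/
theorem wop₂_wop₁_wop₂ (hη : η * η = η * xi) :
    wop₂ (n := n) (M := M) 0 * wop₁ η * wop₂ η = wop₁ η * wop₂ η * wop₁ 0 := by
  have h0 : algebraMap K (Module.End K (Idx n → Idx n → Idx n → M)) 0 = 0 := map_zero _
  unfold wop₁ wop₂
  rw [h0, add_zero, add_zero]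
  exact mixed_braid (braidAux_braid q q_ne_zero) braidAux₁_sq braidAux₂_sq
    (Algebra.commutes _ _).symm (Algebra.commutes _ _).symm (by rw [← map_mul, ← map_mul, hη])

theorem wop₁_wop₂_wop₁ (hη : η * η = η * xi) :
    wop₁ (n := n) (M := M) 0 * wop₂ η * wop₁ η = wop₂ η * wop₁ η * wop₂ 0 := by
  have h0 : algebraMap K (Module.End K (Idx n → Idx n → Idx n → M)) 0 = 0 := map_zero _
  unfold wop₁ wop₂
  rw [h0, add_zero, add_zero]
  exact mixed_braid (braidAux_braid q q_ne_zero).symm braidAux₂_sq braidAux₁_sq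
    (Algebra.commutes _ _).symm (Algebra.commutes _ _).symm (by rw [← map_mul, ← map_mul, hη])

end Wop

/-! ### Reduction of the defining relations to negative row indices -/

section Lift

variable {s n : ℕ} {B : Type*} [Ring B] [Algebra K B]

/-- The symmetry relation `x_{αb} = (-1)^{|α|+|b|} x_{-α,-b}`. -/
def SymRel (x : Idx s → Idx n → B) : Prop := ∀ α b, x α b = sgn (par α + par b) • x (-α) (-b)

/-- The quadratic relations among the generators `x_{αb}` with `α < 0`. -/
def HalfRel (x : Idx s → Idx n → B) : Prop :=
  ∀ β α : Idx s, β.1 < 0 → α.1 < 0 → ∀ b a : Idx n,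
    (if β = α then q⁻¹ else 1) • (x β b * x α a) - (if β.1 < α.1 then xi else 0) • (x α b * x β a) =
      wop 0 (fun k c => x α k * x β c) b a

/-- The generator matrix `∑ (-1)^{|b|(|α|+|b|)} E_{bα} ⊗ x_{αb}`. -/
def genMatrix (x : Idx s → Idx n → B) : Matrix (Idx n) (Idx s) B := fun b α =>
  sgn (par b * (par α + par b)) • x α b

/-- The exponent of the sign in the left side of the quadratic relations. -/
def relSignL (b b' y₁ y₂ α β : ZMod 2) : ZMod 2 :=
  (b' + y₂) * (b + y₁ + b' + b') + (y₁ + α) * (b + y₁) + (y₂ + β) * (b + y₁ + b' + y₂) + b * (y₁ + b) +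
    b' * (y₂ + b')

/-- The exponent of the sign in the right side of the quadratic relations. -/
def relSignR (b b' y₁ y₂ α β : ZMod 2) : ZMod 2 :=
  (y₂ + β) * (b + y₁ + b' + y₂) + (y₁ + α) * (b + y₁) + y₂ * (β + y₂) + y₁ * (α + y₁)

/-- The left side of the quadratic relations. -/
def relL (x : Idx s → Idx n → B) (b b' : Idx n) (α β : Idx s) : B :=
  ∑ y : Idx s × Idx s, S s y (α, β) •
    sgn (relSignL (par b) (par b') (par y.1) (par y.2) (par α) (par β)) • (x y.1 b * x y.2 b')

/-- The right side of the quadratic relations. -/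
def relR (x : Idx s → Idx n → B) (b b' : Idx n) (α β : Idx s) : B :=
  ∑ y : Idx n × Idx n, S n (b, b') y •
    sgn (relSignR (par b) (par b') (par y.1) (par y.2) (par α) (par β)) • (x β y.2 * x α y.1)

variable (x : Idx s → Idx n → B)

theorem mulR_eq_relL (b b' : Idx n) (α β : Idx s) :
    mulR (mulR (leg1 n (genMatrix x)) (leg2 s (genMatrix x))) (scal B (S s)) (b, b') (α, β) =
      relL x b b' α β := by
  rw [mulR, relL]
  refine Finset.sum_congr rfl fun y _ => ?_
  rw [mulR_leg2, Finset.sum_eq_single b' (by intro c _ hc; simp [leg1, Ne.symm hc]) (by simp)]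
  simp only [leg1, if_true, genMatrix, scal, Matrix.map_apply, smul_mul_assoc, mul_smul_comm,
    smul_smul, ← Algebra.commutes, ← Algebra.smul_def]
  congr 1
  simp only [relSignL, sgn_add]
  ring

theorem mulR_eq_relR (b b' : Idx n) (α β : Idx s) :
    mulR (mulR (scal B (S n)) (leg2 n (genMatrix x))) (leg1 s (genMatrix x)) (b, b') (α, β) =
      relR x b b' α β := by
  rw [mulR_leg1, relR, Fintype.sum_prod_type]
  refine Finset.sum_congr rfl fun c _ => ?_
  rw [mulR_leg2, Finset.sum_mul, Finset.smul_sum]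
  refine Finset.sum_congr rfl fun k _ => ?_
  simp only [genMatrix, scal, Matrix.map_apply, smul_mul_assoc, mul_smul_comm,
    smul_smul, ← Algebra.smul_def]
  congr 1
  simp only [relSignR, sgn_add]
  ring

variable {x}

/-- Negation of one index. -/
def negEquiv (n : ℕ) : Idx n ≃ Idx n := ⟨Neg.neg, Neg.neg, idx_neg_neg, idx_neg_neg⟩

/-- S is even, so sign exponents need to agree only where the four parities sum to zero. -/
theorem S_smul_congr {m : ℕ} {y z : Idx m × Idx m} {u v : B}
    (h : par y.1 + par z.1 + par y.2 + par z.2 = 0 → u = v) : S m y z • u = S m y z • v := by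
  by_cases hS : S m y z = 0
  · rw [hS, zero_smul, zero_smul]
  · rw [h (S_parity hS)]

/-- The sum is reindexed by negating the first row index; S is invariant under this, and the
symmetry relation absorbs the sign. -/
theorem relL_neg_left (hs : SymRel x) (b b' : Idx n) (α β : Idx s) :
    relL x (-b) b' (-α) β = relL x b b' α β := by
  unfold relL
  refine Fintype.sum_equiv ((negEquiv s).prodCongr (Equiv.refl _)) _ _ ?_
  rintro ⟨y₁, y₂⟩
  change _ = S s (-y₁, y₂) (α, β) • _
  rw [show S s (-y₁, y₂) (α, β) = S s (y₁, y₂) (-α, β) by rw [← S_neg_left, idx_neg_neg]]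
  refine S_smul_congr fun h => ?_
  change _ = sgn (relSignL _ _ (par (-y₁)) (par y₂) _ _) • (x (-y₁) b * x y₂ b')
  rw [hs (-y₁) b, idx_neg_neg, smul_mul_assoc, smul_smul, ← sgn_add]
  congr 2
  simp only [par_neg] at h ⊢
  unfold relSignL
  revert h
  generalize par b = a1, par b' = a2, par y₁ = a3, par y₂ = a4, par α = a5, par β = a6
  revert a1 a2 a3 a4 a5 a6; decide +kernel

theorem relR_neg_left (hs : SymRel x) (b b' : Idx n) (α β : Idx s) :
    relR x (-b) b' (-α) β = relR x b b' α β := by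
  unfold relR
  refine Fintype.sum_equiv ((negEquiv n).prodCongr (Equiv.refl _)) _ _ ?_
  rintro ⟨y₁, y₂⟩
  change _ = S n (b, b') (-y₁, y₂) • _
  rw [← S_neg_left b b' (-y₁) y₂, idx_neg_neg]
  refine S_smul_congr fun h => ?_
  change _ = sgn (relSignR _ _ (par (-y₁)) (par y₂) _ _) • (x β y₂ * x α (-y₁))
  rw [hs α (-y₁), idx_neg_neg, mul_smul_comm, smul_smul, ← sgn_add]
  congr 2
  simp only [par_neg] at h ⊢
  unfold relSignR
  revert h
  generalize par b = a1, par b' = a2, par y₁ = a3, par y₂ = a4, par α = a5, par β = a6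
  revert a1 a2 a3 a4 a5 a6; decide +kernel

/-- The correction term between the two conjugates of the quadratic relations. -/
theorem relL_neg_right (hs : SymRel x) (b b' : Idx n) (α β : Idx s) :
    relL x b b' α β = relL x b (-b') α (-β) +
      xi • (sgn (par α + relSignL (par b) (par b') (par β) (par α) (par α) (par β)) •
          (x β b * x α b') +
        sgn (par (-α) + relSignL (par b) (par b') (par (-β)) (par (-α)) (par α) (par β)) •
          (x (-β) b * x (-α) b')) := by
  have e (y : Idx s × Idx s) : S s y (α, β) = S s (y.1, -y.2) (α, -β) + xi * sgn (par y.2) *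
      ((if (β, α) = y then 1 else 0) + (if (-β, -α) = y then 1 else 0)) := by
    obtain ⟨i, j⟩ := y
    have h3 : (i = -β ∧ α = -j) ↔ (-β, -α) = (i, j) := by
      rw [Prod.mk.injEq, idx_neg_eq_iff, idx_neg_eq_iff α j, ← idx_neg_eq_iff i, eq_comm (a := -i)]
    have h2 : (i = β ∧ α = j) ↔ (β, α) = (i, j) := by rw [Prod.mk.injEq, eq_comm (a := i)]
    rw [S_neg_right]
    simp only [h2, h3]
  unfold relL
  simp only [e, add_smul, Finset.sum_add_distrib]
  congr 1
  · refine Fintype.sum_equiv ((Equiv.refl _).prodCongr (negEquiv s)) _ _ ?_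
    rintro ⟨y₁, y₂⟩
    refine S_smul_congr fun h => ?_
    change _ = sgn (relSignL _ _ (par y₁) (par (-y₂)) _ _) • (x y₁ b * x (-y₂) (-b'))
    rw [hs y₂ b', mul_smul_comm, smul_smul, ← sgn_add]
    congr 2
    simp only [par_neg] at h ⊢
    unfold relSignL
    revert h
    generalize par b = a1, par b' = a2, par y₁ = a3, par y₂ = a4, par α = a5, par β = a6
    revert a1 a2 a3 a4 a5 a6; decide +kernel
  · simp only [mul_add, add_smul, Finset.sum_add_distrib, smul_add]
    rw [Finset.sum_eq_single (β, α) (by intro y _ hy; simp [Ne.symm hy]) (by simp),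
      Finset.sum_eq_single (-β, -α) (by intro y _ hy; simp [Ne.symm hy]) (by simp)]
    simp only [if_true, mul_one, smul_smul, sgn_add, mul_assoc]

theorem relR_neg_right (hs : SymRel x) (b b' : Idx n) (α β : Idx s) :
    relR x b b' α β = relR x b (-b') α (-β) +
      xi • (sgn (par b' + relSignR (par b) (par b') (par b') (par b) (par α) (par β)) •
          (x β b * x α b') +
        sgn (par b' + relSignR (par b) (par b') (par (-b')) (par (-b)) (par α) (par β)) •
          (x β (-b) * x α (-b'))) := by
  have e (y : Idx n × Idx n) : S n (b, b') y = S n (b, -b') (y.1, -y.2) + xi * sgn (par b') *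
      ((if (b', b) = y then 1 else 0) + (if (-b', -b) = y then 1 else 0)) := by
    obtain ⟨i, j⟩ := y
    rw [S_neg_right]
    simp only [Prod.mk.injEq, idx_neg_eq_iff, and_comm, eq_comm (a := i)]
  unfold relR
  simp only [e, add_smul, Finset.sum_add_distrib]
  congr 1
  · refine Fintype.sum_equiv ((Equiv.refl _).prodCongr (negEquiv n)) _ _ ?_
    rintro ⟨y₁, y₂⟩
    refine S_smul_congr fun h => ?_
    change _ = sgn (relSignR _ _ (par y₁) (par (-y₂)) _ _) • (x (-β) (-y₂) * x α y₁)
    rw [hs β y₂, smul_mul_assoc, smul_smul, ← sgn_add]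
    congr 2
    simp only [par_neg] at h ⊢
    unfold relSignR
    revert h
    generalize par b = a1, par b' = a2, par y₁ = a3, par y₂ = a4, par α = a5, par β = a6
    revert a1 a2 a3 a4 a5 a6; decide +kernel
  · simp only [mul_add, add_smul, Finset.sum_add_distrib, smul_add]
    rw [Finset.sum_eq_single (b', b) (by intro y _ hy; simp [Ne.symm hy]) (by simp),
      Finset.sum_eq_single (-b', -b) (by intro y _ hy; simp [Ne.symm hy]) (by simp)]
    simp only [if_true, mul_one, smul_smul, sgn_add, mul_assoc]

/-- Neither side is invariant under negation in the second leg, but both acquire the same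
correction, so their difference is invariant. The second halves of the corrections are matched by
applying the symmetry relation to both factors. -/
theorem relL_sub_relR_neg_right (hs : SymRel x) (b b' : Idx n) (α β : Idx s) :
    relL x b b' α β - relR x b b' α β = relL x b (-b') α (-β) - relR x b (-b') α (-β) := by
  rw [relL_neg_right hs, relR_neg_right hs, add_sub_add_comm, add_eq_left, sub_eq_zero]
  congr 2
  · congr 2
    unfold relSignL relSignR
    generalize par b = a1, par b' = a2, par α = a5, par β = a6
    revert a1 a2 a5 a6; decide +kernel
  · rw [hs (-β), hs (-α), idx_neg_neg, idx_neg_neg, smul_mul_smul_comm, smul_smul, ← sgn_add,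
      ← sgn_add]
    congr 2
    simp only [par_neg]
    unfold relSignL relSignR
    generalize par b = a1, par b' = a2, par α = a5, par β = a6
    revert a1 a2 a5 a6; decide +kernel

/-- For negative row indices the column of S has no term with negated indices, so the left side
reduces to at most two products. A common sign is divided out of both sides. -/
theorem relL_eq_relR_iff (b b' : Idx n) (α β : Idx s) (hα : α.1 < 0)
    (hβ : β.1 < 0) : relL x b b' α β = relR x b b' α β ↔
      (if α = β then q⁻¹ else 1) • (x α b * x β b') - (if α.1 < β.1 then xi else 0) • (x β b * x α b') =
        wop 0 (fun k c => x β k * x α c) b b' := by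
  have pα : par α = 1 := by simp [par, hα.le]
  have pβ : par β = 1 := by simp [par, hβ.le]
  rw [wop_zero_eq_sum_S]
  have eR : relR x b b' α β = sgn ((par b + 1) * (par b' + 1)) • sgn ((par b + 1) * (par b' + 1)) •
      ∑ y, S n (b, b') y • sgn (par b * (par y.1 + 1)) • (x β y.2 * x α y.1) := by
    rw [smul_smul, ← sgn_add, add_self_two, sgn_zero, one_smul, relR]
    refine Finset.sum_congr rfl fun y _ => S_smul_congr fun h => ?_
    congr 2
    rw [pα, pβ]
    revert h
    unfold relSignR
    simp only
    generalize par b = a1, par b' = a2, par y.1 = a3, par y.2 = a4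
    revert a1 a2 a3 a4; decide +kernel
  have eL : relL x b b' α β = sgn ((par b + 1) * (par b' + 1)) •
    ((if α = β then q⁻¹ else 1) • (x α b * x β b') -
      (if α.1 < β.1 then xi else 0) • (x β b * x α b')) := by
    -- With α and β negative, -α < β is impossible.
    rw [relL, sum_S_column, if_neg (show ¬ -(α, β).1.1 < (α, β).2.1 by simp only; omega),
      zero_smul, add_zero]
    simp only [pα, pβ, sgn_one]
    have hs : relSignL (par b) (par b') 1 1 1 1 = (par b + 1) * (par b' + 1) := by
      unfold relSignL
      generalize par b = a1, par b' = a2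
      revert a1 a2; decide +kernel
    rw [hs, smul_comm _ (sgn _), smul_comm _ (sgn _), ← smul_add]
    congr 1
    rw [sub_eq_add_neg, ← neg_smul]
    congr 2
    · have h1 : ¬ α = -β := by rw [idx_eq_iff, neg_val]; omega
      unfold phi
      rw [if_neg h1, pβ]
      split_ifs <;> simp_all
    · split_ifs <;> simp
  have hne (y : ZMod 2) : sgn y ≠ 0 := by unfold sgn; split_ifs <;> simp
  rw [eL, eR]
  exact (smul_right_injective B (hne _)).eq_iff

/-- Negation in each leg moves any pair of row indices to a pair of negative ones, so the quadratic
relations there imply all the others. -/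
theorem relL_eq_relR (hs : SymRel x) (hh : HalfRel x) (b b' : Idx n) (α β : Idx s) :
    relL x b b' α β = relR x b b' α β := by
  have h1 : ∀ b b' (α β : Idx s), α.1 < 0 → relL x b b' α β = relR x b b' α β := by
    intro b b' α β hα
    rcases lt_or_gt_of_ne (idx_ne β) with hβ | hβ
    · exact (relL_eq_relR_iff b b' α β hα hβ).mpr (hh α β hα hβ b b')
    · rw [← sub_eq_zero, relL_sub_relR_neg_right hs, sub_eq_zero]
      have hβ' : (-β).1 < 0 := by rw [neg_val]; omega
      exact (relL_eq_relR_iff _ _ _ _ hα hβ').mpr (hh _ _ hα hβ' _ _)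
  rcases lt_or_gt_of_ne (idx_ne α) with hα | hα
  · exact h1 b b' α β hα
  · rw [← relL_neg_left hs, ← relR_neg_left hs]
    exact h1 _ _ _ _ (by rw [neg_val]; omega)

/-- The homomorphism out of `Ā_{s,n}` given by elements satisfying the symmetry and the quadratic
relations for negative row indices. -/
def abarLift (x : Idx s → Idx n → B) (hs : SymRel x) (hh : HalfRel x) : Abar s n →ₐ[K] B :=
  RingQuot.liftAlgHom K ⟨FreeAlgebra.lift K fun p : Idx s × Idx n => x p.1 p.2, by
    intro u v hr
    cases hr with
    | sym α b =>
      rw [map_smul, tfree, tfree, FreeAlgebra.lift_ι_apply, FreeAlgebra.lift_ι_apply]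
      exact hs α b
    | rtt y z =>
      obtain ⟨b, b'⟩ := y
      obtain ⟨α, β⟩ := z
      have e : (Tfree s n) = genMatrix fun α b => tfree α b := rfl
      rw [e, mulR_eq_relL, mulR_eq_relR]
      have h := relL_eq_relR hs hh b b' α β
      simp only [relL, relR, tfree, map_sum, map_smul, map_mul, FreeAlgebra.lift_ι_apply] at h ⊢
      exact h⟩

theorem abarLift_tbar (x : Idx s → Idx n → B) (hs : SymRel x) (hh : HalfRel x) (α : Idx s)
    (b : Idx n) : abarLift x hs hh (tbar α b) = x α b := by
  simp [abarLift, tbar, tfree]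

end Lift

/-! ### Homomorphisms out of the coordinate superalgebra from half of the generators -/

section Abar

variable {s n : ℕ} {B : Type*} [Ring B] [Algebra K B]

theorem tbar_half : HalfRel (tbar : Idx s → Idx n → Abar s n) := by
  intro β α hβ hα b a
  rw [← relL_eq_relR_iff b a β α hβ hα]
  have h := RingQuot.mkAlgHom_rel K (BarRel.rtt (s := s) (n := n) (b, a) (β, α))
  have e : (Tfree s n) = genMatrix fun α b => tfree α b := rfl
  rw [e, mulR_eq_relL, mulR_eq_relR] at h
  simp only [relL, relR, map_sum, map_smul, map_mul] at h ⊢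
  exact h

/-- Generators with positive row index are scalar multiples of generators with negative row index,
so the latter suffice. -/
theorem abar_induction {p : Abar s n → Prop} (hc : ∀ c : K, p (algebraMap K _ c))
    (hadd : ∀ x y, p x → p y → p (x + y)) (hmul : ∀ x y, p x → p y → p (x * y))
    (ht : ∀ (α : Idx s) (b : Idx n), α.1 < 0 → p (tbar α b)) (x : Abar s n) : p x := by
  obtain ⟨u, rfl⟩ := RingQuot.mkAlgHom_surjective K (BarRel s n) x
  induction u using FreeAlgebra.induction with
  | grade0 c => rw [AlgHom.commutes]; exact hc c
  | grade1 y =>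
    obtain ⟨α, b⟩ := y
    change p (tbar α b)
    rcases lt_or_gt_of_ne (idx_ne α) with hα | hα
    · exact ht α b hα
    · rw [tbar_sym, Algebra.smul_def]
      exact hmul _ _ (hc _) (ht _ _ (by rw [neg_val]; omega))
  | mul u v hu hv => rw [map_mul]; exact hmul _ _ hu hv
  | add u v hu hv => rw [map_add]; exact hadd _ _ hu hv

/-- The extension of a family indexed by negative `α` by the symmetry relation. -/
def symExt (y : Idx s → Idx n → B) : Idx s → Idx n → B := fun α b =>
  if α.1 < 0 then y α b else sgn (par α + par b) • y (-α) (-b)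

theorem symExt_of_neg (y : Idx s → Idx n → B) {α : Idx s} (b : Idx n) (h : α.1 < 0) :
    symExt y α b = y α b := if_pos h

theorem symExt_sym (y : Idx s → Idx n → B) : SymRel (symExt y) := by
  intro α b
  have hα := idx_ne α
  unfold symExt
  rw [neg_val]
  by_cases h : α.1 < 0
  · rw [if_pos h, if_neg (by omega), idx_neg_neg, idx_neg_neg, smul_smul, ← sgn_add, par_neg,
      par_neg]
    have e : ∀ x y : ZMod 2, x + y + (x + 1 + (y + 1)) = 0 := by decide
    rw [e, sgn_zero, one_smul]
  · rw [if_neg h, if_pos (by omega)]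

theorem symExt_half {y : Idx s → Idx n → B} (h : HalfRel y) : HalfRel (symExt y) := by
  intro β α hβ hα b a
  simp only [symExt_of_neg _ _ hβ, symExt_of_neg _ _ hα]
  exact h β α hβ hα b a

/-- The homomorphism out of `Ā_{s,n}` determined by its values on the generators `t̄_{αb}` with
`α < 0`. -/
def abarHom (y : Idx s → Idx n → B) (h : HalfRel y) : Abar s n →ₐ[K] B :=
  abarLift (symExt y) (symExt_sym y) (symExt_half h)

theorem abarHom_tbar (y : Idx s → Idx n → B) (h : HalfRel y) {α : Idx s} (b : Idx n)
    (hα : α.1 < 0) : abarHom y h (tbar α b) = y α b := by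
  rw [abarHom, abarLift_tbar, symExt_of_neg y b hα]

end Abar

/-! ### Moving a vector past an element of the coordinate superalgebra -/

section Transfer

variable {s n : ℕ} (η : K)

/-- Summing against a delta function recovers the value of the operator on a general family; this
turns matrix entries into an action on vectors. -/
theorem sum_wop_ite {M N : Type*} [AddCommGroup M] [Module K M] [AddCommGroup N] [Module K N]
    (φ : Idx n → M →ₗ[K] N) (f : Idx n → M) (b a : Idx n) :
    ∑ c, φ c (wop η (fun k c' => if c' = c then f k else 0) b a) =
      wop η (fun k c => φ c (f k)) b a := by
  simp only [← wop_map]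
  have e : (fun k c => φ c (f k)) = ∑ c, fun k c' => φ c (if c' = c then f k else 0) := by
    ext k c'
    simp only [Finset.sum_apply]
    rw [Finset.sum_eq_single c' (by intro c _ hc; simp [Ne.symm hc]) (by simp), if_pos rfl]
  rw [e, map_sum]
  simp only [Finset.sum_apply]

/-- The matrix of the operator moving a vector past the generator `t̄_{αa}`. -/
def transferGen (α : Idx s) (a : Idx n) : Matrix (Idx n) (Idx n) (Abar s n) := fun b c =>
  wop η (fun k c' => if c' = c then tbar α k else 0) b a

theorem transferGen_mulVec (α : Idx s) (a : Idx n) (g : Idx n → Abar s n) (b : Idx n) :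
    (transferGen η α a).mulVec g b = wop η (fun k c => tbar α k * g c) b a :=
  sum_wop_ite η (fun c => LinearMap.mulRight K (g c)) (fun k => tbar α k) b a

/-- A product of two transfer matrices applied to a vector is a word in the shifted operators on
three indices: that of the vector and those of the two generators. Quadratic relations between the
matrices thereby become braid type relations. -/
theorem transferGen_mul_mulVec (α β : Idx s) (a b : Idx n) (g : Idx n → Abar s n) (d : Idx n) :
    (transferGen η β b * transferGen η α a).mulVec g d =
      wop₁ η (wop₂ η fun k k' c => tbar β k * tbar α k' * g c) d b a := by
  rw [← Matrix.mulVec_mulVec, transferGen_mulVec, wop₁_apply]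
  refine congrArg (fun F => wop η F d b) (funext fun k => funext fun c => ?_)
  rw [transferGen_mulVec, wop₂_apply]
  simp only [mul_assoc]
  exact (wop_map η (LinearMap.mulLeft K (tbar β k)) _ _ _).symm

variable {η}

/-- The mixed braid relation carries w from the outer labels b, a to the inner column indices, where
the quadratic relation of the generators themselves applies. -/
theorem transferGen_half (hη : η * η = η * xi) :
    HalfRel (transferGen η : Idx s → Idx n → Matrix (Idx n) (Idx n) (Abar s n)) := by
  intro β α hβ hα b a
  have key (g : Idx n → Abar s n) (d : Idx n) (F : Matrix (Idx n) (Idx n) (Abar s n) →ₗ[K] Abar s n)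
      (hF : ∀ M, F M = M.mulVec g d) :
      F ((if β = α then q⁻¹ else 1) • (transferGen η β b * transferGen η α a) -
        (if β.1 < α.1 then xi else 0) • (transferGen η α b * transferGen η β a)) =
      F (wop 0 (fun k c => transferGen η α k * transferGen η β c) b a) := by
    rw [map_sub, map_smul, map_smul, ← wop_map]
    simp only [hF, transferGen_mul_mulVec]
    have h := congrFun (congrFun (congrFun (LinearMap.congr_fun (wop₂_wop₁_wop₂ hη)
      (fun k k' c => tbar α k * tbar β k' * g c)) d) b) a
    refine Eq.trans ?_ h.symm
    have e : wop₁ 0 (fun k k' c => tbar α k * tbar β k' * g c) =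
        (if β = α then q⁻¹ else 1) • (fun k k' c => tbar β k * tbar α k' * g c) -
        (if β.1 < α.1 then xi else 0) • (fun k k' c => tbar α k * tbar β k' * g c) := by
      ext k k' c
      rw [wop₁_apply]
      have h2 := wop_map 0 (LinearMap.mulRight K (g c)) (fun k k' => tbar α k * tbar β k') k k'
      refine h2.trans ?_
      rw [← tbar_half β α hβ hα k k', map_sub, map_smul, map_smul]
      rfl
    simp only [Module.End.mul_apply, e, map_sub, map_smul, Pi.sub_apply, Pi.smul_apply]
  -- An equality of matrices is tested on the standard basis vectors.
  ext d c
  have h := key (Pi.single c 1) d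
    { toFun := fun M => M.mulVec (Pi.single c 1) d
      map_add' := fun M N => by simp
      map_smul' := fun t M => by simp } (fun _ => rfl)
  simpa [Matrix.mulVec_single] using h

/-- The matrix coefficients of the operator moving a vector past an element of `Ā_{s,n}`. -/
def transfer (s : ℕ) (hη : η * η = η * xi) (b c : Idx n) : Abar s n →ₗ[K] Abar s n :=
  LinearMap.proj c ∘ₗ LinearMap.proj b ∘ₗ
    (abarHom (transferGen η) (transferGen_half (s := s) (n := n) hη)).toLinearMap

variable (hη : η * η = η * xi)

theorem transfer_tbar {α : Idx s} (hα : α.1 < 0) (a b c : Idx n) :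
    transfer s hη b c (tbar α a) = wop η (fun k c' => if c' = c then tbar α k else 0) b a :=
  congrFun (congrFun (abarHom_tbar _ (transferGen_half hη) a hα) b) c

theorem transfer_algebraMap (r : K) (b c : Idx n) :
    transfer s hη b c (algebraMap K _ r) = if b = c then algebraMap K _ r else 0 :=
  (congrFun (congrFun (AlgHom.commutes (abarHom _ (transferGen_half (s := s) (n := n) hη)) r) b)
    c).trans (Matrix.algebraMap_matrix_apply)

theorem transfer_one (b c : Idx n) :
    transfer s hη b c 1 = if b = c then 1 else 0 := by
  rw [← map_one (algebraMap K (Abar s n)), transfer_algebraMap]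

/-- The operators are the entries of an algebra homomorphism to matrices, so this is matrix
multiplication. -/
theorem transfer_mul (x y : Abar s n) (b c : Idx n) :
    transfer s hη b c (x * y) = ∑ k, transfer s hη b k x * transfer s hη k c y :=
  (congrFun (congrFun (map_mul (abarHom _ (transferGen_half (s := s) (n := n) hη)) x y) b)
    c).trans Matrix.mul_apply

theorem sum_transfer_tbar_mul {α : Idx s} (hα : α.1 < 0) (a b : Idx n) (g : Idx n → Abar s n) :
    ∑ c, transfer s hη b c (tbar α a) * g c = wop η (fun k c => tbar α k * g c) b a := by
  simp only [transfer_tbar hη hα]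
  exact sum_wop_ite η (fun c => LinearMap.mulRight K (g c)) (fun k => tbar α k) b a

/-- The operator moving two vectors past an element of `Ā_{s,n}`. -/
def transferTwo (x : Abar s n) (g : Idx n → Idx n → Abar s n) (b b' : Idx n) : Abar s n :=
  ∑ c', ∑ c, transfer s hη b c (transfer s hη b' c' x) * g c c'

theorem transferTwo_mul (x y : Abar s n) (g : Idx n → Idx n → Abar s n) :
    transferTwo hη (x * y) g = transferTwo hη x (transferTwo hη y g) := by
  ext b b'
  simp only [transferTwo, transfer_mul, map_sum, Finset.mul_sum, Finset.sum_mul, mul_assoc]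
  calc _ = ∑ c', ∑ e, ∑ c, ∑ f, transfer s hη b f (transfer s hη b' e x) *
        (transfer s hη f c (transfer s hη e c' y) * g c c') :=
        Finset.sum_congr rfl fun _ _ => Finset.sum_comm
    _ = ∑ e, ∑ c', ∑ c, ∑ f, transfer s hη b f (transfer s hη b' e x) *
        (transfer s hη f c (transfer s hη e c' y) * g c c') := Finset.sum_comm
    _ = ∑ e, ∑ c', ∑ f, ∑ c, transfer s hη b f (transfer s hη b' e x) *
        (transfer s hη f c (transfer s hη e c' y) * g c c') :=
        Finset.sum_congr rfl fun _ _ => Finset.sum_congr rfl fun _ _ => Finset.sum_comm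
    _ = _ := Finset.sum_congr rfl fun _ _ => Finset.sum_comm

/-- Moving two vectors past x commutes with w acting on the pair of vectors. The property is
multiplicative in x, and on generators it is the mirrored mixed braid relation. -/
theorem wop_transferTwo (x : Abar s n) (g : Idx n → Idx n → Abar s n) :
    wop 0 (transferTwo hη x g) = transferTwo hη x (wop 0 g) := by
  induction x using abar_induction generalizing g with
  | hc r =>
    have e (g : Idx n → Idx n → Abar s n) : transferTwo hη (algebraMap K _ r) g = r • g := by
      funext b b'
      unfold transferTwo
      rw [Finset.sum_eq_single b' (by intro c _ hc; simp [transfer_algebraMap, Ne.symm hc]) (by simp),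
        transfer_algebraMap, if_pos rfl,
        Finset.sum_eq_single b (by intro c _ hc; simp [transfer_algebraMap, Ne.symm hc]) (by simp),
        transfer_algebraMap, if_pos rfl, Pi.smul_apply, Pi.smul_apply, Algebra.smul_def]
    rw [e, e, map_smul]
  | hadd x y hx hy =>
    have e (g : Idx n → Idx n → Abar s n) :
        transferTwo hη (x + y) g = transferTwo hη x g + transferTwo hη y g := by
      funext b b'
      simp [transferTwo, add_mul, Finset.sum_add_distrib]
    rw [e, e, map_add, hx, hy]
  | hmul x y hx hy => rw [transferTwo_mul, transferTwo_mul, hx, hy]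
  | ht α a hα =>
    have e (g : Idx n → Idx n → Abar s n) (b b' : Idx n) : transferTwo hη (tbar α a) g b b' =
        wop₂ η (wop₁ η fun k c c' => tbar α k * g c c') b b' a := by
      unfold transferTwo
      rw [wop₂_apply]
      have h (k c' : Idx n) : wop₁ η (fun k c c' => tbar α k * g c c') b k c' =
          ∑ c, transfer s hη b c (tbar α k) * g c c' := by
        rw [wop₁_apply, sum_transfer_tbar_mul hη hα]
      simp only [transfer_tbar hη hα _ b']
      let φ (c' : Idx n) : Abar s n →ₗ[K] Abar s n :=
        ∑ c, LinearMap.mulRight K (g c c') ∘ₗ transfer s hη b c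
      have hφ (c' : Idx n) (u : Abar s n) : φ c' u = ∑ c, transfer s hη b c u * g c c' := by
        simp [φ]
      have h2 := sum_wop_ite η φ (fun k => tbar α k) b' a
      simp only [hφ] at h2
      rw [h2]
      exact congrArg (fun F => wop η F b' a) (funext fun k => funext fun c' => (h k c').symm)
    ext b b'
    have h := congrFun (congrFun (congrFun (LinearMap.congr_fun (wop₁_wop₂_wop₁ hη)
      (fun k c c' => tbar α k * g c c')) b) b') a
    simp only [Module.End.mul_apply] at h
    rw [e]
    have e1 : wop 0 (transferTwo hη (tbar α a) g) b b' =
        wop₁ 0 (wop₂ η (wop₁ η fun k c c' => tbar α k * g c c')) b b' a := by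
      rw [wop₁_apply]
      exact congrArg (fun F => wop 0 F b b') (funext fun x => funext fun y => e g x y)
    rw [e1]
    refine h.trans ?_
    refine congrArg (fun F => wop₂ η (wop₁ η F) b b' a) ?_
    funext k c c'
    exact wop_map 0 (LinearMap.mulLeft K (tbar α k)) g c c'

/-- The entrywise form of `wop_transferTwo`, obtained by choosing a delta function for the pair of
vectors. With η = ξ it becomes the RTT relation of `Uq n`; with η = 0 it gives the relations within
the second tensor factor. -/
theorem wop_transfer_transfer (x : Abar s n) (c c' b b' : Idx n) :
    wop 0 (fun b b' => transfer s hη b c (transfer s hη b' c' x)) b b' =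
      ∑ k, ∑ e, wcoeff 0 k e c c' • transfer s hη b k (transfer s hη b' e x) := by
  have h := congrFun (congrFun (wop_transferTwo hη x
    (fun k e => if k = c ∧ e = c' then (1 : Abar s n) else 0)) b) b'
  have e1 : transferTwo hη x (fun k e => if k = c ∧ e = c' then (1 : Abar s n) else 0) =
      fun b b' => transfer s hη b c (transfer s hη b' c' x) := by
    funext b b'
    unfold transferTwo
    rw [Finset.sum_eq_single c' (by intro k _ hk; simp [hk]) (by simp),
      Finset.sum_eq_single c (by intro k _ hk; simp [hk]) (by simp)]
    simp
  have e2 (k e : Idx n) : wop 0 (fun k e => if k = c ∧ e = c' then (1 : Abar s n) else 0) k e =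
      algebraMap K _ (wcoeff 0 k e c c') := by
    rw [wcoeff, ← Algebra.linearMap_apply, ← wop_map]
    simp only [Algebra.linearMap_apply, apply_ite (algebraMap K (Abar s n)), map_one, map_zero]
  rw [e1] at h
  rw [h, transferTwo, Finset.sum_comm]
  simp only [e2, ← Algebra.commutes, ← Algebra.smul_def]

end Transfer

/-! ### Factorization of the superalgebra of size s + l -/

section Factorization

variable {s l n : ℕ}

theorem iotaBar_tbar {m : ℕ} (p : ℕ) (h : s + p ≤ m) (α : Idx s) (b : Idx n) :
    iotaBar p h n (tbar α b) = tbar (shift p h α) b := by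
  simp [iotaBar, tbar, tfree]

/-- The shift embedding the indices of the first factor. -/
abbrev shiftL (s l : ℕ) (α : Idx s) : Idx (s + l) := shift l le_rfl α

/-- The shift embedding the indices of the second factor. -/
abbrev shiftR (s l : ℕ) (β : Idx l) : Idx (s + l) := shift 0 (Nat.le_add_left l s) β

theorem shift_neg_iff {m : ℕ} (p : ℕ) (h : s + p ≤ m) (α : Idx s) :
    (shift p h α).1 < 0 ↔ α.1 < 0 := by
  have := idx_ne α
  rw [shift_val]
  split_ifs <;> omega

/-- The first factor occupies the outer row indices. Its negative indices lie below every index of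
the second factor, which fixes the form of all mixed relations. -/
theorem shiftL_lt_shiftR {α : Idx s} {β : Idx l} (hα : α.1 < 0) :
    (shiftL s l α).1 < (shiftR s l β).1 := by
  have h := β.2
  simp only [Finset.mem_erase, Finset.mem_Icc] at h
  rw [shiftL, shiftR, shift_val, shift_val]
  split_ifs <;> omega

theorem exists_shift (γ : Idx (s + l)) : (∃ β, shiftR s l β = γ) ∨ ∃ α, shiftL s l α = γ := by
  have h := γ.2
  simp only [Finset.mem_erase, Finset.mem_Icc] at h
  by_cases h1 : -(l : ℤ) ≤ γ.1 ∧ γ.1 ≤ l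
  · left
    refine ⟨⟨γ.1, by simp only [Finset.mem_erase, Finset.mem_Icc]; omega⟩, Subtype.ext ?_⟩
    rw [shiftR, shift_val]
    simp
  · right
    refine ⟨⟨if 0 < γ.1 then γ.1 - l else γ.1 + l, ?_⟩, Subtype.ext ?_⟩
    · simp only [Finset.mem_erase, Finset.mem_Icc]
      split_ifs <;> omega
    · rw [shiftL, shift_val]
      simp only
      split_ifs <;> omega

theorem zero_shift : (0 : K) * 0 = 0 * xi := by simp

/-- The elements `x_{αb}` with `α < 0` generate the algebra. -/
def HalfGenerates {A : Type*} [Ring A] [Algebra K A] (x : Idx s → Idx n → A) : Prop :=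
  Algebra.adjoin K {u | ∃ α b, α.1 < 0 ∧ x α b = u} = ⊤

theorem HalfGenerates.induction {A : Type*} [Ring A] [Algebra K A] {x : Idx s → Idx n → A}
    (hx : HalfGenerates x) {p : A → Prop} (hc : ∀ c : K, p (algebraMap K _ c))
    (hadd : ∀ u v, p u → p v → p (u + v)) (hmul : ∀ u v, p u → p v → p (u * v))
    (ht : ∀ (α : Idx s) (b : Idx n), α.1 < 0 → p (x α b)) (u : A) : p u := by
  have hu : u ∈ Algebra.adjoin K {u | ∃ α b, α.1 < 0 ∧ x α b = u} := by
    rw [hx]; trivial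
  induction hu using Algebra.adjoin_induction with
  | mem u h => obtain ⟨α, b, hα, rfl⟩ := h; exact ht α b hα
  | algebraMap r => exact hc r
  | add u v _ _ hu hv => exact hadd u v hu hv
  | mul u v _ _ hu hv => exact hmul u v hu hv

theorem tbar_generates : HalfGenerates (tbar : Idx s → Idx n → Abar s n) := by
  refine Algebra.eq_top_iff.mpr fun u => ?_
  induction u using abar_induction with
  | hc c => exact Subalgebra.algebraMap_mem _ c
  | hadd u v hu hv => exact Subalgebra.add_mem _ hu hv
  | hmul u v hu hv => exact Subalgebra.mul_mem _ hu hv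
  | ht α b hα => exact Algebra.subset_adjoin ⟨α, b, hα, rfl⟩

/-- Operators `D_{bc}` on an algebra generated by `x_{αa}` which move a vector past an element. -/
structure IsTransfer {A : Type*} [Ring A] [Algebra K A] (x : Idx s → Idx n → A)
    (D : Idx n → Idx n → A →ₗ[K] A) : Prop where
  one : ∀ b c, D b c 1 = if b = c then 1 else 0
  mul : ∀ b c u v, D b c (u * v) = ∑ k, D b k u * D k c v
  gen : ∀ α, α.1 < 0 → ∀ a b c, D b c (x α a) = wop 0 (fun k c' => if c' = c then x α k else 0) b a
  rtt : ∀ u c c' b b', wop 0 (fun b b' => D b c (D b' c' u)) b b' =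
    ∑ k, ∑ e, wcoeff 0 k e c c' • D b k (D b' e u)

theorem transfer_isTransfer : IsTransfer (tbar : Idx s → Idx n → Abar s n) (transfer s zero_shift) where
  one := transfer_one zero_shift
  mul b c u v := transfer_mul zero_shift u v b c
  gen _ hα a b c := transfer_tbar zero_shift hα a b c
  rtt u c c' b b' := wop_transfer_transfer zero_shift u c c' b b'

variable {A B : Type*} [Ring A] [Algebra K A] [Ring B] [Algebra K B]

/-- The operator of left multiplication by a generator of the second factor. -/
def actR (D : Idx n → Idx n → A →ₗ[K] A) (y : Idx l → Idx n → B) (β : Idx l) (b : Idx n) :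
    Module.End K (A ⊗[K] B) :=
  ∑ c, TensorProduct.map (D b c) (LinearMap.mulLeft K (y β c))

variable (A B) in
/-- Left multiplication on the first factor. -/
def actL : A →ₐ[K] Module.End K (A ⊗[K] B) :=
  AlgHom.ofLinearMap (LinearMap.rTensorHom B ∘ₗ (LinearMap.mul K A))
    (by
      refine TensorProduct.ext' fun x y => ?_
      simp)
    (by
      intro u v
      refine TensorProduct.ext' fun x y => ?_
      simp [mul_assoc])

theorem actL_tmul (u x : A) (y : B) : actL A B u (x ⊗ₜ[K] y) = (u * x) ⊗ₜ[K] y := rfl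

variable {x : Idx s → Idx n → A} {D : Idx n → Idx n → A →ₗ[K] A} {y : Idx l → Idx n → B}

theorem actR_tmul (β : Idx l) (b : Idx n) (u : A) (v : B) :
    actR D y β b (u ⊗ₜ[K] v) = ∑ c, D b c u ⊗ₜ[K] (y β c * v) := by
  simp [actR]

theorem actR_mul_actR_tmul (β α : Idx l) (b a : Idx n) (u : A) (v : B) :
    (actR D y β b * actR D y α a) (u ⊗ₜ[K] v) = ∑ c, ∑ e,
      D b c (D a e u) ⊗ₜ[K] (y β c * y α e * v) := by
  rw [Module.End.mul_apply, actR_tmul, map_sum, Finset.sum_comm]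
  simp only [actR_tmul, mul_assoc]

/-- Evaluation of an endomorphism at a vector. -/
def evalAt {V : Type*} [AddCommGroup V] [Module K V] (v : V) : Module.End K V →ₗ[K] V :=
  LinearMap.applyₗ v

/-- The relation between pairs of operators D moves w from the labels b, a to the column indices of
the second factor, where the quadratic relations of y apply. -/
theorem actR_half (hD : IsTransfer x D) (hy : HalfRel y) : HalfRel (actR D y) := by
  intro β α hβ hα b a
  refine TensorProduct.ext' fun u v => ?_
  have hR : wop 0 (fun k c => actR D y α k * actR D y β c) b a (u ⊗ₜ[K] v) =
      wop 0 (fun k c => (actR D y α k * actR D y β c) (u ⊗ₜ[K] v)) b a :=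
    (wop_map 0 (evalAt (u ⊗ₜ[K] v)) _ b a).symm
  rw [hR]
  simp only [actR_mul_actR_tmul]
  have h1 : wop 0 (fun b a => ∑ c, ∑ e, D b c (D a e u) ⊗ₜ[K]
      (y α c * y β e * v)) b a = ∑ c, ∑ e,
      (wop 0 (fun b a => D b c (D a e u)) b a) ⊗ₜ[K] (y α c * y β e * v) := by
    have e1 : (fun b a => ∑ c, ∑ e, D b c (D a e u) ⊗ₜ[K]
      (y α c * y β e * v)) = ∑ c, ∑ e, fun b a =>
        D b c (D a e u) ⊗ₜ[K] (y α c * y β e * v) := by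
      funext b a
      simp only [Finset.sum_apply]
    rw [e1]
    simp only [map_sum, Finset.sum_apply]
    refine Finset.sum_congr rfl fun c _ => Finset.sum_congr rfl fun e _ => ?_
    exact wop_map 0 ((TensorProduct.mk K _ _).flip (y α c * y β e * v)) _ b a
  rw [h1]
  simp only [hD.rtt, TensorProduct.sum_tmul, ← TensorProduct.smul_tmul']
  -- Summation by parts: the matrix coefficients of w pass from the first tensor factor to the
  -- second.
  have h2 : ∑ c, ∑ e, ∑ k, ∑ f, wcoeff 0 k f c e •
      (D b k (D a f u) ⊗ₜ[K] (y α c * y β e * v)) =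
      ∑ k, ∑ f, D b k (D a f u) ⊗ₜ[K] (wop 0 (fun c e => y α c * y β e) k f * v) := by
    simp only [wop_eq_sum, Finset.sum_mul, TensorProduct.tmul_sum, smul_mul_assoc,
      TensorProduct.tmul_smul]
    calc _ = ∑ c, ∑ k, ∑ e, ∑ f, wcoeff 0 k f c e •
          (D b k (D a f u) ⊗ₜ[K] (y α c * y β e * v)) :=
          Finset.sum_congr rfl fun _ _ => Finset.sum_comm
      _ = ∑ k, ∑ c, ∑ e, ∑ f, wcoeff 0 k f c e •
          (D b k (D a f u) ⊗ₜ[K] (y α c * y β e * v)) := Finset.sum_comm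
      _ = ∑ k, ∑ c, ∑ f, ∑ e, wcoeff 0 k f c e •
          (D b k (D a f u) ⊗ₜ[K] (y α c * y β e * v)) :=
          Finset.sum_congr rfl fun _ _ => Finset.sum_congr rfl fun _ _ => Finset.sum_comm
      _ = _ := Finset.sum_congr rfl fun _ _ => Finset.sum_comm
  rw [h2]
  simp only [← hy β α hβ hα, LinearMap.sub_apply, LinearMap.smul_apply, actR_mul_actR_tmul,
    sub_mul, smul_mul_assoc, TensorProduct.tmul_sub, TensorProduct.tmul_smul,
    Finset.sum_sub_distrib, Finset.smul_sum]

/-- The mixed relation on the tensor product: D is a matrix homomorphism, and on generators it is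
given by w itself. -/
theorem actR_mul_actL (hD : IsTransfer x D) {α : Idx s} (hα : α.1 < 0) (β : Idx l) (b a : Idx n) :
    actR D y β b * actL A B (x α a) =
      wop 0 (fun k c => actL A B (x α k) * actR D y β c) b a := by
  refine TensorProduct.ext' fun u v => ?_
  have hR : wop 0 (fun k c => actL A B (x α k) * actR D y β c) b a (u ⊗ₜ[K] v) =
      wop 0 (fun k c => (actL A B (x α k) * actR D y β c) (u ⊗ₜ[K] v)) b a :=
    (wop_map 0 (evalAt (u ⊗ₜ[K] v)) _ b a).symm
  rw [hR]
  simp only [Module.End.mul_apply, actL_tmul, actR_tmul, map_sum, hD.mul,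
    TensorProduct.sum_tmul, hD.gen α hα]
  rw [Finset.sum_comm]
  let φ (e : Idx n) : A →ₗ[K] A ⊗[K] B :=
    ∑ c, (TensorProduct.mk K _ _).flip (y β c * v) ∘ₗ LinearMap.mulRight K (D e c u)
  have h := sum_wop_ite 0 φ (fun k => x α k) b a
  simpa [φ] using h

/-- The generators of `Ā_{s+l,n}` acting on the tensor product. -/
def actGen (x : Idx s → Idx n → A) (D : Idx n → Idx n → A →ₗ[K] A) (y : Idx l → Idx n → B) :
    Idx (s + l) → Idx n → Module.End K (A ⊗[K] B) :=
  Function.extend (shiftR s l) (actR D y)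
    (Function.extend (shiftL s l) (fun α a => actL A B (x α a)) 0)

theorem actGen_shiftR (β : Idx l) : actGen x D y (shiftR s l β) = actR D y β :=
  (shift_inj _ _).extend_apply _ _ _

theorem actGen_shiftL {α : Idx s} (hα : α.1 < 0) :
    actGen x D y (shiftL s l α) = fun a => actL A B (x α a) := by
  unfold actGen
  rw [Function.extend_apply', (shift_inj _ _).extend_apply]
  rintro ⟨β, h⟩
  exact (shiftL_lt_shiftR (β := β) hα).ne (by rw [h])

/-- Relations within one factor come from that factor. The mixed relation with the second factor on
the left is `actR_mul_actL`, and the one with the first factor on the left follows from it by the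
Hecke relation. -/
theorem actGen_half (hx : HalfRel x) (hD : IsTransfer x D) (hy : HalfRel y) :
    HalfRel (actGen x D y) := by
  intro β α hβ hα b a
  rcases exists_shift β with ⟨β, rfl⟩ | ⟨β, rfl⟩ <;> rcases exists_shift α with ⟨α, rfl⟩ | ⟨α, rfl⟩ <;>
    rw [shift_neg_iff] at hα hβ
  · rw [actGen_shiftR, actGen_shiftR]
    simp only [(shift_inj _ _).eq_iff, Subtype.coe_lt_coe, shift_lt]
    exact actR_half hD hy β α hβ hα b a
  · rw [actGen_shiftR, actGen_shiftL hα, if_neg, if_neg, one_smul, zero_smul, sub_zero]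
    · exact actR_mul_actL hD hα β b a
    · exact (shiftL_lt_shiftR hα).not_gt
    · exact fun h => (shiftL_lt_shiftR (β := β) hα).ne (by rw [h])
  · rw [actGen_shiftR, actGen_shiftL hβ, if_neg, if_pos (shiftL_lt_shiftR hβ), one_smul]
    · have h : (fun k c => actR D y α k * actL A B (x β c)) =
          wop 0 (fun k c => actL A B (x β k) * actR D y α c) := by
        funext k c
        exact actR_mul_actL hD hβ α k c
      -- Applying w to the mixed relation gives w² = 1 - ξw on the right, and ξw of the ordered
      -- products is ξ times the reversed ones.
      rw [h, wop_wop, ← h]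
      rfl
    · exact fun h => (shiftL_lt_shiftR (β := α) hβ).ne (by rw [h])
  · rw [actGen_shiftL hα, actGen_shiftL hβ]
    simp only [(shift_inj _ _).eq_iff, Subtype.coe_lt_coe, shift_lt]
    have h := congrArg (actL A B) (hx β α hβ hα b a)
    simp only [map_sub, map_smul, map_mul] at h
    refine h.trans ?_
    exact (wop_map 0 (actL A B).toLinearMap _ b a).symm.trans (by simp)

/-- The map `u ⊗ v ↦ f(u) g(v)`. -/
def mulTensor {C : Type*} [Ring C] [Algebra K C] (f : A →ₐ[K] C) (g : B →ₐ[K] C) : A ⊗[K] B →ₗ[K] C :=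
  TensorProduct.lift ((LinearMap.mul K C).compl₁₂ f.toLinearMap g.toLinearMap)

theorem mulTensor_tmul {C : Type*} [Ring C] [Algebra K C] (f : A →ₐ[K] C) (g : B →ₐ[K] C) (u : A)
    (v : B) : mulTensor f g (u ⊗ₜ[K] v) = f u * g v := rfl

/-- Moving a generator of the second factor past an element of the first one. -/
theorem mul_eq_sum_transfer {C : Type*} [Ring C] [Algebra K C] {z : Idx (s + l) → Idx n → C}
    (hz : HalfRel z) (hg : HalfGenerates x) (hD : IsTransfer x D) (f : A →ₐ[K] C)
    (hf : ∀ α a, α.1 < 0 → f (x α a) = z (shiftL s l α) a) {β : Idx l} (hβ : β.1 < 0) (u : A)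
    (b : Idx n) : z (shiftR s l β) b * f u = ∑ c, f (D b c u) * z (shiftR s l β) c := by
  induction u using hg.induction generalizing b with
  | hc r =>
    rw [Finset.sum_eq_single b, Algebra.algebraMap_eq_smul_one, map_smul, map_smul, map_smul,
      hD.one, if_pos rfl, map_one, mul_smul_comm, smul_mul_assoc, one_mul, mul_one]
    · intro c _ hc
      rw [Algebra.algebraMap_eq_smul_one, map_smul, hD.one, if_neg (Ne.symm hc), smul_zero,
        map_zero, zero_mul]
    · simp
  | hadd u v hu hv => simp only [map_add, mul_add, add_mul, Finset.sum_add_distrib, hu, hv]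
  | hmul u v hu hv =>
    rw [map_mul, ← mul_assoc, hu, Finset.sum_mul]
    simp only [mul_assoc, hv, hD.mul, map_sum, map_mul, Finset.sum_mul, Finset.mul_sum]
    rw [Finset.sum_comm]
  | ht α a hα =>
    have h := hz (shiftR s l β) (shiftL s l α) ((shift_neg_iff _ _ _).mpr hβ)
      ((shift_neg_iff _ _ _).mpr hα) b a
    rw [if_neg, if_neg, one_smul, zero_smul, sub_zero] at h
    · rw [hf α a hα, h]
      simp only [hD.gen α hα]
      have h2 := sum_wop_ite 0 (fun c => LinearMap.mulRight K (z (shiftR s l β) c) ∘ₗ f.toLinearMap)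
        (fun k => x α k) b a
      simp only [LinearMap.comp_apply, AlgHom.toLinearMap_apply, LinearMap.mulRight_apply, hf _ _ hα] at h2
      exact h2.symm
    · exact (shiftL_lt_shiftR hα).not_gt
    · exact fun h => (shiftL_lt_shiftR (β := β) hα).ne (by rw [h])

/-- The large algebra acts on A ⊗ B as it would act by left multiplication on itself if the
factorization were known. Evaluation at 1 ⊗ 1 is then a two-sided inverse of the multiplication map.
-/
theorem mulTensor_bijective (hx : HalfRel x) (hgx : HalfGenerates x) (hD : IsTransfer x D)
    (hy : HalfRel y) (hgy : HalfGenerates y) (f : A →ₐ[K] Abar (s + l) n)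
    (hf : ∀ α a, α.1 < 0 → f (x α a) = tbar (shiftL s l α) a) (g : B →ₐ[K] Abar (s + l) n)
    (hg : ∀ α a, α.1 < 0 → g (y α a) = tbar (shiftR s l α) a) :
    Function.Bijective (mulTensor f g) := by
  let Ψ : Abar (s + l) n →ₐ[K] Module.End K (A ⊗[K] B) :=
    abarHom (actGen x D y) (actGen_half hx hD hy)
  have hL : Ψ.comp f = actL A B := by
    refine AlgHom.ext fun u => ?_
    induction u using hgx.induction with
    | hc r => rw [AlgHom.commutes, AlgHom.commutes]
    | hadd u v hu hv => rw [map_add, map_add, hu, hv]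
    | hmul u v hu hv => rw [map_mul, map_mul, hu, hv]
    | ht α a hα =>
      rw [AlgHom.comp_apply, hf α a hα]
      exact (abarHom_tbar _ _ a ((shift_neg_iff _ _ _).mpr hα)).trans
        (congrFun (actGen_shiftL hα) a)
  have hΨR (β : Idx l) (b : Idx n) (hβ : β.1 < 0) : Ψ (tbar (shiftR s l β) b) = actR D y β b :=
    (abarHom_tbar _ _ b ((shift_neg_iff _ _ _).mpr hβ)).trans (congrFun (actGen_shiftR β) b)
  -- On 1 ⊗ w the operators D reduce to the identity matrix, so the second factor acts by left
  -- multiplication.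
  have hR (v w : B) : Ψ (g v) ((1 : A) ⊗ₜ[K] w) = 1 ⊗ₜ[K] (v * w) := by
    induction v using hgy.induction generalizing w with
    | hc r =>
      rw [AlgHom.commutes, AlgHom.commutes, Module.algebraMap_end_apply, ← TensorProduct.tmul_smul,
        Algebra.smul_def]
    | hadd u v hu hv =>
      rw [map_add, map_add, LinearMap.add_apply, hu, hv, add_mul, TensorProduct.tmul_add]
    | hmul u v hu hv => rw [map_mul, map_mul, Module.End.mul_apply, hv, hu, mul_assoc]
    | ht β b hβ =>
      rw [hg β b hβ, hΨR β b hβ, actR_tmul, Finset.sum_eq_single b, hD.one, if_pos rfl]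
      · intro c _ hc
        rw [hD.one, if_neg (Ne.symm hc), TensorProduct.zero_tmul]
      · simp
  -- The multiplication map is linear over the large algebra; this is where moving a generator past
  -- the whole first factor is needed.
  have hσ (u : Abar (s + l) n) (w : A ⊗[K] B) : mulTensor f g (Ψ u w) = u * mulTensor f g w := by
    induction u using abar_induction generalizing w with
    | hc r => rw [AlgHom.commutes, Module.algebraMap_end_apply, map_smul, Algebra.smul_def]
    | hadd u v hu hv => rw [map_add, LinearMap.add_apply, map_add, hu, hv, add_mul]
    | hmul u v hu hv => rw [map_mul, Module.End.mul_apply, hu, hv, mul_assoc]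
    | ht γ b hγ =>
      induction w using TensorProduct.induction_on with
      | zero => simp
      | add w w' hw hw' => rw [map_add, map_add, map_add, mul_add, hw, hw']
      | tmul u v =>
        rcases exists_shift γ with ⟨β, rfl⟩ | ⟨α, rfl⟩
        · rw [shift_neg_iff] at hγ
          rw [hΨR β b hγ, actR_tmul, map_sum, mulTensor_tmul, ← mul_assoc,
            mul_eq_sum_transfer tbar_half hgx hD f hf hγ, Finset.sum_mul]
          simp only [mulTensor_tmul, map_mul, hg β _ hγ, mul_assoc]
        · rw [shift_neg_iff] at hγ
          rw [← hf α b hγ, ← AlgHom.comp_apply, hL, actL_tmul, mulTensor_tmul, mulTensor_tmul,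
            map_mul, mul_assoc]
  constructor
  · have hinv (w : A ⊗[K] B) : Ψ (mulTensor f g w) (1 ⊗ₜ[K] 1) = w := by
      induction w using TensorProduct.induction_on with
      | zero => simp
      | add w w' hw hw' => rw [map_add, map_add, LinearMap.add_apply, hw, hw']
      | tmul u v =>
        rw [mulTensor_tmul, map_mul, Module.End.mul_apply, hR, mul_one, ← AlgHom.comp_apply, hL,
          actL_tmul, mul_one]
    intro w w' h
    rw [← hinv w, ← hinv w', h]
  · intro u
    refine ⟨Ψ u (1 ⊗ₜ[K] 1), ?_⟩
    rw [hσ, mulTensor_tmul, map_one, map_one, mul_one, mul_one]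

end Factorization

/-! ### Parity operators on a superalgebra -/

section Parity

variable {A : Type*} [Ring A] [Algebra K A] (𝒜 : ZMod 2 → Submodule K A) [GradedAlgebra 𝒜]

/-- The operator `u ↦ (-1)^{i|u|} u` on a superalgebra. -/
def parOp (i : ZMod 2) : A →ₗ[K] A := ∑ j : ZMod 2, sgn (i * j) • GradedAlgebra.proj 𝒜 j

theorem proj_of_mem {u : A} {j : ZMod 2} (hu : u ∈ 𝒜 j) (i : ZMod 2) :
    GradedAlgebra.proj 𝒜 i u = if i = j then u else 0 := by
  rw [GradedAlgebra.proj_apply]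
  split_ifs with h
  · subst h
    exact DirectSum.decompose_of_mem_same 𝒜 hu
  · exact DirectSum.decompose_of_mem_ne 𝒜 hu (Ne.symm h)

theorem sum_proj (u : A) : ∑ j : ZMod 2, GradedAlgebra.proj 𝒜 j u = u := by
  induction u using DirectSum.Decomposition.inductionOn 𝒜 with
  | zero => simp
  | @homogeneous i u =>
    simp only [proj_of_mem 𝒜 u.2]
    rw [Finset.sum_eq_single i (by intro k _ hk; simp [hk]) (by simp), if_pos rfl]
  | add u v hu hv => simp only [map_add, Finset.sum_add_distrib, hu, hv]

theorem parOp_of_mem {u : A} {j : ZMod 2} (hu : u ∈ 𝒜 j) (i : ZMod 2) :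
    parOp 𝒜 i u = sgn (i * j) • u := by
  simp only [parOp, LinearMap.sum_apply, LinearMap.smul_apply, proj_of_mem 𝒜 hu]
  rw [Finset.sum_eq_single j (by intro k _ hk; simp [hk]) (by simp), if_pos rfl]

/-- The two homogeneous components have opposite eigenvalues, so the unwanted one equals its own
negative and vanishes because 2 is invertible. -/
theorem mem_of_parOp {u : A} {j : ZMod 2} (hu : parOp 𝒜 1 u = sgn j • u) : u ∈ 𝒜 j := by
  have h := congrArg (GradedAlgebra.proj 𝒜 (j + 1)) hu
  have h1 := parOp_of_mem 𝒜 (SetLike.coe_mem (DirectSum.decompose 𝒜 u j)) 1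
  have h2 := parOp_of_mem 𝒜 (SetLike.coe_mem (DirectSum.decompose 𝒜 u (j + 1))) 1
  have e : (DirectSum.decompose 𝒜 u j : A) + DirectSum.decompose 𝒜 u (j + 1) = u := by
    have h0 := sum_proj 𝒜 u
    have h3 : ∀ F : ZMod 2 → A, ∑ i, F i = F j + F (j + 1) := by
      intro F
      have : ∀ x : ZMod 2, x = 0 ∨ x = 1 := by decide
      rcases this j with rfl | rfl
      · exact Fin.sum_univ_two F
      · exact (Fin.sum_univ_two F).trans (add_comm _ _)
    rw [h3] at h0
    exact h0
  have e1 : parOp 𝒜 1 u = sgn j • ((DirectSum.decompose 𝒜 u j : A) - DirectSum.decompose 𝒜 u (j + 1)) := by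
    conv_lhs => rw [← e]
    rw [map_add, h1, h2, one_mul, one_mul, sgn_add, sgn_one, mul_neg, mul_one, neg_smul, smul_sub,
      sub_eq_add_neg]
  have hs : sgn j * sgn j = 1 := by rw [← sgn_add, add_self_two, sgn_zero]
  have e2 : (DirectSum.decompose 𝒜 u j : A) - DirectSum.decompose 𝒜 u (j + 1) = u := by
    have := congrArg (fun v => sgn j • v) (e1.symm.trans hu)
    simpa only [smul_smul, hs, one_smul] using this
  have e3 : (DirectSum.decompose 𝒜 u (j + 1) : A) = 0 := by
    have h4 : (2 : K) • (DirectSum.decompose 𝒜 u (j + 1) : A) = 0 := by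
      rw [two_smul]
      have := e.trans e2.symm
      rw [sub_eq_add_neg, add_right_inj, eq_neg_iff_add_eq_zero] at this
      exact this
    exact (smul_eq_zero.mp h4).resolve_left two_ne_zero
  rw [← e, e3, add_zero]
  exact SetLike.coe_mem _

theorem parOp_parOp (i j : ZMod 2) (u : A) : parOp 𝒜 i (parOp 𝒜 j u) = parOp 𝒜 (i + j) u := by
  induction u using DirectSum.Decomposition.inductionOn 𝒜 with
  | zero => simp
  | homogeneous u =>
    rw [parOp_of_mem 𝒜 u.2, map_smul, parOp_of_mem 𝒜 u.2, parOp_of_mem 𝒜 u.2, smul_smul, ← sgn_add,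
      add_mul, add_comm]
  | add u v hu hv => rw [map_add, map_add, map_add, hu, hv]

theorem parOp_zero (u : A) : parOp 𝒜 0 u = u := by
  simp only [parOp, zero_mul, sgn_zero, one_smul, LinearMap.sum_apply]
  exact sum_proj 𝒜 u

theorem parOp_mul (i : ZMod 2) (u v : A) : parOp 𝒜 i (u * v) = parOp 𝒜 i u * parOp 𝒜 i v := by
  induction u using DirectSum.Decomposition.inductionOn 𝒜 with
  | zero => simp
  | homogeneous u =>
    induction v using DirectSum.Decomposition.inductionOn 𝒜 with
    | zero => simp
    | homogeneous v =>
      rw [parOp_of_mem 𝒜 u.2, parOp_of_mem 𝒜 v.2, parOp_of_mem 𝒜 (SetLike.mul_mem_graded u.2 v.2),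
        smul_mul_smul_comm, ← sgn_add, mul_add]
    | add v w hv hw => rw [mul_add, map_add, map_add, mul_add, hv, hw]
  | add u w hu hw => rw [add_mul, map_add, map_add, add_mul, hu, hw]

theorem parOp_one (i : ZMod 2) : parOp 𝒜 i 1 = 1 := by
  rw [parOp_of_mem 𝒜 SetLike.GradedOne.one_mem, mul_zero, sgn_zero, one_smul]

theorem ext_homogeneous {M : Type*} [AddCommGroup M] [Module K M] {f g : A →ₗ[K] M}
    (h : ∀ j, ∀ u ∈ 𝒜 j, f u = g u) : f = g := by
  refine LinearMap.ext fun u => ?_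
  induction u using DirectSum.Decomposition.inductionOn 𝒜 with
  | zero => simp
  | homogeneous u => exact h _ _ u.2
  | add u v hu hv => rw [map_add, map_add, hu, hv]

end Parity

/-! ### Induction over the quantum queer superalgebra -/

section UqInduction

variable {n : ℕ}

theorem uq_induction {p : Uq n → Prop} (hc : ∀ c : K, p (algebraMap K _ c))
    (hadd : ∀ u v, p u → p v → p (u + v)) (hmul : ∀ u v, p u → p v → p (u * v))
    (hL : ∀ c d, p (L n c d)) (u : Uq n) : p u := by
  obtain ⟨w, rfl⟩ := RingQuot.mkAlgHom_surjective K (URel n) u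
  induction w using FreeAlgebra.induction with
  | grade0 c => rw [AlgHom.commutes]; exact hc c
  | grade1 y =>
    obtain ⟨⟨c, d⟩, h⟩ := y
    have := hL c d
    rwa [L, Matrix.map_apply, Lfree, dif_pos h] at this
  | mul x y hx hy => rw [map_mul]; exact hmul _ _ hx hy
  | add x y hx hy => rw [map_add]; exact hadd _ _ hx hy

/-- Induction over the homogeneous elements of `U_q(𝔮_n)`. -/
theorem uq_homogeneous_induction {p : ZMod 2 → Uq n → Prop} (h1 : p 0 1) (hz : ∀ i, p i 0)
    (hsmul : ∀ i (c : K) u, p i u → p i (c • u))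
    (hadd : ∀ i u v, p i u → p i v → p i (u + v))
    (hmul : ∀ c d j u, p j u → p (par c + par d + j) (L n c d * u)) {i : ZMod 2} {u : Uq n}
    (hu : u ∈ UqGrading n i) : p i u := by
  obtain ⟨w, hw, rfl⟩ := hu
  induction hw using Submodule.span_induction with
  | mem w h =>
    obtain ⟨xs, rfl, rfl⟩ := h
    induction xs with
    | nil => simpa using h1
    | cons y xs ih =>
      obtain ⟨⟨c, d⟩, h⟩ := y
      have := hmul c d _ _ ih
      rw [L, Matrix.map_apply, Lfree, dif_pos h] at this
      simpa [LPar] using this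
  | zero => rw [map_zero]; exact hz i
  | add u v _ _ hu hv => rw [map_add]; exact hadd _ _ _ hu hv
  | smul c u _ hu => rw [map_smul]; exact hsmul _ _ _ hu

end UqInduction

/-! ### From unsigned operators to an action of the quantum queer superalgebra -/

section Action

variable {n : ℕ} {A : Type*} [Ring A] [Algebra K A] (𝒜 : ZMod 2 → Submodule K A) [GradedAlgebra 𝒜]

/-- Operators `D_{cd}` from which an action of `U_q(𝔮_n)` on `A` is obtained by a change of
signs. -/
structure IsActionData (D : Idx n → Idx n → A →ₗ[K] A) : Prop where
  one : ∀ c d, D c d 1 = if c = d then 1 else 0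
  mul : ∀ c d u v, D c d (u * v) = ∑ k, D c k u * D k d v
  mem : ∀ c d j, ∀ u ∈ 𝒜 j, D c d u ∈ 𝒜 (par c + par d + j)
  zero : ∀ c d, ¬ c ≤ d → D c d = 0
  inv : ∀ c u, D c c (D (-c) (-c) u) = parOp 𝒜 1 u
  rtt : ∀ u c c' b b', wop 0 (fun b b' => D b c (D b' c' u)) b b' =
    ∑ k, ∑ e, wcoeff 0 k e c c' • D b k (D b' e u)

/-- The action of the generator `L_{cd}`. -/
def Lop (D : Idx n → Idx n → A →ₗ[K] A) : Matrix (Idx n) (Idx n) (Module.End K A) := fun c d =>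
  sgn (par c * par d + par d) • (D c d ∘ₗ parOp 𝒜 (par d + 1))

variable {𝒜} {D : Idx n → Idx n → A →ₗ[K] A}

theorem Lop_of_mem {u : A} {j : ZMod 2} (hu : u ∈ 𝒜 j) (c d : Idx n) :
    Lop 𝒜 D c d u = sgn (par c * par d + par d + (par d + 1) * j) • D c d u := by
  rw [Lop, LinearMap.smul_apply, LinearMap.comp_apply, parOp_of_mem 𝒜 hu, map_smul, smul_smul,
    ← sgn_add]

theorem Lop_mem (hD : IsActionData 𝒜 D) {u : A} {j : ZMod 2} (hu : u ∈ 𝒜 j) (c d : Idx n) :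
    Lop 𝒜 D c d u ∈ 𝒜 (par c + par d + j) := by
  rw [Lop_of_mem hu]
  exact Submodule.smul_mem _ _ (hD.mem c d j u hu)

theorem Lop_Lop_of_mem (hD : IsActionData 𝒜 D) {u : A} {j : ZMod 2} (hu : u ∈ 𝒜 j) (a b c d : Idx n) :
    Lop 𝒜 D a b (Lop 𝒜 D c d u) = sgn (par a * par b + par b + par c * par d + par d +
      (par d + 1) * j + (par b + 1) * (par c + par d + j)) • D a b (D c d u) := by
  rw [Lop_of_mem hu, map_smul, Lop_of_mem (hD.mem c d j u hu), smul_smul, ← sgn_add]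
  congr 2
  ring

theorem mulL_leg1_leg2 {R : Type*} [Ring R] [Algebra K R] (M : Matrix (Idx n) (Idx n) R)
    (x y : Idx n × Idx n) : mulL (leg1 n M) (leg2 n M) x y =
      sgn ((par x.2 + par y.2) * (par x.1 + par y.1)) • (M x.1 y.1 * M x.2 y.2) := by
  rw [mulL, Finset.sum_eq_single (y.1, x.2)]
  · simp only [leg1, leg2, if_true]
    congr 2
    generalize par x.1 = x1, par x.2 = x2, par y.1 = y1, par y.2 = y2
    revert x1 x2 y1 y2; decide
  · rintro ⟨w1, w2⟩ - hw
    by_cases h1 : x.2 = w2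
    · have h2 : ¬ w1 = y.1 := fun h2 => hw (by rw [h1, h2])
      simp [leg1, leg2, h2]
    · simp [leg1, h1]
  · simp

theorem mulL_leg2_leg1 {R : Type*} [Ring R] [Algebra K R] (M : Matrix (Idx n) (Idx n) R)
    (x y : Idx n × Idx n) : mulL (leg2 n M) (leg1 n M) x y = M x.2 y.2 * M x.1 y.1 := by
  rw [mulL, Finset.sum_eq_single (x.1, y.2)]
  · simp only [leg1, leg2, if_true]
    have e : ∀ x1 x2 y1 y2 : ZMod 2, (x1 + y1 + y2 + y2) * (x1 + x1 + x2 + y2) +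
      (x1 + y1) * (x2 + y2) = 0 := by decide
    rw [e, sgn_zero, one_smul]
  · rintro ⟨w1, w2⟩ - hw
    by_cases h1 : x.1 = w1
    · have h2 : ¬ w2 = y.2 := fun h2 => hw (by rw [h1, h2])
      simp [leg1, leg2, h2]
    · simp [leg2, h1]
  · simp

theorem wcoeff_zero_eq (b a k c : Idx n) : wcoeff 0 b a k c =
    S n (b, a) (c, k) * sgn ((par b + 1) * (par a + 1) + par b * (par c + 1)) := by
  rw [wcoeff, wop_zero_eq_sum_S, Finset.sum_eq_single (c, k)]
  · simp only [and_self, if_true, smul_eq_mul, mul_one, sgn_add]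
    ring
  · rintro ⟨y1, y2⟩ - hy
    have : ¬ (y2 = k ∧ y1 = c) := fun h => hy (by rw [h.1, h.2])
    simp [this]
  · simp

/-- On an element of parity j both sides equal the relation `IsActionData.rtt` up to one common
sign, which depends on j. All sign comparisons are restricted to the support of S. -/
theorem Lop_rtt (hD : IsActionData 𝒜 D) :
    mulL (mulL (leg1 n (Lop 𝒜 D)) (leg2 n (Lop 𝒜 D))) (scal _ (S n)) =
      mulL (mulL (scal _ (S n)) (leg2 n (Lop 𝒜 D))) (leg1 n (Lop 𝒜 D)) := by
  rw [mulL_assoc (scal _ (S n))]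
  refine funext fun x => funext fun z => ?_
  refine ext_homogeneous 𝒜 fun j u hu => ?_
  -- The column indices enter in reversed order because w contains the flip.
  have hR := hD.rtt u z.2 z.1 x.1 x.2
  rw [wop_zero_eq_sum_S] at hR
  have hl : mulL (mulL (leg1 n (Lop 𝒜 D)) (leg2 n (Lop 𝒜 D))) (scal _ (S n)) x z u =
      sgn (par x.2 * par z.2 + par z.2 + par x.1 * par z.1 + par z.1 + (par z.1 + 1) * j +
        (par z.2 + 1) * (par x.1 + par z.1 + j) + (par x.1 + 1) * (par x.2 + 1)) •
      ∑ k, ∑ e, wcoeff 0 k e z.2 z.1 • D x.1 k (D x.2 e u) := by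
    rw [mulL, LinearMap.sum_apply, Fintype.sum_prod_type, Finset.smul_sum]
    refine Finset.sum_congr rfl fun k _ => ?_
    rw [Finset.smul_sum]
    refine Finset.sum_congr rfl fun e _ => ?_
    rw [mulL_leg1_leg2, wcoeff_zero_eq, scal, Matrix.map_apply, ← Algebra.commutes,
      ← Algebra.smul_def, LinearMap.smul_apply, LinearMap.smul_apply, LinearMap.smul_apply,
      Module.End.mul_apply, Lop_Lop_of_mem hD hu, smul_comm _ (S n (k, e) z), mul_smul,
      smul_comm _ (S n (k, e) (z.1, z.2))]
    refine S_smul_congr fun h => ?_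
    simp only [smul_smul, ← sgn_add]
    congr 2
    simp only at h ⊢
    clear hR hu
    generalize par x.1 = x1, par x.2 = x2, par k = y1, par e = y2, par z.1 = z1, par z.2 = z2 at *
    revert x1 x2 y1 y2 z1 z2 j; decide +kernel
  have hr : mulL (scal _ (S n)) (mulL (leg2 n (Lop 𝒜 D)) (leg1 n (Lop 𝒜 D))) x z u =
      sgn (par x.2 * par z.2 + par z.2 + par x.1 * par z.1 + par z.1 + (par z.1 + 1) * j +
        (par z.2 + 1) * (par x.1 + par z.1 + j) + (par x.1 + 1) * (par x.2 + 1)) •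
      sgn ((par x.1 + 1) * (par x.2 + 1)) • ∑ y, S n (x.1, x.2) y • sgn (par x.1 * (par y.1 + 1)) •
        D y.2 z.2 (D y.1 z.1 u) := by
    rw [mulL, LinearMap.sum_apply, Finset.smul_sum, Finset.smul_sum]
    refine Finset.sum_congr rfl fun y _ => ?_
    rw [mulL_leg2_leg1, scal, Matrix.map_apply, ← Algebra.smul_def, LinearMap.smul_apply,
      LinearMap.smul_apply, Module.End.mul_apply, Lop_Lop_of_mem hD hu, smul_comm _ (S n x y),
      smul_comm (sgn ((par x.1 + 1) * (par x.2 + 1))) (S n (x.1, x.2) y),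
      smul_comm _ (S n (x.1, x.2) y)]
    refine S_smul_congr fun h => ?_
    simp only [smul_smul, ← sgn_add]
    congr 2
    clear hR hu hl
    generalize par x.1 = x1, par x.2 = x2, par y.1 = y1, par y.2 = y2, par z.1 = z1, par z.2 = z2 at *
    revert x1 x2 y1 y2 z1 z2 j; decide +kernel
  rw [hl, hr, ← hR]

/-- The two parity twists have exponents |c| + 1 and |c|, so together they cancel the parity
operator produced by `IsActionData.inv`. -/
theorem Lop_inv (hD : IsActionData 𝒜 D) (c : Idx n) : Lop 𝒜 D c c * Lop 𝒜 D (-c) (-c) = 1 := by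
  refine ext_homogeneous 𝒜 fun j u hu => ?_
  rw [Module.End.mul_apply, Lop_Lop_of_mem hD hu, hD.inv, parOp_of_mem 𝒜 hu, smul_smul, ← sgn_add,
    par_neg, Module.End.one_apply]
  have e : ∀ c j : ZMod 2, c * c + c + (c + 1) * (c + 1) + (c + 1) + (c + 1 + 1) * j +
    (c + 1) * (c + 1 + (c + 1) + j) + 1 * j = 0 := by decide
  rw [e, sgn_zero, one_smul]

/-- The action of `U_q(𝔮_n)` on `A`. -/
def uqAct (hD : IsActionData 𝒜 D) : Uq n →ₐ[K] Module.End K A :=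
  UqLift (Lop 𝒜 D) (fun c d h => by rw [Lop, hD.zero c d h, LinearMap.zero_comp, smul_zero])
    (Lop_inv hD) (Lop_rtt hD)

theorem uqAct_L (hD : IsActionData 𝒜 D) (c d : Idx n) : uqAct hD (L n c d) = Lop 𝒜 D c d :=
  UqLift_L _ _ _ _ c d

theorem uqAct_mem (hD : IsActionData 𝒜 D) (i j : ZMod 2) (u : Uq n) (hu : u ∈ UqGrading n i) (x : A)
    (hx : x ∈ 𝒜 j) : uqAct hD u x ∈ 𝒜 (i + j) := by
  refine uq_homogeneous_induction (p := fun i u => uqAct hD u x ∈ 𝒜 (i + j)) ?_ ?_ ?_ ?_ ?_ hu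
  · simpa using hx
  · intro i
    rw [map_zero]
    exact Submodule.zero_mem _
  · intro i c u h
    rw [map_smul]
    exact Submodule.smul_mem _ _ h
  · intro i u v h h'
    rw [map_add]
    exact Submodule.add_mem _ h h'
  · intro c d i u h
    rw [map_mul, uqAct_L, add_assoc]
    exact Lop_mem hD h c d

/-- Both sides are multiplicative in u, so it is enough to compare them on the generators. -/
theorem uqAct_one (hD : IsActionData 𝒜 D) (u : Uq n) : uqAct hD u 1 = counit n u • (1 : A) := by
  induction u using uq_induction with
  | hc c => simp
  | hadd u v hu hv => rw [map_add, map_add, LinearMap.add_apply, hu, hv, add_smul]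
  | hmul u v hu hv => rw [map_mul, map_mul, Module.End.mul_apply, hv, map_smul, hu, smul_smul, mul_comm]
  | hL c d =>
    rw [uqAct_L, counit, UqLift_L, Lop_of_mem SetLike.GradedOne.one_mem, hD.one, Matrix.one_apply]
    split_ifs with h
    · subst h
      have e : ∀ c : ZMod 2, c * c + c + (c + 1) * 0 = 0 := by decide
      rw [e, sgn_zero]
    · rw [smul_zero, zero_smul]

end Action

/-! ### Tensor products of representations -/

section TensorRep

variable {n : ℕ} {A B : Type} [Ring A] [Algebra K A] [AddCommGroup B] [Module K B]

theorem tensor_ext_homogeneous (𝒜 : ZMod 2 → Submodule K A) [GradedAlgebra 𝒜] {M : Type*}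
    [AddCommGroup M] [Module K M] {f g : A ⊗[K] B →ₗ[K] M}
    (h : ∀ j, ∀ x ∈ 𝒜 j, ∀ y, f (x ⊗ₜ[K] y) = g (x ⊗ₜ[K] y)) : f = g := by
  refine TensorProduct.ext ?_
  refine ext_homogeneous 𝒜 fun j x hx => LinearMap.ext fun y => ?_
  exact h j x hx y

/-- The operator `x ⊗ y ↦ f(x) ⊗ y`. -/
def leftRep (B : Type) [AddCommGroup B] [Module K B] (ρ : Uq n →ₐ[K] Module.End K A) :
    Uq n →ₐ[K] Module.End K (A ⊗[K] B) :=
  AlgHom.ofLinearMap (LinearMap.rTensorHom B ∘ₗ ρ.toLinearMap)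
    (by
      refine TensorProduct.ext' fun x y => ?_
      simp)
    (by
      intro u v
      refine TensorProduct.ext' fun x y => ?_
      simp)

theorem leftRep_tmul (ρ : Uq n →ₐ[K] Module.End K A) (u : Uq n) (x : A) (y : B) :
    leftRep B ρ u (x ⊗ₜ[K] y) = ρ u x ⊗ₜ[K] y := rfl

variable (𝒜 : ZMod 2 → Submodule K A) [GradedAlgebra 𝒜]

/-- The linear map underlying `rightRep`. -/
def rightRepLin (ρ' : Uq n →ₐ[K] Module.End K B) : Uq n →ₗ[K] Module.End K (A ⊗[K] B) :=
  ∑ i : ZMod 2, (TensorProduct.mapBilinear (RingHom.id K) A B A B (parOp 𝒜 i)) ∘ₗ ρ'.toLinearMap ∘ₗ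
    GradedAlgebra.proj (UqGrading n) i

theorem rightRepLin_apply (ρ' : Uq n →ₐ[K] Module.End K B) {i : ZMod 2} {u : Uq n}
    (hu : u ∈ UqGrading n i) (x : A) (y : B) :
    rightRepLin 𝒜 ρ' u (x ⊗ₜ[K] y) = parOp 𝒜 i x ⊗ₜ[K] ρ' u y := by
  simp only [rightRepLin, LinearMap.sum_apply, LinearMap.comp_apply, proj_of_mem _ hu,
    AlgHom.toLinearMap_apply, TensorProduct.mapBilinear_apply, TensorProduct.map_tmul]
  rw [Finset.sum_eq_single i (by intro k _ hk; simp [hk]) (by simp), if_pos rfl]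

/-- The operator `x ⊗ y ↦ (-1)^{|u||x|} x ⊗ u.y`. -/
def rightRep (ρ' : Uq n →ₐ[K] Module.End K B) : Uq n →ₐ[K] Module.End K (A ⊗[K] B) :=
  AlgHom.ofLinearMap (rightRepLin 𝒜 ρ')
    (by
      refine TensorProduct.ext' fun x y => ?_
      rw [rightRepLin_apply 𝒜 ρ' SetLike.GradedOne.one_mem, parOp_zero, map_one]
      rfl)
    (by
      intro u v
      induction u using DirectSum.Decomposition.inductionOn (UqGrading n) with
      | zero => simp
      | add u w hu hw => rw [add_mul, map_add, map_add, add_mul, hu, hw]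
      | homogeneous u =>
        induction v using DirectSum.Decomposition.inductionOn (UqGrading n) with
        | zero => simp
        | add u w hu hw => rw [mul_add, map_add, map_add, mul_add, hu, hw]
        | homogeneous v =>
          refine TensorProduct.ext' fun x y => ?_
          rw [Module.End.mul_apply, rightRepLin_apply 𝒜 ρ' v.2, rightRepLin_apply 𝒜 ρ' u.2,
            rightRepLin_apply 𝒜 ρ' (SetLike.mul_mem_graded u.2 v.2), parOp_parOp, map_mul]
          rfl)

theorem rightRep_tmul (ρ' : Uq n →ₐ[K] Module.End K B) {i : ZMod 2} {u : Uq n}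
    (hu : u ∈ UqGrading n i) (x : A) (y : B) :
    rightRep 𝒜 ρ' u (x ⊗ₜ[K] y) = parOp 𝒜 i x ⊗ₜ[K] ρ' u y :=
  rightRepLin_apply 𝒜 ρ' hu x y

/-- The action is compatible with the parity. -/
def ActMem (ρ : Uq n →ₐ[K] Module.End K A) : Prop :=
  ∀ i j, ∀ u ∈ UqGrading n i, ∀ x ∈ 𝒜 j, ρ u x ∈ 𝒜 (i + j)

variable {𝒜}

/-- This supercommutation is what allows the two actions to be combined into a homomorphism from the
graded tensor product. It relies on the left action respecting parity. -/
theorem leftRep_mul_rightRep {ρ : Uq n →ₐ[K] Module.End K A} (hρ : ActMem 𝒜 ρ)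
    (ρ' : Uq n →ₐ[K] Module.End K B) ⦃i j : ZMod 2⦄ (u : UqGrading n i) (v : UqGrading n j) :
    leftRep B ρ u * rightRep 𝒜 ρ' v = (-1 : ℤˣ) ^ (j * i) • (rightRep 𝒜 ρ' v * leftRep B ρ u) := by
  refine Eq.trans ?_ (uzpow_smul_eq (j * i) (rightRep 𝒜 ρ' v * leftRep B ρ u)).symm
  refine tensor_ext_homogeneous 𝒜 fun k x hx y => ?_
  rw [LinearMap.smul_apply, Module.End.mul_apply, Module.End.mul_apply, leftRep_tmul,
    rightRep_tmul 𝒜 ρ' v.2, rightRep_tmul 𝒜 ρ' v.2, leftRep_tmul, parOp_of_mem 𝒜 hx,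
    parOp_of_mem 𝒜 (hρ i k u u.2 x hx), map_smul, ← TensorProduct.smul_tmul',
    ← TensorProduct.smul_tmul', smul_smul, ← sgn_add, mul_add, ← add_assoc, add_self_two, zero_add]

/-- The action of `U_q(𝔮_n)` on a tensor product as a homomorphism of algebras. -/
def tensorRep {ρ : Uq n →ₐ[K] Module.End K A} (hρ : ActMem 𝒜 ρ) (ρ' : Uq n →ₐ[K] Module.End K B) :
    Uq n →ₐ[K] Module.End K (A ⊗[K] B) :=
  (GradedTensorProduct.lift (C := Module.End K (A ⊗[K] B)) (UqGrading n) (UqGrading n)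
    (leftRep B ρ) (rightRep 𝒜 ρ')
    (leftRep_mul_rightRep hρ ρ')).comp (comul n)

theorem twist_apply_of_mem {i : ZMod 2} {u : Uq n} (hu : u ∈ UqGrading n i) (j : ZMod 2) :
    twist n j u = sgn (i * j) • u := by
  simp only [twist, LinearMap.sum_apply, LinearMap.smul_apply, proj_of_mem _ hu]
  rw [Finset.sum_eq_single i (by intro k _ hk; simp [hk]) (by simp), if_pos rfl]

theorem rightRep_tmul_of_mem (ρ' : Uq n →ₐ[K] Module.End K B) (u : Uq n) {j : ZMod 2} {x : A}
    (hx : x ∈ 𝒜 j) (y : B) : rightRep 𝒜 ρ' u (x ⊗ₜ[K] y) = x ⊗ₜ[K] ρ' (twist n j u) y := by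
  induction u using DirectSum.Decomposition.inductionOn (UqGrading n) with
  | zero => simp
  | add u w hu hw =>
    rw [map_add, map_add, map_add, LinearMap.add_apply, LinearMap.add_apply, hu, hw,
      TensorProduct.tmul_add]
  | homogeneous u =>
    rw [rightRep_tmul 𝒜 ρ' u.2, parOp_of_mem 𝒜 hx, twist_apply_of_mem u.2, map_smul,
      LinearMap.smul_apply, TensorProduct.tmul_smul, TensorProduct.smul_tmul']

/-- The action through the comultiplication is an algebra homomorphism by construction; this
identifies it with the explicit Sweedler formula, which `tensorAct_tmul` gives for the action of the
statement. -/
theorem tensorRep_tmul {ρ : Uq n →ₐ[K] Module.End K A} (hρ : ActMem 𝒜 ρ)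
    (ρ' : Uq n →ₐ[K] Module.End K B) (u : Uq n) {j : ZMod 2} {x : A} (hx : x ∈ 𝒜 j) (y : B) :
    tensorRep hρ ρ' u (x ⊗ₜ[K] y) = TensorProduct.lift ((TensorProduct.mk K A B).compl₁₂
      (ρ.toLinearMap.flip x) (ρ'.toLinearMap.flip y)) (DeltaTwist n j u) := by
  rw [tensorRep, AlgHom.comp_apply, DeltaTwist, LinearMap.comp_apply, Delta, LinearMap.comp_apply]
  change (GradedTensorProduct.lift (C := Module.End K (A ⊗[K] B)) (UqGrading n) (UqGrading n) _ _
    (leftRep_mul_rightRep hρ ρ') (comul n u)) _ = TensorProduct.lift _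
    (LinearMap.lTensor _ _ ((GradedTensorProduct.of K (UqGrading n) (UqGrading n)).symm (comul n u)))
  generalize comul n u = w
  obtain ⟨w, rfl⟩ := (GradedTensorProduct.of K (UqGrading n) (UqGrading n)).surjective w
  rw [LinearEquiv.symm_apply_apply]
  induction w using TensorProduct.induction_on with
  | zero => simp
  | add w w' hw hw' =>
    rw [map_add, map_add, LinearMap.add_apply, hw, hw', map_add, map_add]
  | tmul u v =>
    rw [LinearMap.lTensor_tmul, TensorProduct.lift.tmul]
    exact congrArg (leftRep B ρ u) (rightRep_tmul_of_mem ρ' v hx y)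

theorem tensorAct_tmul {ρ : Uq n →ₗ[K] Module.End K A}
    (ρ' : Uq n →ₗ[K] Module.End K B) (u : Uq n) {j : ZMod 2} {x : A} (hx : x ∈ 𝒜 j) (y : B) :
    tensorAct n 𝒜 ρ ρ' u (x ⊗ₜ[K] y) = TensorProduct.lift ((TensorProduct.mk K A B).compl₁₂
      (ρ.flip x) (ρ'.flip y)) (DeltaTwist n j u) := by
  have key (k : ZMod 2) (w : Uq n ⊗[K] Uq n) :
      TensorProduct.lift ((TensorProduct.mapBilinear (RingHom.id K) A B A B).compl₁₂
        (LinearMap.lcomp K A (GradedAlgebra.proj 𝒜 k) ∘ₗ ρ) ρ') w (x ⊗ₜ[K] y) =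
      if k = j then TensorProduct.lift ((TensorProduct.mk K A B).compl₁₂
        (ρ.flip x) (ρ'.flip y)) w else 0 := by
    induction w using TensorProduct.induction_on with
    | zero => simp
    | add w w' hw hw' =>
      rw [map_add, map_add, LinearMap.add_apply, hw, hw']
      split_ifs <;> simp
    | tmul u v =>
      rw [TensorProduct.lift.tmul, TensorProduct.lift.tmul]
      change ρ u (GradedAlgebra.proj 𝒜 k x) ⊗ₜ[K] ρ' v y = if k = j then ρ u x ⊗ₜ[K] ρ' v y else 0
      rw [proj_of_mem 𝒜 hx]
      split_ifs
      · rfl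
      · rw [map_zero, TensorProduct.zero_tmul]
  simp only [tensorAct, LinearMap.sum_apply, LinearMap.comp_apply, key]
  rw [Finset.sum_eq_single j (by intro k _ hk; simp [hk]) (by simp), if_pos rfl]

theorem DeltaTwist_L (j : ZMod 2) (c d : Idx n) : DeltaTwist n j (L n c d) =
    ∑ k, sgn ((par c + par k) * (par k + par d) + (par k + par d) * j) •
      (L n c k ⊗ₜ[K] L n k d) := by
  have h : Delta n (L n c d) = ∑ k, sgn ((par c + par k) * (par k + par d)) •
      (L n c k ⊗ₜ[K] L n k d) := by
    rw [Delta, LinearMap.comp_apply, AlgHom.toLinearMap_apply, comul, UqLift_L, LL, map_sum]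
    rfl
  rw [DeltaTwist, LinearMap.comp_apply, h, map_sum]
  refine Finset.sum_congr rfl fun k _ => ?_
  rw [map_smul, LinearMap.lTensor_tmul, twist_apply_of_mem (L_mem n k d), TensorProduct.tmul_smul,
    smul_smul, ← sgn_add]

end TensorRep

/-! ### The supermodule superalgebra axioms -/

section ActionMul

variable {n : ℕ} {A : Type} [Ring A] [Algebra K A] {𝒜 : ZMod 2 → Submodule K A} [GradedAlgebra 𝒜]
  {D : Idx n → Idx n → A →ₗ[K] A}

theorem lift_comp_apply {A B C : Type*} [AddCommGroup A] [Module K A] [AddCommGroup B] [Module K B]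
    [AddCommGroup C] [Module K C] (μ : A →ₗ[K] B →ₗ[K] C) (f : Uq n →ₗ[K] A) (g : Uq n →ₗ[K] B)
    (w : Uq n ⊗[K] Uq n) : TensorProduct.lift (μ.compl₁₂ f g) w =
      TensorProduct.lift μ (TensorProduct.lift ((TensorProduct.mk K A B).compl₁₂ f g) w) := by
  induction w using TensorProduct.induction_on with
  | zero => simp
  | add w w' hw hw' => rw [map_add, hw, hw', ← map_add, ← map_add]
  | tmul u v => rfl

/-- Both actions are algebra homomorphisms in u, so equivariance of the multiplication needs
checking only on L_{cd}. There it is the matrix multiplicativity of D, with the signs of `Lop`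
accounting for those of the comultiplication. -/
theorem uqAct_mul (hD : IsActionData 𝒜 D) (u : Uq n) (w : A ⊗[K] A) :
    uqAct hD u (LinearMap.mul' K A w) =
      LinearMap.mul' K A (tensorRep (uqAct_mem hD) (uqAct hD) u w) := by
  induction u using uq_induction generalizing w with
  | hc c =>
    rw [AlgHom.commutes, AlgHom.commutes, Module.algebraMap_end_apply, Module.algebraMap_end_apply,
      map_smul]
  | hadd u v hu hv => simp only [map_add, LinearMap.add_apply, hu, hv]
  | hmul u v hu hv => rw [map_mul, map_mul, Module.End.mul_apply, Module.End.mul_apply, hv, hu]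
  | hL c d =>
    refine LinearMap.congr_fun (f := uqAct hD (L n c d) ∘ₗ LinearMap.mul' K A)
      (g := LinearMap.mul' K A ∘ₗ tensorRep (uqAct_mem hD) (uqAct hD) (L n c d)) ?_ w
    refine tensor_ext_homogeneous 𝒜 fun j x hx y => ?_
    induction y using DirectSum.Decomposition.inductionOn 𝒜 with
    | zero => simp
    | add y z hy hz => simp only [TensorProduct.tmul_add, map_add, hy, hz]
    | @homogeneous i y =>
      rw [LinearMap.comp_apply, LinearMap.comp_apply, tensorRep_tmul (uqAct_mem hD) _ _ hx,
        DeltaTwist_L, map_sum, map_sum, LinearMap.mul'_apply, uqAct_L,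
        Lop_of_mem (SetLike.mul_mem_graded hx y.2), hD.mul, Finset.smul_sum]
      refine Finset.sum_congr rfl fun k _ => ?_
      rw [map_smul, map_smul]
      change _ = _ • (uqAct hD (L n c k) x * uqAct hD (L n k d) y)
      rw [uqAct_L, uqAct_L, Lop_of_mem hx, Lop_of_mem y.2, smul_mul_smul_comm, smul_smul, ← sgn_add,
        ← sgn_add]
      congr 2
      generalize par c = c1, par d = d1, par k = k1
      clear hx y
      revert c1 d1 k1 i j; decide +kernel

theorem uqAct_isSupermoduleSuperalgebra (hD : IsActionData 𝒜 D) :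
    IsSupermoduleSuperalgebra n 𝒜 1 (LinearMap.mul K A) (uqAct hD).toLinearMap where
  internal := DirectSum.Decomposition.isInternal 𝒜
  one_act := map_one (uqAct hD)
  mul_act := map_mul (uqAct hD)
  act_mem := uqAct_mem hD
  one_mul := one_mul
  mul_one := mul_one
  mul_assoc := mul_assoc
  one_mem := SetLike.GradedOne.one_mem
  mul_mem i j x hx y hy := SetLike.mul_mem_graded hx hy
  act_mul u j a ha b := by
    refine (uqAct_mul hD u (a ⊗ₜ[K] b)).trans ?_
    rw [tensorRep_tmul (uqAct_mem hD) _ _ ha]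
    exact (lift_comp_apply _ _ _ _).symm
  act_one := uqAct_one hD

end ActionMul

/-! ### The transfer operators for S⁻¹ as action data -/

section ActionTransfer


theorem sum_Sinv {n : ℕ} {A : Type*} [AddCommGroup A] [Module K A] (g : Idx n → A) (b c d : Idx n) : ∑ b', Sinv n (b, c) (b', d) • g b' =
    (if c = d then q ^ (-phi b c) • g b else 0) - (if c < d then (xi * sgn (par c)) •
      ((if b = d then g c else 0) + (if b = -d then g (-c) else 0)) else 0) := by
  have e (b' : Idx n) : Sinv n (b, c) (b', d) • g b' =
      (if b = b' then (if c = d then q ^ (-phi b c) • g b' else 0) else 0) -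
      ((if c = b' then (if c < d then (xi * sgn (par c)) • (if b = d then g b' else 0) else 0) else 0) +
       (if -c = b' then (if c < d then (xi * sgn (par c)) • (if b = -d then g b' else 0) else 0)
        else 0)) := by
    simp only [Sinv, eq_comm (a := b'), sub_smul]
    congr 1
    · by_cases h1 : b = b' <;> by_cases h2 : c = d <;> simp [h1, h2]
    · by_cases h1 : c < d
      · simp only [if_pos h1, mul_add, add_smul]
        congr 1
        · by_cases h2 : b = d <;> by_cases h3 : c = b' <;> simp [h2, h3]
        · by_cases h2 : b = -d <;> by_cases h3 : -c = b' <;> simp [h2, h3]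
      · simp [h1]
  simp only [e, Finset.sum_sub_distrib, Finset.sum_add_distrib, Finset.sum_ite_eq, Finset.mem_univ,
    if_true]
  congr 1
  split_ifs <;> simp

/-- On the diagonal the shift by ξ replaces q by q⁻¹: the scalar form of w + ξ = w⁻¹. -/
theorem sgn_mul_q_pow_add {n : ℕ} (c : Idx n) : sgn (par c + 1) * q ^ phi c c + xi =
    sgn (par c + 1) * q ^ (-phi c c) := by
  have hc := idx_ne c
  have h1 : ¬ c = -c := fun h => hc (by have := congrArg Subtype.val h; rw [neg_val] at this; omega)
  have h2 : ∀ x : ZMod 2, x = 0 ∨ x = 1 := by decide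
  unfold phi xi
  rw [if_pos rfl, if_neg h1]
  rcases h2 (par c) with h | h <;> rw [h]
  · simp [sgn_one]
    ring
  · have : (1 : ZMod 2) + 1 = 0 := by decide
    simp [this, sgn_zero]

variable {s n : ℕ} {A : Type} [Ring A] [Algebra K A] {𝒜 : ZMod 2 → Submodule K A}
  {x : Idx s → Idx n → A} {D : Idx n → Idx n → A →ₗ[K] A}

variable (𝒜) in
/-- Operators on a superalgebra generated by elements `x_{αb}` that define the action of
`U_q(𝔮_n)`. -/
structure IsActionTransfer (x : Idx s → Idx n → A) (D : Idx n → Idx n → A →ₗ[K] A) : Prop where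
  generates : HalfGenerates x
  x_mem : ∀ α b, α.1 < 0 → x α b ∈ 𝒜 (par b + 1)
  one : ∀ b c, D b c 1 = if b = c then 1 else 0
  mul : ∀ b c u v, D b c (u * v) = ∑ k, D b k u * D k c v
  gen : ∀ α, α.1 < 0 → ∀ a b c, D b c (x α a) = wop xi (fun k c' => if c' = c then x α k else 0) b a
  rtt : ∀ u c c' b b', wop 0 (fun b b' => D b c (D b' c' u)) b b' =
    ∑ k, ∑ e, wcoeff 0 k e c c' • D b k (D b' e u)

namespace IsActionTransfer

theorem algebraMap_apply (hD : IsActionTransfer 𝒜 x D) (r : K) (b c : Idx n) :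
    D b c (algebraMap K A r) = if b = c then algebraMap K A r else 0 := by
  rw [Algebra.algebraMap_eq_smul_one, map_smul, hD.one]
  split_ifs <;> simp

theorem gen_mem (hD : IsActionTransfer 𝒜 x D) {α : Idx s} (hα : α.1 < 0) (a c d : Idx n) :
    D c d (x α a) ∈ 𝒜 (par c + par d + (par a + 1)) := by
  have h (k e : Idx n) (p : ZMod 2) (hp : e = d → p = par k + 1) :
      (if e = d then x α k else 0) ∈ 𝒜 p := by
    split_ifs with he
    · rw [hp he]
      exact hD.x_mem α k hα
    · exact Submodule.zero_mem _
  rw [hD.gen α hα, wop_apply]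
  refine Submodule.add_mem _ (Submodule.sub_mem _ (Submodule.sub_mem _ ?_ ?_) ?_) ?_ <;>
    refine Submodule.smul_mem _ _ (h _ _ _ ?_)
  · rintro rfl
    rw [add_self_two, zero_add]
  · rintro rfl
    rw [add_assoc, ← add_assoc (par a), add_self_two, zero_add]
  · rintro rfl
    rw [par_neg, par_neg]
    generalize par a = a1, par c = c1
    revert a1 c1; decide
  · rintro rfl
    rw [add_assoc, ← add_assoc (par a), add_self_two, zero_add]

/-- Triangularity passes to products. On generators with c > d the shift by ξ cancels the only
surviving term of w, which explains why η = ξ rather than η = 0 is used for the action. -/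
theorem apply_eq_zero (hD : IsActionTransfer 𝒜 x D) (c d : Idx n) (h : ¬ c ≤ d) : D c d = 0 := by
  refine LinearMap.ext fun u => ?_
  rw [LinearMap.zero_apply]
  induction u using hD.generates.induction generalizing c d with
  | hc r => rw [hD.algebraMap_apply, if_neg (fun e => h e.le)]
  | hadd u v hu hv => rw [map_add, hu c d h, hv c d h, add_zero]
  | hmul u v hu hv =>
    rw [hD.mul]
    refine Finset.sum_eq_zero fun k _ => ?_
    by_cases h1 : c ≤ k
    · rw [hv k d fun h2 => h (h1.trans h2), mul_zero]
    · rw [hu c k h1, zero_mul]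
  | ht α a hα =>
    have h' : d.1 < c.1 := not_le.mp h
    rw [hD.gen α hα, wop_apply, if_neg (fun e => h e.le), smul_zero, zero_sub, sub_eq_add_neg]
    have e1 : (if -a = d then x α (-c) else 0) = if a.1 = -d.1 then x α (-c) else 0 := by
      simp only [idx_eq_iff, neg_val, neg_eq_iff_eq_neg]
    rw [e1]
    by_cases h1 : a = d
    · subst h1
      have : ¬ a.1 = -a.1 := by have := idx_ne a; omega
      rw [if_pos h', if_pos rfl, if_neg this, smul_zero, neg_zero, add_zero, neg_add_cancel]
    · rw [if_neg h1, smul_zero, smul_zero, neg_zero, zero_add, add_zero]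
      split_ifs <;> first | omega | simp

/-- By triangularity only the diagonal intermediate index contributes. -/
theorem diag_mul (hD : IsActionTransfer 𝒜 x D) (c : Idx n) (u v : A) : D c c (u * v) = D c c u * D c c v := by
  rw [hD.mul, Finset.sum_eq_single c _ (by simp)]
  intro k _ hk
  by_cases h1 : c ≤ k
  · rw [hD.apply_eq_zero k c fun h2 => hk (le_antisymm h2 h1), LinearMap.zero_apply, mul_zero]
  · rw [hD.apply_eq_zero c k h1, LinearMap.zero_apply, zero_mul]

/-- The coefficients of w + ξ are those of S⁻¹ up to a sign. Below, the strictly triangular part and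
the diagonal are compared separately, distinguishing b = ±d in the former and b = ±c in the latter.
-/
theorem gen_eq_sum (hD : IsActionTransfer 𝒜 x D) {α : Idx s} (hα : α.1 < 0) (b c d : Idx n) : D c d (x α b) =
    sgn ((par c + 1) * (par b + 1 + par d)) • ∑ b', Sinv n (b, c) (b', d) • x α b' := by
  by_cases hcd : ¬ c ≤ d
  · rw [hD.apply_eq_zero c d hcd, LinearMap.zero_apply, sum_Sinv, if_neg (fun e => hcd e.le),
      if_neg (fun e => hcd e.le), sub_zero, smul_zero]
  rw [not_not] at hcd
  rw [sum_Sinv, hD.gen α hα, wop_apply]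
  have hb := idx_ne b
  rcases hcd.lt_or_eq with h | rfl
  · rw [if_neg h.ne, if_neg h.ne, if_pos h, smul_zero, zero_sub, zero_sub]
    have h' : c.1 < d.1 := h
    by_cases h1 : b = d
    · subst h1
      have h2 : ¬ -b = b := fun h => hb (by have := congrArg Subtype.val h; rw [neg_val] at this; omega)
      have h3 : ¬ b = -b := fun h => h2 h.symm
      have e : ∀ c b : ZMod 2, (c + 1) * (b + 1 + b) = c + 1 := by decide
      rw [if_neg (by omega), if_neg h2, if_pos rfl, if_neg h3, e]
      simp only [zero_smul, smul_zero, neg_zero, sub_zero, zero_add, add_zero, smul_smul,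
        ← neg_smul]
      congr 1
      have hs : sgn (par c) * sgn (par c) = 1 := by rw [← sgn_add, add_self_two, sgn_zero]
      rw [sgn_add, sgn_one]
      linear_combination (-xi) * hs
    · simp only [if_neg h1, smul_zero, neg_zero, zero_sub, add_zero, zero_add, idx_neg_eq_iff]
      by_cases h2 : b = -d
      · subst h2
        have e : ∀ c d : ZMod 2, (c + 1) * (d + 1 + 1 + d) = 0 := by decide
        rw [if_pos rfl, if_pos (by rw [neg_val]; omega), par_neg, e, sgn_zero, one_smul]
      · rw [if_neg h2, smul_zero, smul_zero, neg_zero, smul_zero]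
  · rw [if_pos rfl, if_pos rfl, if_neg (lt_irrefl _), sub_zero, smul_smul]
    have e : ∀ c b : ZMod 2, (c + 1) * (b + 1 + c) = (c + 1) * (b + 1) := by decide
    rw [e]
    by_cases h1 : b = c
    · subst h1
      have h2 : ¬ -b = b := fun h => hb (by have := congrArg Subtype.val h; rw [neg_val] at this; omega)
      have e2 : ∀ b : ZMod 2, (b + 1) * (b + 1) = b + 1 := by decide
      rw [if_pos rfl, if_neg h2, if_neg (lt_irrefl _), zero_smul, smul_zero, sub_zero, sub_zero,
        ← add_smul, e2, sgn_mul_q_pow_add]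
    · simp only [if_neg h1, smul_zero, add_zero, sub_zero, idx_neg_eq_iff]
      have e3 : phi c b = -phi b c ∨ ¬ b = -c := by
        by_cases h2 : b = -c
        · left
          subst h2
          rw [phi_neg_right, phi_neg_left]
        · exact Or.inr h2
      by_cases h2 : b = -c
      · rw [if_pos h2, e3.resolve_right (not_not.mpr h2), if_neg, zero_smul, sub_zero]
        rw [h2, neg_val]
        omega
      · have h3 : phi c b = 0 := by
          unfold phi
          rw [if_neg (Ne.symm h1), if_neg (fun h : c = -b => h2 (by rw [h, idx_neg_neg]))]
          simp
        have h4 : phi b c = 0 := by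
          unfold phi
          rw [if_neg h1, if_neg h2]
          simp
        rw [if_neg h2, smul_zero, sub_zero, h3, h4, neg_zero]

theorem diag_gen (hD : IsActionTransfer 𝒜 x D) {α : Idx s} (hα : α.1 < 0) (b c : Idx n) : D c c (x α b) =
    (sgn ((par c + 1) * (par b + 1)) * q ^ (-phi b c)) • x α b := by
  have e : ∀ c b : ZMod 2, (c + 1) * (b + 1 + c) = (c + 1) * (b + 1) := by decide
  rw [hD.gen_eq_sum hα, sum_Sinv, if_pos rfl, if_neg (lt_irrefl _), sub_zero, smul_smul, e]

variable [GradedAlgebra 𝒜]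

/-- Homogeneity of D is expressed through the parity operator, because this form passes to sums and
products of arbitrary elements and can thus be proved by induction from the generators. -/
theorem parOp_apply (hD : IsActionTransfer 𝒜 x D) (u : A) (c d : Idx n) :
    parOp 𝒜 1 (D c d u) = sgn (par c + par d) • D c d (parOp 𝒜 1 u) := by
  induction u using hD.generates.induction generalizing c d with
  | hc r =>
    rw [Algebra.algebraMap_eq_smul_one, map_smul, map_smul, map_smul, map_smul, parOp_one, hD.one]
    split_ifs with h
    · rw [h, add_self_two, sgn_zero, one_smul, parOp_one]
    · simp
  | hadd u v hu hv => simp only [map_add, hu, hv, smul_add]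
  | hmul u v hu hv =>
    rw [hD.mul, map_sum, parOp_mul, hD.mul, Finset.smul_sum]
    refine Finset.sum_congr rfl fun k _ => ?_
    rw [parOp_mul, hu, hv, smul_mul_smul_comm, ← sgn_add]
    congr 2
    generalize par c = a, par d = b, par k = c
    revert a b c; decide
  | ht α a hα =>
    rw [parOp_of_mem 𝒜 (hD.gen_mem hα a c d), parOp_of_mem 𝒜 (hD.x_mem α a hα), map_smul, smul_smul,
      ← sgn_add, one_mul, one_mul]

theorem apply_mem (hD : IsActionTransfer 𝒜 x D) (c d : Idx n) (j : ZMod 2) (u : A) (hu : u ∈ 𝒜 j) :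
    D c d u ∈ 𝒜 (par c + par d + j) := by
  refine mem_of_parOp 𝒜 ?_
  rw [hD.parOp_apply, parOp_of_mem 𝒜 hu, map_smul, smul_smul, ← sgn_add, one_mul]

/-- Diagonal operators are multiplicative, so generators suffice; there the powers of q cancel
because φ is odd under negation of its second index, and only the parity sign remains. -/
theorem diag_diag (hD : IsActionTransfer 𝒜 x D) (c : Idx n) (u : A) : D c c (D (-c) (-c) u) = parOp 𝒜 1 u := by
  induction u using hD.generates.induction with
  | hc r =>
    rw [hD.algebraMap_apply, if_pos rfl, hD.algebraMap_apply, if_pos rfl,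
      Algebra.algebraMap_eq_smul_one, map_smul, parOp_one]
  | hadd u v hu hv => simp only [map_add, hu, hv]
  | hmul u v hu hv => rw [hD.diag_mul, hD.diag_mul, hu, hv, parOp_mul]
  | ht α b hα =>
    have e : ∀ c b : ZMod 2, (c + 1 + 1) * (b + 1) + (c + 1) * (b + 1) = 1 * (b + 1) := by decide
    rw [hD.diag_gen hα, map_smul, hD.diag_gen hα, parOp_of_mem 𝒜 (hD.x_mem α b hα), smul_smul,
      phi_neg_right, neg_neg, mul_mul_mul_comm, ← sgn_add, ← zpow_add₀ q_ne_zero, add_neg_cancel,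
      zpow_zero, mul_one, par_neg, e]

theorem isActionData (hD : IsActionTransfer 𝒜 x D) : IsActionData 𝒜 D where
  one := hD.one
  mul := hD.mul
  mem := hD.apply_mem
  zero := hD.apply_eq_zero
  inv := hD.diag_diag
  rtt := hD.rtt

theorem uqAct_gen (hD : IsActionTransfer 𝒜 x D) {α : Idx s} (hα : α.1 < 0) (b c d : Idx n) :
    sgn ((par c + par d) * (par b + 1)) • uqAct hD.isActionData (L n c d) (x α b) =
      ∑ b', Sinv n (b, c) (b', d) • x α b' := by
  rw [uqAct_L, Lop_of_mem (hD.x_mem α b hα), hD.gen_eq_sum hα, smul_smul, smul_smul, ← sgn_add,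
    ← sgn_add]
  have e : ∀ b c d : ZMod 2, (c + d) * (b + 1) + (c * d + d + (d + 1) * (b + 1)) +
    (c + 1) * (b + 1 + d) = 0 := by decide
  rw [← add_assoc] at *
  rw [show (par c + par d) * (par b + 1) + (par c * par d + par d) + (par d + 1) * (par b + 1) +
    (par c + 1) * (par b + 1 + par d) = 0 by rw [← e (par b) (par c) (par d)]; ring, sgn_zero, one_smul]

end IsActionTransfer

end ActionTransfer

/-! ### Uniqueness of the action -/

section ActionUnique

variable {s n : ℕ} {A : Type} [Ring A] [Algebra K A] {𝒜 : ZMod 2 → Submodule K A} [GradedAlgebra 𝒜]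
  {x : Idx s → Idx n → A} {ρ ρ' : Uq n →ₗ[K] Module.End K A}

theorem act_L_mul (h : IsSupermoduleSuperalgebra n 𝒜 1 (LinearMap.mul K A) ρ) (c d : Idx n)
    (a b : A) : ρ (L n c d) (a * b) = ∑ k, sgn ((par c + par k) * (par k + par d)) •
      (ρ (L n c k) (parOp 𝒜 (par k + par d) a) * ρ (L n k d) b) := by
  induction a using DirectSum.Decomposition.inductionOn 𝒜 with
  | zero => simp
  | add a a' ha ha' => simp only [add_mul, map_add, ha, ha', smul_add, Finset.sum_add_distrib]
  | homogeneous a =>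
    refine (h.act_mul (L n c d) _ a a.2 b).trans ?_
    rw [DeltaTwist_L, map_sum]
    refine Finset.sum_congr rfl fun k _ => ?_
    rw [map_smul, TensorProduct.lift.tmul, parOp_of_mem 𝒜 a.2, map_smul, smul_mul_assoc, smul_smul,
      ← sgn_add]
    rfl

/-- The comultiplication of L involves only entries of L, so agreement of all L_{cd} on generators
spreads to products. The induction includes a parity twist j because the Leibniz rule twists its
first argument. -/
theorem act_unique (hx : HalfGenerates x)
    (hm : ∀ α b, α.1 < 0 → x α b ∈ 𝒜 (par b + 1))
    (h : IsSupermoduleSuperalgebra n 𝒜 1 (LinearMap.mul K A) ρ)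
    (h' : IsSupermoduleSuperalgebra n 𝒜 1 (LinearMap.mul K A) ρ')
    (hg : ∀ α, α.1 < 0 → ∀ b c d, ρ (L n c d) (x α b) = ρ' (L n c d) (x α b)) : ρ = ρ' := by
  have key (a : A) (j : ZMod 2) (c d : Idx n) :
      ρ (L n c d) (parOp 𝒜 j a) = ρ' (L n c d) (parOp 𝒜 j a) := by
    induction a using hx.induction generalizing j c d with
    | hc r =>
      rw [Algebra.algebraMap_eq_smul_one, map_smul, map_smul, map_smul, parOp_one, h.act_one,
        h'.act_one]
    | hadd u v hu hv => simp only [map_add, hu, hv]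
    | hmul u v hu hv =>
      rw [parOp_mul, act_L_mul h, act_L_mul h']
      refine Finset.sum_congr rfl fun k _ => ?_
      rw [parOp_parOp, hu, hv]
    | ht α b hα => rw [parOp_of_mem 𝒜 (hm α b hα), map_smul, map_smul, hg α hα]
  refine LinearMap.ext fun u => ?_
  induction u using uq_induction with
  | hc r => rw [Algebra.algebraMap_eq_smul_one, map_smul, map_smul, h.one_act, h'.one_act]
  | hadd u v hu hv => rw [map_add, map_add, hu, hv]
  | hmul u v hu hv => rw [h.mul_act, h'.mul_act, hu, hv]
  | hL c d =>
    refine LinearMap.ext fun a => ?_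
    have := key a 0 c d
    rwa [parOp_zero] at this

end ActionUnique

/-! ### Equivariance of homomorphisms that send generators to generators -/

section Equivariance

variable {s m n : ℕ} {A C : Type} [Ring A] [Algebra K A] [Ring C] [Algebra K C]
  {𝒜 : ZMod 2 → Submodule K A} {𝒞 : ZMod 2 → Submodule K C}
  {x : Idx s → Idx n → A} {D : Idx n → Idx n → A →ₗ[K] A} {z : Idx m → Idx n → C}
  {E : Idx n → Idx n → C →ₗ[K] C} {f : A →ₐ[K] C} {ν : Idx s → Idx m}

/-- The transfer operators change only the column index of a generator, so a map that relabels rows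
commutes with them. Equivariance under `Uq n` follows. -/
theorem hom_transfer (hD : IsActionTransfer 𝒜 x D) (hE : IsActionTransfer 𝒞 z E)
    (hν : ∀ α, α.1 < 0 → (ν α).1 < 0) (hf : ∀ α b, α.1 < 0 → f (x α b) = z (ν α) b) (c d : Idx n)
    (u : A) : f (D c d u) = E c d (f u) := by
  induction u using hD.generates.induction generalizing c d with
  | hc r =>
    rw [hD.algebraMap_apply, AlgHom.commutes, hE.algebraMap_apply]
    split_ifs <;> simp
  | hadd u v hu hv => simp only [map_add, hu, hv]
  | hmul u v hu hv => simp only [hD.mul, map_sum, map_mul, hE.mul, hu, hv]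
  | ht α b hα =>
    rw [hD.gen α hα, hf α b hα, hE.gen _ (hν α hα)]
    refine (wop_map xi f.toLinearMap _ c b).symm.trans ?_
    refine congrArg (fun F => wop xi F c b) (funext fun k => funext fun c' => ?_)
    rw [AlgHom.toLinearMap_apply]
    split_ifs
    · exact hf α k hα
    · exact map_zero f

variable [GradedAlgebra 𝒜] [GradedAlgebra 𝒞]

theorem hom_parOp (hD : IsActionTransfer 𝒜 x D) (hE : IsActionTransfer 𝒞 z E)
    (hν : ∀ α, α.1 < 0 → (ν α).1 < 0) (hf : ∀ α b, α.1 < 0 → f (x α b) = z (ν α) b) (i : ZMod 2)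
    (u : A) : f (parOp 𝒜 i u) = parOp 𝒞 i (f u) := by
  induction u using hD.generates.induction with
  | hc r =>
    rw [Algebra.algebraMap_eq_smul_one, map_smul, map_smul, map_smul, map_smul, parOp_one,
      map_one f, parOp_one]
  | hadd u v hu hv => simp only [map_add, hu, hv]
  | hmul u v hu hv => rw [parOp_mul, map_mul, hu, hv, map_mul, parOp_mul]
  | ht α b hα =>
    rw [parOp_of_mem 𝒜 (hD.x_mem α b hα), map_smul, hf α b hα,
      parOp_of_mem 𝒞 (hE.x_mem _ b (hν α hα))]

theorem hom_mem (hD : IsActionTransfer 𝒜 x D) (hE : IsActionTransfer 𝒞 z E)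
    (hν : ∀ α, α.1 < 0 → (ν α).1 < 0) (hf : ∀ α b, α.1 < 0 → f (x α b) = z (ν α) b) (j : ZMod 2)
    (u : A) (hu : u ∈ 𝒜 j) : f u ∈ 𝒞 j := by
  refine mem_of_parOp 𝒞 ?_
  rw [← hom_parOp hD hE hν hf, parOp_of_mem 𝒜 hu, map_smul, one_mul]

theorem hom_uqAct (hD : IsActionTransfer 𝒜 x D) (hE : IsActionTransfer 𝒞 z E)
    (hν : ∀ α, α.1 < 0 → (ν α).1 < 0) (hf : ∀ α b, α.1 < 0 → f (x α b) = z (ν α) b) (u : Uq n)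
    (a : A) : f (uqAct hD.isActionData u a) = uqAct hE.isActionData u (f a) := by
  induction u using uq_induction generalizing a with
  | hc r => simp
  | hadd u v hu hv => simp only [map_add, LinearMap.add_apply, hu, hv]
  | hmul u v hu hv => rw [map_mul, map_mul, Module.End.mul_apply, Module.End.mul_apply, hu, hv]
  | hL c d =>
    rw [uqAct_L, uqAct_L, Lop, Lop, LinearMap.smul_apply, LinearMap.smul_apply, map_smul,
      LinearMap.comp_apply, LinearMap.comp_apply, hom_transfer hD hE hν hf, hom_parOp hD hE hν hf]

end Equivariance

/-! ### The action on the coordinate superalgebra -/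

section BarAction

variable {s n : ℕ}

theorem tbar_mem (α : Idx s) (b : Idx n) : tbar α b ∈ AbarGrading s n (par α + par b) :=
  ⟨_, freeGrading_ι tPar (α, b), rfl⟩

theorem par_of_neg {m : ℕ} {α : Idx m} (hα : α.1 < 0) : par α = 1 := by simp [par, hα.le]

theorem transfer_isActionTransfer : IsActionTransfer (AbarGrading s n)
    (tbar : Idx s → Idx n → Abar s n) (transfer s (rfl : xi * xi = xi * xi)) where
  generates := tbar_generates
  x_mem α b hα := by
    have h := tbar_mem α b
    rw [par_of_neg hα, add_comm] at h
    exact h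
  one := transfer_one rfl
  mul b c u v := transfer_mul rfl u v b c
  gen _ hα a b c := transfer_tbar rfl hα a b c
  rtt u c c' b b' := wop_transfer_transfer rfl u c c' b b'

/-- The action of `U_q(𝔮_n)` on `Ā_{s,n}`. -/
def barAct (s n : ℕ) : Uq n →ₗ[K] Module.End K (Abar s n) :=
  (uqAct (transfer_isActionTransfer (s := s) (n := n)).isActionData).toLinearMap

theorem Tbar_of_neg {α : Idx s} (hα : α.1 < 0) (b : Idx n) : Tbar s n b α = tbar α b := by
  have e : ∀ x : ZMod 2, x * (1 + x) = 0 := by decide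
  rw [Tbar, par_of_neg hα, e, sgn_zero, one_smul]

theorem Tbar_neg (α : Idx s) (b : Idx n) : Tbar s n (-b) (-α) = Tbar s n b α := by
  rw [Tbar, Tbar, tbar_sym α b, smul_smul, ← sgn_add, par_neg, par_neg]
  congr 2
  generalize par α = a1, par b = b1
  revert a1 b1; decide

theorem Sinv_neg (b c b' d : Idx n) : Sinv n (-b, c) (-b', d) = Sinv n (b, c) (b', d) := by
  simp only [Sinv, phi_neg_left, idx_neg_eq_iff, idx_neg_neg]
  rw [add_comm (ite (b = -d ∧ b' = -c) _ _)]

theorem barAct_isBarAction (s n : ℕ) : IsBarAction s n (barAct s n) where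
  toIsSupermoduleSuperalgebra := uqAct_isSupermoduleSuperalgebra _
  gen b c d α := by
    have key (b : Idx n) (α : Idx s) (hα : α.1 < 0) :
        sgn ((par c + par d) * (par b + par α)) • barAct s n (L n c d) (Tbar s n b α) =
          ∑ b' : Idx n, Sinv n (b, c) (b', d) • Tbar s n b' α := by
      rw [Tbar_of_neg hα, par_of_neg hα]
      simp only [Tbar_of_neg hα]
      exact transfer_isActionTransfer.uqAct_gen hα b c d
    rcases lt_or_gt_of_ne (idx_ne α) with hα | hα
    · exact key b α hα
    -- A positive row index is reduced to a negative one, since negating both indices of T̄ changes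
    -- nothing and S⁻¹ is invariant under negation in its first leg.
    · have h := key (-b) (-α) (by rw [neg_val]; omega)
      rw [Tbar_neg, par_neg, par_neg] at h
      have e : ∀ x y : ZMod 2, x + 1 + (y + 1) = x + y := by decide
      rw [e] at h
      rw [h]
      refine Fintype.sum_equiv (negEquiv n) _ _ fun b' => ?_
      change _ = Sinv n (b, c) (-b', d) • Tbar s n (-b') α
      rw [← Tbar_neg α (-b'), idx_neg_neg, ← Sinv_neg b c (-b') d, idx_neg_neg]

theorem barAct_unique {ρ : Uq n →ₗ[K] Module.End K (Abar s n)} (h : IsBarAction s n ρ) :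
    ρ = barAct s n := by
  refine act_unique tbar_generates transfer_isActionTransfer.x_mem h.toIsSupermoduleSuperalgebra
    (barAct_isBarAction s n).toIsSupermoduleSuperalgebra ?_
  intro α hα b c d
  have h1 := (h.gen b c d α).trans ((barAct_isBarAction s n).gen b c d α).symm
  rw [Tbar_of_neg hα] at h1
  have h2 := congrArg (fun v => sgn ((par c + par d) * (par b + par α)) • v) h1
  simpa only [smul_smul, ← sgn_add, add_self_two, sgn_zero, one_smul] using h2

end BarAction

/-! ### Pulling back the supermodule superalgebra axioms -/

section Transport

variable {n : ℕ} {V C : Type} [AddCommGroup V] [Module K V] [Ring C] [Algebra K C]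
  {𝒱 : ZMod 2 → Submodule K V} {𝒞 : ZMod 2 → Submodule K C} {e : V} {μ : V →ₗ[K] V →ₗ[K] V}
  {ρ : Uq n →ₗ[K] Module.End K V} {ρ' : Uq n →ₗ[K] Module.End K C} {σ : V →ₗ[K] C}

/-- The structure of a supermodule superalgebra is reflected by injective maps. -/
theorem isSupermoduleSuperalgebra_of_injective
    (h : IsSupermoduleSuperalgebra n 𝒞 1 (LinearMap.mul K C) ρ') (hσ : Function.Injective σ)
    (hi : DirectSum.IsInternal 𝒱) (hm : ∀ k w, w ∈ 𝒱 k ↔ σ w ∈ 𝒞 k) (he : σ e = 1)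
    (hμ : ∀ v w, σ (μ v w) = σ v * σ w) (hρ : ∀ u v, σ (ρ u v) = ρ' u (σ v)) :
    IsSupermoduleSuperalgebra n 𝒱 e μ ρ where
  internal := hi
  one_act := LinearMap.ext fun v => hσ (by
    rw [hρ, h.one_act, Module.End.one_apply, Module.End.one_apply])
  mul_act u v := LinearMap.ext fun w => hσ (by
    rw [hρ, h.mul_act, Module.End.mul_apply, Module.End.mul_apply, hρ, hρ])
  act_mem i j u hu x hx := by
    rw [hm, hρ]
    exact h.act_mem i j u hu _ ((hm j x).mp hx)
  one_mul x := hσ (by rw [hμ, he, _root_.one_mul])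
  mul_one x := hσ (by rw [hμ, he, _root_.mul_one])
  mul_assoc x y z := hσ (by rw [hμ, hμ, hμ, hμ, _root_.mul_assoc])
  one_mem := by
    rw [hm, he]
    exact h.one_mem
  mul_mem i j x hx y hy := by
    rw [hm, hμ]
    exact h.mul_mem i j _ ((hm i x).mp hx) _ ((hm j y).mp hy)
  act_mul u j a ha b := hσ (by
    rw [hρ, hμ]
    refine (h.act_mul u j _ ((hm j a).mp ha) (σ b)).trans ?_
    generalize DeltaTwist n j u = w
    induction w using TensorProduct.induction_on with
    | zero => simp
    | add w w' hw hw' => rw [map_add, map_add, map_add, hw, hw']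
    | tmul u v =>
      rw [TensorProduct.lift.tmul, TensorProduct.lift.tmul]
      change ρ' u (σ a) * ρ' v (σ b) = σ (μ (ρ u a) (ρ v b))
      rw [hμ, hρ, hρ])
  act_one u := hσ (by rw [hρ, he, h.act_one, map_smul, he])

end Transport

/-! ### Grading and action on a tensor product under the multiplication map -/

section TensorGrading

variable {A B C : Type} [Ring A] [Algebra K A] [Ring B] [Algebra K B] [Ring C] [Algebra K C]
  {𝒜 : ZMod 2 → Submodule K A} {ℬ : ZMod 2 → Submodule K B} {𝒞 : ZMod 2 → Submodule K C}
  {f : A →ₐ[K] C} {g : B →ₐ[K] C}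

theorem mulTensor_mem [SetLike.GradedMul 𝒞] (hf : ∀ j, ∀ u ∈ 𝒜 j, f u ∈ 𝒞 j) (hg : ∀ j, ∀ u ∈ ℬ j, g u ∈ 𝒞 j)
    {k : ZMod 2} {w : A ⊗[K] B} (hw : w ∈ tensorGrading 𝒜 ℬ k) : mulTensor f g w ∈ 𝒞 k := by
  induction hw using Submodule.span_induction with
  | mem w h =>
    obtain ⟨i, j, rfl, a, ha, b, hb, rfl⟩ := h
    exact SetLike.mul_mem_graded (hf i a ha) (hg j b hb)
  | zero => rw [map_zero]; exact Submodule.zero_mem _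
  | add u v _ _ hu hv => rw [map_add]; exact Submodule.add_mem _ hu hv
  | smul c u _ hu => rw [map_smul]; exact Submodule.smul_mem _ _ hu

theorem eq_zero_of_mem_of_mem [GradedAlgebra 𝒞] {u : C} {i j : ZMod 2} (hij : i ≠ j) (hi : u ∈ 𝒞 i) (hj : u ∈ 𝒞 j) :
    u = 0 := by
  have h1 := proj_of_mem 𝒞 hi i
  rw [proj_of_mem 𝒞 hj i, if_neg hij, if_pos rfl] at h1
  exact h1.symm

/-- Equivariance of the multiplication map is the super Leibniz rule in the target combined with
equivariance of f and g. -/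
theorem mulTensor_tensorAct [GradedAlgebra 𝒜] {n : ℕ} {ρA : Uq n →ₗ[K] Module.End K A} {ρB : Uq n →ₗ[K] Module.End K B}
    {ρC : Uq n →ₗ[K] Module.End K C}
    (h : IsSupermoduleSuperalgebra n 𝒞 1 (LinearMap.mul K C) ρC)
    (hf : ∀ j, ∀ u ∈ 𝒜 j, f u ∈ 𝒞 j) (hfρ : ∀ u a, f (ρA u a) = ρC u (f a))
    (hgρ : ∀ u a, g (ρB u a) = ρC u (g a)) (u : Uq n) (w : A ⊗[K] B) :
    mulTensor f g (tensorAct n 𝒜 ρA ρB u w) = ρC u (mulTensor f g w) := by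
  refine LinearMap.congr_fun (f := mulTensor f g ∘ₗ tensorAct n 𝒜 ρA ρB u)
    (g := ρC u ∘ₗ mulTensor f g) ?_ w
  refine tensor_ext_homogeneous 𝒜 fun j a ha b => ?_
  rw [LinearMap.comp_apply, LinearMap.comp_apply, tensorAct_tmul ρB u ha b]
  refine Eq.trans ?_ (h.act_mul u j _ (hf j a ha) (g b)).symm
  generalize DeltaTwist n j u = w
  induction w using TensorProduct.induction_on with
  | zero => simp
  | add w w' hw hw' => rw [map_add, map_add, map_add, hw, hw']
  | tmul u v =>
    rw [TensorProduct.lift.tmul, TensorProduct.lift.tmul]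
    change f (ρA u a) * g (ρB v b) = ρC u (f a) * ρC v (g b)
    rw [hfρ, hgρ]

variable [GradedAlgebra 𝒜] [GradedAlgebra ℬ]

variable (𝒜 ℬ) in
theorem tensorGrading_sup : tensorGrading 𝒜 ℬ 0 ⊔ tensorGrading 𝒜 ℬ 1 = ⊤ := by
  have key (k : ZMod 2) : tensorGrading 𝒜 ℬ k ≤ tensorGrading 𝒜 ℬ 0 ⊔ tensorGrading 𝒜 ℬ 1 := by
    have : ∀ x : ZMod 2, x = 0 ∨ x = 1 := by decide
    rcases this k with rfl | rfl
    · exact le_sup_left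
    · exact le_sup_right
  refine Submodule.eq_top_iff'.mpr fun w => ?_
  induction w using TensorProduct.induction_on with
  | zero => exact Submodule.zero_mem _
  | add w w' hw hw' => exact Submodule.add_mem _ hw hw'
  | tmul a b =>
    induction a using DirectSum.Decomposition.inductionOn 𝒜 with
    | zero => rw [TensorProduct.zero_tmul]; exact Submodule.zero_mem _
    | add a a' ha ha' => rw [TensorProduct.add_tmul]; exact Submodule.add_mem _ ha ha'
    | @homogeneous i a =>
      induction b using DirectSum.Decomposition.inductionOn ℬ with
      | zero => rw [TensorProduct.tmul_zero]; exact Submodule.zero_mem _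
      | add b b' hb hb' => rw [TensorProduct.tmul_add]; exact Submodule.add_mem _ hb hb'
      | @homogeneous j b =>
        exact key (i + j) (Submodule.subset_span ⟨i, j, rfl, a, a.2, b, b.2, rfl⟩)

variable [GradedAlgebra 𝒞]

/-- The two parts span, and an element of both is sent to an element of two different parities,
hence to zero; injectivity finishes. -/
theorem tensorGrading_isInternal (hf : ∀ j, ∀ u ∈ 𝒜 j, f u ∈ 𝒞 j)
    (hg : ∀ j, ∀ u ∈ ℬ j, g u ∈ 𝒞 j) (hσ : Function.Injective (mulTensor f g)) :
    DirectSum.IsInternal (tensorGrading 𝒜 ℬ) := by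
  rw [DirectSum.isInternal_submodule_iff_isCompl (i := 0) (j := 1) _ (by decide)
    (by ext x; have : ∀ x : ZMod 2, x = 0 ∨ x = 1 := by decide
        simpa using this x)]
  refine ⟨?_, codisjoint_iff.mpr (tensorGrading_sup 𝒜 ℬ)⟩
  rw [Submodule.disjoint_def]
  intro w h0 h1
  refine hσ ?_
  rw [map_zero]
  exact eq_zero_of_mem_of_mem (by decide : (0 : ZMod 2) ≠ 1) (mulTensor_mem hf hg h0)
    (mulTensor_mem hf hg h1)

theorem mem_tensorGrading_iff (hf : ∀ j, ∀ u ∈ 𝒜 j, f u ∈ 𝒞 j)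
    (hg : ∀ j, ∀ u ∈ ℬ j, g u ∈ 𝒞 j) (hσ : Function.Injective (mulTensor f g)) (k : ZMod 2)
    (w : A ⊗[K] B) : w ∈ tensorGrading 𝒜 ℬ k ↔ mulTensor f g w ∈ 𝒞 k := by
  refine ⟨mulTensor_mem hf hg, fun h => ?_⟩
  have hw : ∃ w₀ ∈ tensorGrading 𝒜 ℬ k, ∃ w₁ ∈ tensorGrading 𝒜 ℬ (k + 1), w₀ + w₁ = w := by
    have := Submodule.mem_top (R := K) (x := w)
    rw [← tensorGrading_sup 𝒜 ℬ, Submodule.mem_sup] at this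
    obtain ⟨w₀, h₀, w₁, h₁, e⟩ := this
    have h2 : ∀ x : ZMod 2, x = 0 ∨ x = 1 := by decide
    rcases h2 k with rfl | rfl
    · exact ⟨w₀, h₀, w₁, h₁, e⟩
    · exact ⟨w₁, h₁, w₀, h₀, by rw [add_comm, e]⟩
  obtain ⟨w₀, h₀, w₁, h₁, rfl⟩ := hw
  -- The component of the wrong parity has an image lying in both parities, so it is zero.
  have h3 : mulTensor f g w₁ ∈ 𝒞 k := by
    have := Submodule.sub_mem _ h (mulTensor_mem hf hg h₀)
    rwa [map_add, add_sub_cancel_left] at this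
  have h4 : w₁ = 0 := hσ (by
    rw [map_zero]
    have : ∀ k : ZMod 2, k ≠ k + 1 := by decide
    exact eq_zero_of_mem_of_mem (this k) h3 (mulTensor_mem hf hg h₁))
  rw [h4, add_zero]
  exact h₀

end TensorGrading

/-! ### Twistings of tensor products -/

section Braiding

variable {A B C : Type} [Ring A] [Algebra K A] [Ring B] [Algebra K B] [Ring C] [Algebra K C]
  {f : A →ₐ[K] C} {g : B →ₐ[K] C} {Θ : B ⊗[K] A →ₗ[K] A ⊗[K] B}

/-- `Θ` is compatible with the units and the multiplications. -/
structure IsTwisting (Θ : B ⊗[K] A →ₗ[K] A ⊗[K] B) : Prop where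
  braid_mul : Θ ∘ₗ (LinearMap.mul' K A).lTensor B =
    (LinearMap.mul' K A).rTensor B ∘ₗ (TensorProduct.assoc K A A B).symm.toLinearMap ∘ₗ
      Θ.lTensor A ∘ₗ (TensorProduct.assoc K A B A).toLinearMap ∘ₗ
      Θ.rTensor A ∘ₗ (TensorProduct.assoc K B A A).symm.toLinearMap
  mul_braid : Θ ∘ₗ (LinearMap.mul' K B).rTensor A =
    (LinearMap.mul' K B).lTensor A ∘ₗ (TensorProduct.assoc K A B B).toLinearMap ∘ₗ
      Θ.rTensor B ∘ₗ (TensorProduct.assoc K B A B).symm.toLinearMap ∘ₗ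
      Θ.lTensor B ∘ₗ (TensorProduct.assoc K B B A).toLinearMap
  one_tmul : ∀ x : A, Θ (1 ⊗ₜ[K] x) = x ⊗ₜ[K] 1
  tmul_one : ∀ y : B, Θ (y ⊗ₜ[K] 1) = 1 ⊗ₜ[K] y

/-- `x ⊗ y ⊗ x' ↦ (mul ⊗ 1)(x ⊗ Θ(y ⊗ x'))`. -/
def passRight (Θ : B ⊗[K] A →ₗ[K] A ⊗[K] B) : (A ⊗[K] B) ⊗[K] A →ₗ[K] A ⊗[K] B :=
  (LinearMap.mul' K A).rTensor B ∘ₗ (TensorProduct.assoc K A A B).symm.toLinearMap ∘ₗ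
    Θ.lTensor A ∘ₗ (TensorProduct.assoc K A B A).toLinearMap

/-- `y ⊗ x ⊗ y' ↦ (1 ⊗ mul)(Θ(y ⊗ x) ⊗ y')`. -/
def passLeft (Θ : B ⊗[K] A →ₗ[K] A ⊗[K] B) : B ⊗[K] (A ⊗[K] B) →ₗ[K] A ⊗[K] B :=
  (LinearMap.mul' K B).lTensor A ∘ₗ (TensorProduct.assoc K A B B).toLinearMap ∘ₗ
    Θ.rTensor B ∘ₗ (TensorProduct.assoc K B A B).symm.toLinearMap

/-- `x ⊗ w ↦ (mul ⊗ 1)(x ⊗ w)`. -/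
def mulFst (a : A) : A ⊗[K] B →ₗ[K] A ⊗[K] B := (LinearMap.mulLeft K a).rTensor B

/-- `w ⊗ y ↦ (1 ⊗ mul)(w ⊗ y)`. -/
def mulSnd (b : B) : A ⊗[K] B →ₗ[K] A ⊗[K] B := (LinearMap.mulRight K b).lTensor A

theorem rTensor_mul_assoc_symm (a : A) (w : A ⊗[K] B) :
    (LinearMap.mul' K A).rTensor B ((TensorProduct.assoc K A A B).symm (a ⊗ₜ[K] w)) = mulFst a w := by
  induction w using TensorProduct.induction_on with
  | zero => simp
  | add w w' hw hw' => rw [TensorProduct.tmul_add, map_add, map_add, map_add, hw, hw']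
  | tmul a' b => rfl

theorem lTensor_mul_assoc (w : A ⊗[K] B) (b : B) :
    (LinearMap.mul' K B).lTensor A (TensorProduct.assoc K A B B (w ⊗ₜ[K] b)) = mulSnd b w := by
  induction w using TensorProduct.induction_on with
  | zero => simp
  | add w w' hw hw' => rw [TensorProduct.add_tmul, map_add, map_add, map_add, hw, hw']
  | tmul a' b => rfl

theorem passRight_tmul (a a' : A) (b : B) :
    passRight Θ ((a ⊗ₜ[K] b) ⊗ₜ[K] a') = mulFst a (Θ (b ⊗ₜ[K] a')) :=
  rTensor_mul_assoc_symm a _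

theorem passLeft_tmul (a : A) (b b' : B) :
    passLeft Θ (b ⊗ₜ[K] (a ⊗ₜ[K] b')) = mulSnd b' (Θ (b ⊗ₜ[K] a)) :=
  lTensor_mul_assoc _ b'

theorem mulTensor_mulFst (a : A) (w : A ⊗[K] B) : mulTensor f g (mulFst a w) = f a * mulTensor f g w := by
  induction w using TensorProduct.induction_on with
  | zero => simp
  | add w w' hw hw' => rw [map_add, map_add, map_add, hw, hw', mul_add]
  | tmul a' b =>
    rw [mulTensor_tmul, ← mul_assoc, ← map_mul]
    rfl

theorem mulTensor_mulSnd (b : B) (w : A ⊗[K] B) : mulTensor f g (mulSnd b w) = mulTensor f g w * g b := by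
  induction w using TensorProduct.induction_on with
  | zero => simp
  | add w w' hw hw' => rw [map_add, map_add, map_add, hw, hw', add_mul]
  | tmul a' b =>
    rw [mulTensor_tmul, mul_assoc, ← map_mul]
    rfl

theorem IsTwisting.tmul_mul (hΘ : IsTwisting Θ) (b : B) (a a' : A) :
    Θ (b ⊗ₜ[K] (a * a')) = passRight Θ (Θ (b ⊗ₜ[K] a) ⊗ₜ[K] a') :=
  LinearMap.congr_fun hΘ.braid_mul (b ⊗ₜ[K] (a ⊗ₜ[K] a'))

theorem IsTwisting.mul_tmul (hΘ : IsTwisting Θ) (b b' : B) (a : A) :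
    Θ ((b * b') ⊗ₜ[K] a) = passLeft Θ (b ⊗ₜ[K] Θ (b' ⊗ₜ[K] a)) :=
  LinearMap.congr_fun hΘ.mul_braid ((b ⊗ₜ[K] b') ⊗ₜ[K] a)

theorem mulTensor_passRight (h : ∀ w, mulTensor f g (Θ w) = mulTensor g f w) (w : A ⊗[K] B) (a : A) :
    mulTensor f g (passRight Θ (w ⊗ₜ[K] a)) = mulTensor f g w * f a := by
  induction w using TensorProduct.induction_on with
  | zero => simp
  | add w w' hw hw' => rw [TensorProduct.add_tmul, map_add, map_add, map_add, hw, hw', add_mul]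
  | tmul a' b =>
    rw [passRight_tmul, mulTensor_mulFst, h, mulTensor_tmul, mulTensor_tmul, mul_assoc]

theorem mulTensor_passLeft (h : ∀ w, mulTensor f g (Θ w) = mulTensor g f w) (w : A ⊗[K] B) (b : B) :
    mulTensor f g (passLeft Θ (b ⊗ₜ[K] w)) = g b * mulTensor f g w := by
  induction w using TensorProduct.induction_on with
  | zero => simp
  | add w w' hw hw' => rw [TensorProduct.tmul_add, map_add, map_add, map_add, hw, hw', mul_add]
  | tmul a' b =>
    rw [passLeft_tmul, mulTensor_mulSnd, h, mulTensor_tmul, mulTensor_tmul, mul_assoc]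

/-- After applying the injective multiplication map, the hexagon type identities become
associativity in C and the unit conditions become unit laws. -/
theorem isTwisting_of_injective (hσ : Function.Injective (mulTensor f g))
    (h : ∀ w, mulTensor f g (Θ w) = mulTensor g f w) : IsTwisting Θ where
  braid_mul := by
    refine TensorProduct.ext (LinearMap.ext fun b => TensorProduct.ext' fun a a' => hσ ?_)
    change mulTensor f g (Θ (b ⊗ₜ[K] (a * a'))) =
      mulTensor f g (passRight Θ (Θ (b ⊗ₜ[K] a) ⊗ₜ[K] a'))
    rw [mulTensor_passRight h, h, h, mulTensor_tmul, mulTensor_tmul, map_mul, mul_assoc]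
  mul_braid := by
    refine TensorProduct.ext (TensorProduct.ext' fun b b' => LinearMap.ext fun a => hσ ?_)
    change mulTensor f g (Θ ((b * b') ⊗ₜ[K] a)) =
      mulTensor f g (passLeft Θ (b ⊗ₜ[K] Θ (b' ⊗ₜ[K] a)))
    rw [mulTensor_passLeft h, h, h, mulTensor_tmul, mulTensor_tmul, map_mul, mul_assoc]
  one_tmul a := hσ (by rw [h, mulTensor_tmul, mulTensor_tmul, map_one g, one_mul, mul_one])
  tmul_one a := hσ (by rw [h, mulTensor_tmul, mulTensor_tmul, map_one f, one_mul, mul_one])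

/-- The multiplication `(mul ⊗ mul) ∘ (1 ⊗ Θ ⊗ 1)`. -/
def twistedMul (Θ : B ⊗[K] A →ₗ[K] A ⊗[K] B) :
    A ⊗[K] B →ₗ[K] A ⊗[K] B →ₗ[K] A ⊗[K] B :=
  TensorProduct.curry
    (TensorProduct.map (LinearMap.mul' K A) (LinearMap.mul' K B) ∘ₗ
      (TensorProduct.assoc K A A (B ⊗[K] B)).symm.toLinearMap ∘ₗ
      ((TensorProduct.assoc K A B B).toLinearMap ∘ₗ Θ.rTensor B ∘ₗ
        (TensorProduct.assoc K B A B).symm.toLinearMap).lTensor A ∘ₗ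
      (TensorProduct.assoc K A B (A ⊗[K] B)).toLinearMap)

theorem map_mul_assoc_symm (a : A) (w : A ⊗[K] B) (b : B) :
    TensorProduct.map (LinearMap.mul' K A) (LinearMap.mul' K B)
      ((TensorProduct.assoc K A A (B ⊗[K] B)).symm (a ⊗ₜ[K] TensorProduct.assoc K A B B (w ⊗ₜ[K] b))) =
      mulFst a (mulSnd b w) := by
  induction w using TensorProduct.induction_on with
  | zero => simp
  | add w w' hw hw' =>
    rw [TensorProduct.add_tmul, map_add, TensorProduct.tmul_add, map_add, map_add, map_add, map_add,
      hw, hw']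
  | tmul a' b => rfl

/-- In C the twist replaces f(a)g(b)f(a')g(b') by a product with the middle factors rewritten,
without changing its value. -/
theorem mulTensor_twistedMul (h : ∀ w, mulTensor f g (Θ w) = mulTensor g f w) (w w' : A ⊗[K] B) :
    mulTensor f g (twistedMul Θ w w') = mulTensor f g w * mulTensor f g w' := by
  induction w using TensorProduct.induction_on with
  | zero => simp
  | add w v hw hv => rw [map_add, LinearMap.add_apply, map_add, map_add, hw, hv, add_mul]
  | tmul a b =>
    induction w' using TensorProduct.induction_on with
    | zero => simp
    | add w v hw hv => rw [map_add, map_add, map_add, hw, hv, mul_add]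
    | tmul a' b' =>
      refine (congrArg (mulTensor f g) (map_mul_assoc_symm a (Θ (b ⊗ₜ[K] a')) b')).trans ?_
      rw [mulTensor_mulFst, mulTensor_mulSnd, h, mulTensor_tmul, mulTensor_tmul, mulTensor_tmul]
      simp only [mul_assoc]

/-- A twisting is determined by its values on generators. -/
theorem IsTwisting.unique {s l n : ℕ} {x : Idx s → Idx n → A} {y : Idx l → Idx n → B}
    {D : Idx n → Idx n → A →ₗ[K] A} {Θ' : B ⊗[K] A →ₗ[K] A ⊗[K] B} (hx : HalfGenerates x)
    (hy : HalfGenerates y) (h : IsTwisting Θ) (h' : IsTwisting Θ')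
    (hΘ : ∀ β, β.1 < 0 → ∀ b a, Θ (y β b ⊗ₜ[K] a) = ∑ c, D b c a ⊗ₜ[K] y β c)
    (hg : ∀ β α, β.1 < 0 → α.1 < 0 → ∀ b a, Θ' (y β b ⊗ₜ[K] x α a) = Θ (y β b ⊗ₜ[K] x α a)) :
    Θ' = Θ := by
  -- The second argument is extended first. By `hΘ` the result of passing y_{βb} contains only
  -- generators y_{βc}, so the induction hypothesis, stated for all column indices, applies again.
  have h1 (β : Idx l) (hβ : β.1 < 0) (a : A) (b : Idx n) :
      Θ' (y β b ⊗ₜ[K] a) = Θ (y β b ⊗ₜ[K] a) := by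
    induction a using hx.induction generalizing b with
    | hc r =>
      rw [Algebra.algebraMap_eq_smul_one, TensorProduct.tmul_smul, map_smul, map_smul, h.tmul_one,
        h'.tmul_one]
    | hadd u v hu hv => rw [TensorProduct.tmul_add, map_add, map_add, hu, hv]
    | hmul u v hu hv =>
      rw [h.tmul_mul, h'.tmul_mul, hu, hΘ β hβ, TensorProduct.sum_tmul, map_sum, map_sum]
      refine Finset.sum_congr rfl fun c _ => ?_
      rw [passRight_tmul, passRight_tmul, hv]
    | ht α a hα => exact hg β α hβ hα b a
  refine TensorProduct.ext' fun b a => ?_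
  induction b using hy.induction generalizing a with
  | hc r =>
    rw [Algebra.algebraMap_eq_smul_one, ← TensorProduct.smul_tmul', map_smul, map_smul, h.one_tmul,
      h'.one_tmul]
  | hadd u v hu hv => rw [TensorProduct.add_tmul, map_add, map_add, hu, hv]
  | hmul u v hu hv =>
    rw [h.mul_tmul, h'.mul_tmul, hv]
    generalize Θ (v ⊗ₜ[K] a) = w
    induction w using TensorProduct.induction_on with
    | zero => simp
    | add w w' hw hw' => rw [TensorProduct.tmul_add, map_add, map_add, hw, hw']
    | tmul a b => rw [passLeft_tmul, passLeft_tmul, hu]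
  | ht β b hβ => exact h1 β hβ a b

end Braiding

/-! ### The braiding obtained from a factorization -/

section Exchange

variable {A B C : Type} [Ring A] [Algebra K A] [Ring B] [Algebra K B] [Ring C] [Algebra K C]
  {f : A →ₐ[K] C} {g : B →ₐ[K] C}

/-- The exchange of factors for an algebra factored as `C = f(A) g(B)`. -/
def exchange (hσ : Function.Bijective (mulTensor f g)) : B ⊗[K] A →ₗ[K] A ⊗[K] B :=
  (LinearEquiv.ofBijective _ hσ).symm.toLinearMap ∘ₗ mulTensor g f

theorem mulTensor_exchange (hσ : Function.Bijective (mulTensor f g)) (w : B ⊗[K] A) :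
    mulTensor f g (exchange hσ w) = mulTensor g f w :=
  (LinearEquiv.ofBijective _ hσ).apply_symm_apply _

variable {s l n : ℕ} {x : Idx s → Idx n → A} {y : Idx l → Idx n → B} {z : Idx (s + l) → Idx n → C}

theorem exchange_tmul {D : Idx n → Idx n → A →ₗ[K] A} (hσ : Function.Bijective (mulTensor f g))
    (hz : HalfRel z) (hx : HalfGenerates x) (hD : IsTransfer x D)
    (hf : ∀ α a, α.1 < 0 → f (x α a) = z (shiftL s l α) a)
    (hg : ∀ β b, β.1 < 0 → g (y β b) = z (shiftR s l β) b) (β : Idx l) (hβ : β.1 < 0) (b : Idx n)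
    (a : A) : exchange hσ (y β b ⊗ₜ[K] a) = ∑ c, D b c a ⊗ₜ[K] y β c := by
  refine hσ.injective ?_
  rw [mulTensor_exchange, mulTensor_tmul, map_sum, hg β b hβ, mul_eq_sum_transfer hz hx hD f hf hβ]
  simp only [mulTensor_tmul, hg β _ hβ]

/-- Under the multiplication map this is the mixed quadratic relation of the large algebra, with w
rewritten in terms of S. -/
theorem exchange_gen (hσ : Function.Bijective (mulTensor f g)) (hz : HalfRel z)
    (hf : ∀ α a, α.1 < 0 → f (x α a) = z (shiftL s l α) a)
    (hg : ∀ β b, β.1 < 0 → g (y β b) = z (shiftR s l β) b) (β : Idx l) (α : Idx s) (hβ : β.1 < 0)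
    (hα : α.1 < 0) (b a : Idx n) :
    sgn ((par b + par β) * (par a + par α)) • exchange hσ (y β b ⊗ₜ[K] x α a) =
      ∑ b' : Idx n, ∑ a' : Idx n,
        (S n (b, a) (b', a') * sgn ((par a + par a') * (par b' + par β))) •
          (x α a' ⊗ₜ[K] y β b') := by
  refine hσ.injective ?_
  have h := hz (shiftR s l β) (shiftL s l α) ((shift_neg_iff _ _ _).mpr hβ)
    ((shift_neg_iff _ _ _).mpr hα) b a
  rw [if_neg (fun h => (shiftL_lt_shiftR (β := β) hα).ne (by rw [h])),
    if_neg (shiftL_lt_shiftR hα).not_gt, one_smul, zero_smul, sub_zero, wop_zero_eq_sum_S] at h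
  rw [map_smul, mulTensor_exchange, mulTensor_tmul, hg β b hβ, hf α a hα, h, smul_smul, ← sgn_add,
    par_of_neg hα, par_of_neg hβ, add_self_two, sgn_zero, one_smul, Fintype.sum_prod_type, map_sum]
  refine Finset.sum_congr rfl fun b' _ => ?_
  rw [map_sum]
  refine Finset.sum_congr rfl fun a' _ => ?_
  rw [map_smul, mulTensor_tmul, hf α a' hα, hg β b' hβ, mul_smul]
  refine S_smul_congr fun hp => ?_
  congr 2
  simp only at hp ⊢
  clear h
  generalize par a = a1, par a' = a2, par b = b1, par b' = b2 at *
  revert a1 a2 b1 b2; decide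

variable {𝒜 : ZMod 2 → Submodule K A} [GradedAlgebra 𝒜] {ℬ : ZMod 2 → Submodule K B}
  {𝒞 : ZMod 2 → Submodule K C} [GradedAlgebra 𝒞]
  {ρA : Uq n →ₗ[K] Module.End K A} {ρB : Uq n →ₗ[K] Module.End K B} {ρC : Uq n →ₗ[K] Module.End K C}

theorem mulTensor_isSupermoduleSuperalgebraIso (hσ : Function.Bijective (mulTensor f g))
    (h : IsSupermoduleSuperalgebra n 𝒞 1 (LinearMap.mul K C) ρC)
    (hf : ∀ j, ∀ u ∈ 𝒜 j, f u ∈ 𝒞 j) (hg : ∀ j, ∀ u ∈ ℬ j, g u ∈ 𝒞 j)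
    (hfρ : ∀ u a, f (ρA u a) = ρC u (f a)) (hgρ : ∀ u a, g (ρB u a) = ρC u (g a)) :
    IsSupermoduleSuperalgebraIso n (tensorGrading 𝒜 ℬ) (1 ⊗ₜ[K] 1) (twistedMul (exchange hσ))
      (tensorAct n 𝒜 ρA ρB) 𝒞 1 (LinearMap.mul K C) ρC (mulTensor f g) where
  map_mem _ _ hw := mulTensor_mem hf hg hw
  map_act := mulTensor_tensorAct h hf hfρ hgρ
  map_one := by rw [mulTensor_tmul, _root_.map_one, _root_.map_one, one_mul]
  map_mul := mulTensor_twistedMul (mulTensor_exchange hσ)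
  bijective := hσ

variable [GradedAlgebra ℬ]

theorem exchange_isSupermoduleHom (hσ : Function.Bijective (mulTensor f g))
    (h : IsSupermoduleSuperalgebra n 𝒞 1 (LinearMap.mul K C) ρC)
    (hf : ∀ j, ∀ u ∈ 𝒜 j, f u ∈ 𝒞 j) (hg : ∀ j, ∀ u ∈ ℬ j, g u ∈ 𝒞 j)
    (hfρ : ∀ u a, f (ρA u a) = ρC u (f a)) (hgρ : ∀ u a, g (ρB u a) = ρC u (g a)) :
    IsSupermoduleHom n (tensorGrading ℬ 𝒜) (tensorAct n ℬ ρB ρA) (tensorGrading 𝒜 ℬ)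
      (tensorAct n 𝒜 ρA ρB) (exchange hσ) where
  map_mem i w hw := by
    rw [mem_tensorGrading_iff hf hg hσ.injective, mulTensor_exchange]
    exact mulTensor_mem hg hf hw
  map_act u w := hσ.injective (by
    rw [mulTensor_exchange, mulTensor_tensorAct h hg hgρ hfρ, mulTensor_tensorAct h hf hfρ hgρ,
      mulTensor_exchange])

theorem twistedMul_isSupermoduleSuperalgebra (hσ : Function.Bijective (mulTensor f g))
    (h : IsSupermoduleSuperalgebra n 𝒞 1 (LinearMap.mul K C) ρC)
    (hf : ∀ j, ∀ u ∈ 𝒜 j, f u ∈ 𝒞 j) (hg : ∀ j, ∀ u ∈ ℬ j, g u ∈ 𝒞 j)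
    (hfρ : ∀ u a, f (ρA u a) = ρC u (f a)) (hgρ : ∀ u a, g (ρB u a) = ρC u (g a)) :
    IsSupermoduleSuperalgebra n (tensorGrading 𝒜 ℬ) (1 ⊗ₜ[K] 1) (twistedMul (exchange hσ))
      (tensorAct n 𝒜 ρA ρB) :=
  isSupermoduleSuperalgebra_of_injective h hσ.injective
    (tensorGrading_isInternal hf hg hσ.injective) (mem_tensorGrading_iff hf hg hσ.injective)
    (by rw [mulTensor_tmul, map_one, map_one, one_mul])
    (mulTensor_twistedMul (mulTensor_exchange hσ)) (mulTensor_tensorAct h hf hfρ hgρ)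

end Exchange

/-! ### The braiding of coordinate superalgebras -/

section Braided

variable (n s l : ℕ)

theorem mulTensor_iotaBar_bijective : Function.Bijective (mulTensor
    (iotaBar l le_rfl n : Abar s n →ₐ[K] Abar (s + l) n)
    (iotaBar 0 (Nat.le_add_left l s) n : Abar l n →ₐ[K] Abar (s + l) n)) :=
  mulTensor_bijective tbar_half tbar_generates transfer_isTransfer tbar_half tbar_generates
    (iotaBar l le_rfl n) (fun α a _ => iotaBar_tbar _ _ α a)
    (iotaBar 0 (Nat.le_add_left l s) n) (fun α a _ => iotaBar_tbar _ _ α a)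

/-- The braiding of `Ā_{l,n}` and `Ā_{s,n}`. -/
def barBraiding : Abar l n ⊗[K] Abar s n →ₗ[K] Abar s n ⊗[K] Abar l n :=
  exchange (mulTensor_iotaBar_bijective n s l)

variable {n s}

theorem iotaBar_mem {m : ℕ} (p : ℕ) (h : s + p ≤ m) (j : ZMod 2) (u : Abar s n)
    (hu : u ∈ AbarGrading s n j) : iotaBar p h n u ∈ AbarGrading m n j :=
  hom_mem transfer_isActionTransfer transfer_isActionTransfer
    (fun α hα => (shift_neg_iff p h α).mpr hα) (fun α b _ => iotaBar_tbar p h α b) j u hu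

theorem iotaBar_barAct {m : ℕ} (p : ℕ) (h : s + p ≤ m) (u : Uq n) (a : Abar s n) :
    iotaBar p h n (barAct s n u a) = barAct m n u (iotaBar p h n a) :=
  hom_uqAct transfer_isActionTransfer transfer_isActionTransfer
    (fun α hα => (shift_neg_iff p h α).mpr hα) (fun α b _ => iotaBar_tbar p h α b) u a

variable (n s)

theorem barBraiding_isTwisting : IsTwisting (barBraiding n s l) :=
  isTwisting_of_injective (mulTensor_iotaBar_bijective n s l).injective
    (mulTensor_exchange (mulTensor_iotaBar_bijective n s l))

theorem barBraiding_isBraiding :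
    IsBraiding n s l (barAct s n) (barAct l n) (barBraiding n s l) where
  toIsSupermoduleHom := exchange_isSupermoduleHom (mulTensor_iotaBar_bijective n s l)
    (barAct_isBarAction (s + l) n).toIsSupermoduleSuperalgebra (iotaBar_mem _ _) (iotaBar_mem _ _)
    (iotaBar_barAct _ _) (iotaBar_barAct _ _)
  braid_mul := (barBraiding_isTwisting n s l).braid_mul
  mul_braid := (barBraiding_isTwisting n s l).mul_braid
  one_tmul := (barBraiding_isTwisting n s l).one_tmul
  tmul_one := (barBraiding_isTwisting n s l).tmul_one
  gen := exchange_gen (mulTensor_iotaBar_bijective n s l) tbar_half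
    (fun α a _ => iotaBar_tbar _ _ α a) (fun α a _ => iotaBar_tbar _ _ α a)

variable {n s l}

theorem barBraiding_unique {Θ : Abar l n ⊗[K] Abar s n →ₗ[K] Abar s n ⊗[K] Abar l n}
    (h : IsBraiding n s l (barAct s n) (barAct l n) Θ) : Θ = barBraiding n s l := by
  refine IsTwisting.unique tbar_generates tbar_generates (barBraiding_isTwisting n s l)
    ⟨h.braid_mul, h.mul_braid, h.one_tmul, h.tmul_one⟩
    (exchange_tmul (mulTensor_iotaBar_bijective n s l) tbar_half tbar_generates transfer_isTransfer
      (fun α a _ => iotaBar_tbar _ _ α a) (fun α a _ => iotaBar_tbar _ _ α a)) ?_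
  intro β α hβ hα b a
  have h1 := (h.gen β α hβ hα b a).trans ((barBraiding_isBraiding n s l).gen β α hβ hα b a).symm
  have h2 := congrArg (fun v => sgn ((par b + par β) * (par a + par α)) • v) h1
  simpa only [smul_smul, ← sgn_add, add_self_two, sgn_zero, one_smul] using h2

end Braided
end QuantumQueer
end

/-! ### The main theorem -/

open QuantumQueer in
theorem mainTheorem5 (n s l : ℕ) :
    ∃ Φ : ∀ m : ℕ, Uq n →ₗ[K] Module.End K (Abar m n),
      (∀ m, IsBarAction m n (Φ m) ∧ ∀ ρ, IsBarAction m n ρ → ρ = Φ m) ∧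
      ∃ Θ : Abar l n ⊗[K] Abar s n →ₗ[K] Abar s n ⊗[K] Abar l n,
        (IsBraiding n s l (Φ s) (Φ l) Θ ∧
          ∀ Θ', IsBraiding n s l (Φ s) (Φ l) Θ' → Θ' = Θ) ∧
        IsSupermoduleSuperalgebra n
          (tensorGrading (AbarGrading s n) (AbarGrading l n)) (1 ⊗ₜ[K] 1) (braidedMul Θ)
          (tensorAct n (AbarGrading s n) (Φ s) (Φ l)) ∧
        IsSupermoduleSuperalgebraIso n
          (tensorGrading (AbarGrading s n) (AbarGrading l n)) (1 ⊗ₜ[K] 1) (braidedMul Θ)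
          (tensorAct n (AbarGrading s n) (Φ s) (Φ l))
          (AbarGrading (s + l) n) 1 (LinearMap.mul K (Abar (s + l) n)) (Φ (s + l))
          (sigmaBar n s l) := by
  refine ⟨fun m => barAct m n, fun m => ⟨barAct_isBarAction m n, fun ρ h => barAct_unique h⟩,
    barBraiding n s l, ⟨barBraiding_isBraiding n s l, fun Θ' h => barBraiding_unique h⟩, ?_, ?_⟩
  -- `braidedMul` and `sigmaBar` agree by definition with `twistedMul` and `mulTensor` for the two
  -- embeddings ῑ, so the general results apply directly.
  · exact twistedMul_isSupermoduleSuperalgebra (mulTensor_iotaBar_bijective n s l)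
      (barAct_isBarAction (s + l) n).toIsSupermoduleSuperalgebra (iotaBar_mem _ _) (iotaBar_mem _ _)
      (iotaBar_barAct _ _) (iotaBar_barAct _ _)
  · exact mulTensor_isSupermoduleSuperalgebraIso (mulTensor_iotaBar_bijective n s l)
      (barAct_isBarAction (s + l) n).toIsSupermoduleSuperalgebra (iotaBar_mem _ _) (iotaBar_mem _ _)
      (iotaBar_barAct _ _) (iotaBar_barAct _ _)
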